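/- Work in the Calculus of Dependent Lambda Eliminations (CDLE): the extrinsically typed, impredicative Calculus of Constructions with implicit products $\forall x{:}T.\,T'$ (written $T\Rightarrow T'$ if non-dependent), dependent intersections $\iota x{:}T.\,T'$ and equality types $\{t\simeq t'\}$ over untyped terms, presented by annotated terms with the bidirectional judgments $\Gamma\vdash T\Rightarrow\kappa$, $\Gamma\vdash t\Rightarrow T$, $\Gamma\vdash t\Leftarrow T$, an erasure $|t|$ to untyped $\lambda$-terms, and conversion of types modulo $\beta\eta$-equality $=_{\beta\eta}$ of erased terms. A closed definition $x : T = t$ is accepted if $\vdash T\Rightarrow\star$ and $\vdash t\Leftarrow T$. The binder $\forall x{:}T$ is an erased argument, written $-t$ in applications; $\cdot$ is application to a type; $\beta\{t\}$ proves $\{t_1\simeq t_2\}$ whenever $|t_1|=_{\beta\eta}|t_2|$ and erases to $|t|$, for any well-scoped $t$. Definitions. $\mathit{Top}=\{\lambda x.x\simeq\lambda x.x\}$; $\mathit{View}\cdot T\,t=\iota x{:}T.\{x\simeq t\}$ for $t:\mathit{Top}$; $\mathit{Cast}\cdot S\cdot T=\mathit{View}\cdot(S\to T)\ \beta\{\lambda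 x.x\}$. For $F:\star\to\star$: $\mathit{Mono}\cdot F=\forall X{:}\star.\forall Y{:}\star.\,\mathit{Cast}\cdot X\cdot Y\to\mathit{Cast}\cdot(F\cdot X)\cdot(F\cdot Y)$ and $\mathit{Rec}\cdot F=\forall X{:}\star.\,\mathit{Cast}\cdot(F\cdot X)\cdot X\Rightarrow X$. *Generic Scott encoding.* $\mathit{DF}\cdot D=\forall X{:}\star.(F\cdot D\to X)\to X$, with constructor $\mathit{inDF}=\lambda xs.\Lambda X.\lambda a.\,a\ xs$; $\mathit{WkIndDF}\cdot D\ x=\forall P{:}\mathit{DF}\cdot D\to\star.\,(\Pi xs{:}F\cdot D.\,P\,(\mathit{inDF}\ xs))\to P\,x$; $\mathit{DFI}\cdot D=\iota x{:}\mathit{DF}\cdot D.\,\mathit{WkIndDF}\cdot D\ x$; $\mathit{S.D}=\mathit{Rec}\cdot\mathit{DFI}$. For $\mathit{mono}:\mathit{Mono}\cdot F$, the constructor is $\mathit{S.inD}:F\cdot\mathit{S.D}\to\mathit{S.D}$, $\mathit{S.inD}=\lambda xs.\,\mathit{roll}\,[\mathit{inDF}\,xs,\ \Lambda P.\lambda a.\,a\,xs]$,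 where $\mathit{roll}:\mathit{DFI}\cdot\mathit{S.D}\to\mathit{S.D}$ is the rolling function of $\mathit{Rec}$ ($|\mathit{roll}|=_{\beta\eta}\lambda x.x$). *Generic dependent Lepigre–Raffalli encoding* (for $F$ and $\mathit{mono}:\mathit{Mono}\cdot F$). For $P:\mathit{S.D}\to\star$ let $\mathit{DRec}\cdot P\,x\cdot Y=Y\to Y\to P\,x$ and $$\mathit{PrfAlgLR}\cdot P=\forall Y{:}\star.\,\Pi xs{:}F\cdot(\iota x{:}\mathit{S.D}.\,\mathit{DRec}\cdot P\,x\cdot Y).\;Y\to P\,(\mathit{inDRec}\ xs),$$ where $\mathit{inDRec}\ xs$ is $\mathit{S.inD}$ applied to $xs$ cast, by monotonicity of $F$, to the type $F\cdot\mathit{S.D}$. Put $\mathit{LR.D}=\iota x{:}\mathit{S.D}.\,\forall P{:}\mathit{S.D}\to\star.\,\mathit{DRec}\cdot P\,x\cdot(\mathit{PrfAlgLR}\cdot P)$. *Functors.* $\mathit{Fmap}\cdot F=\forall X{:}\star.\forall Y{:}\star.(X\to Y)\to F\cdot X\to F\cdot Y$. For $\mathit{fmap}:\mathit{Fmap}\cdot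 F$, $\mathit{FmapId}=\forall X.\forall Y.\Pi c{:}X\to Y.(\Pi x{:}X.\{c\,x\simeq x\})\to\Pi x{:}F\cdot X.\{\mathit{fmap}\ c\ x\simeq x\}$ and $\mathit{FmapCompose}=\forall X.\forall Y.\forall Z.\Pi f{:}Y\to Z.\Pi g{:}X\to Y.\Pi x{:}F\cdot X.\{\mathit{fmap}\,f\,(\mathit{fmap}\,g\,x)\simeq\mathit{fmap}\,(\lambda x.f\,(g\,x))\,x\}$. A functor is monotone: $\mathit{fmap}$ and the identity law give $\mathit{monoFunctor}:\mathit{Mono}\cdot F$, which is the monotonicity proof used for $\mathit{S.inD}$ below. With $\mathit{Sigma}$ the type of dependent pairs derived in CDLE and $\mathit{proj1}$ its first projection, $$\mathit{PrfAlgRec}\cdot P=\Pi xs{:}F\cdot(\mathit{Sigma}\cdot\mathit{S.D}\cdot P).\;P\,(\mathit{S.inD}\,(\mathit{fmap}\ \mathit{proj1}\ xs)).$$ **Theorem.** The following hold in CDLE. 1. (Inclusion of Scott-encoded data in the Lepigre–Raffalli encoding.) There is an accepted closed definition $\mathit{toD}$ of type $\forall F{:}\star\to\star.\ \forall\mathit{mono}{:}\mathit{Mono}\cdot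 F.\ \mathit{Cast}\cdot\mathit{S.D}\cdot\mathit{LR.D}$. Moreover every Scott-encoded value has type $\mathit{LR.D}$ up to definitional equality: for every context $\Gamma$, every $F$ with $\Gamma\vdash F\Rightarrow\star\to\star$, every $m$ with $\Gamma\vdash m\Leftarrow\mathit{Mono}\cdot F$ and every $s$ with $\Gamma\vdash s\Leftarrow\mathit{S.D}$ there is a term $s'$ with $\Gamma\vdash s'\Rightarrow\mathit{LR.D}$ and $|s'|=_{\beta\eta}|s|$. 2. (Lepigre–Raffalli-style induction.) There is an accepted closed definition $\mathit{indLRD}$ of type $$\forall F{:}\star\to\star.\ \forall\mathit{mono}{:}\mathit{Mono}\cdot F.\ \forall P{:}\mathit{S.D}\to\star.\ \mathit{PrfAlgLR}\cdot P\to\Pi x{:}\mathit{S.D}.\ \mathit{PrfAlgLR}\cdot P\to P\,x.$$ 3. (Standard induction.) There is an accepted closed definition $\mathit{indD}$ of type $$\forall F{:}\star\to\star.\ \Pi\mathit{fmap}{:}\mathit{Fmap}\cdot F.\ \forall\mathit{fmapId}{:}\mathit{FmapId}\ \mathit{fmap}.\ \forall\mathit{fmapCompose}{:}\mathit{FmapCompose}\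 \mathit{fmap}.\ \forall P{:}\mathit{S.D}\to\star.\ \mathit{PrfAlgRec}\cdot P\to\Pi x{:}\mathit{S.D}.\ P\,x.$$ -/

import Mathlib

/-
The Calculus of Dependent Lambda Eliminations (CDLE): syntax, erasure, conversion and the
bidirectional typing rules, followed by the Cedille definitions that occur in the theorem.

Binding is by de Bruijn indices.  Term variables and type variables are counted separately, so
`Tm.var n` is bound by the `n`-th enclosing binder of a term variable and `Ty.var n` by the
`n`-th enclosing binder of a type variable.
-/

namespace CDLE

/-! ### Untyped lambda terms and their conversion -/

/-- Terms of the untyped lambda calculus. -/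
inductive Pure : Type
  | var (n : ℕ)
  | lam (t : Pure)
  | app (t u : Pure)

/-- Put `a` in front of the sequence `s`. -/
def scons {α : Type} (a : α) (s : ℕ → α) : ℕ → α
  | 0 => a
  | n + 1 => s n

/-- Lift a renaming under a binder. -/
def upRen (r : ℕ → ℕ) : ℕ → ℕ := scons 0 (fun n => r n + 1)

namespace Pure

def rename : (ℕ → ℕ) → Pure → Pure
  | r, var n => var (r n)
  | r, lam t => lam (rename (upRen r) t)
  | r, app t u => app (rename r t) (rename r u)

/-- Capture-avoiding parallel substitution. -/
def subst : (ℕ → Pure) → Pure → Pure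
  | s, var n => s n
  | s, lam t => lam (subst (scons (var 0) (fun n => rename Nat.succ (s n))) t)
  | s, app t u => app (subst s t) (subst s u)

/-- `[u/x]t`, where `x` is the variable of index `0` in `t`. -/
def inst (t u : Pure) : Pure := subst (scons u var) t

/-- `Free n t`: the variable of index `n` occurs free in `t`. -/
def Free : ℕ → Pure → Prop
  | n, var m => n = m
  | n, lam t => Free (n + 1) t
  | n, app t u => Free n t ∨ Free n u

/-- The untyped identity function. -/
def id : Pure := lam (var 0)

end Pure

/-- Beta-eta-conversion of untyped lambda terms. -/
inductive BetaEta : Pure → Pure → Prop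
  | beta (t u : Pure) : BetaEta (.app (.lam t) u) (t.inst u)
  | eta (t : Pure) : BetaEta (.lam (.app (t.rename Nat.succ) (.var 0))) t
  | lam {t t' : Pure} : BetaEta t t' → BetaEta (.lam t) (.lam t')
  | app {t t' u u' : Pure} : BetaEta t t' → BetaEta u u' → BetaEta (.app t u) (.app t' u')
  | refl (t : Pure) : BetaEta t t
  | symm {t u : Pure} : BetaEta t u → BetaEta u t
  | trans {t u v : Pure} : BetaEta t u → BetaEta u v → BetaEta t v

/-! ### Kinds, types and annotated terms -/

mutual

/-- Kinds. -/
inductive Kd : Type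
  /-- `★` -/
  | star
  /-- `Π x: T. κ` -/
  | piTm (T : Ty) (k : Kd)
  /-- `Π X: κ'. κ` -/
  | piTy (k' k : Kd)

/-- Type constructors. -/
inductive Ty : Type
  /-- `X` -/
  | var (n : ℕ)
  /-- `∀ X: κ. T` -/
  | allTy (k : Kd) (T : Ty)
  /-- `∀ x: T. T'`, the implicit product -/
  | allTm (T T' : Ty)
  /-- `Π x: T. T'` -/
  | pi (T T' : Ty)
  /-- `λ x: T. T'` -/
  | lamTm (T T' : Ty)
  /-- `λ X: κ. T` -/
  | lamTy (k : Kd) (T : Ty)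
  /-- `T t` -/
  | appTm (T : Ty) (t : Tm)
  /-- `T ·T'` -/
  | appTy (T T' : Ty)
  /-- `ι x: T. T'`, the dependent intersection -/
  | iota (T T' : Ty)
  /-- `{ t ≃ t' }` -/
  | eq (t t' : Tm)

/-- Annotated terms. -/
inductive Tm : Type
  /-- `x` -/
  | var (n : ℕ)
  /-- `λ x. t` -/
  | lam (t : Tm)
  /-- `t t'` -/
  | app (t t' : Tm)
  /-- `Λ X. t`, abstraction over a type -/
  | lamTy (t : Tm)
  /-- `t ·T` -/
  | appTy (t : Tm) (T : Ty)
  /-- `Λ x. t`, abstraction over an erased term argument -/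
  | lamE (t : Tm)
  /-- `t -t'` -/
  | appE (t t' : Tm)
  /-- `[t, t']` -/
  | pair (t t' : Tm)
  /-- `t.1` -/
  | fst (t : Tm)
  /-- `t.2` -/
  | snd (t : Tm)
  /-- `β{t}` -/
  | beta (t : Tm)
  /-- `ρ t @x.T' - t'`, where `x` is bound in `T'` -/
  | rho (t : Tm) (T' : Ty) (t' : Tm)
  /-- `φ t - t' {t''}` -/
  | phi (t t' t'' : Tm)
  /-- `χ T - t` -/
  | chi (T : Ty) (t : Tm)
  /-- `[x ◂ T₁ = t₁] - t₂`, where `x` is bound in `t₂` -/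
  | letIn (T₁ : Ty) (t₁ t₂ : Tm)
  /-- `δ - t` -/
  | delta (t : Tm)
  /-- `ς t` -/
  | sym (t : Tm)

end

/-! ### Renaming and substitution

`r` acts on term variables and `q` on type variables. -/

mutual

def Kd.rename : (ℕ → ℕ) → (ℕ → ℕ) → Kd → Kd
  | _, _, .star => .star
  | r, q, .piTm T k => .piTm (T.rename r q) (k.rename (upRen r) q)
  | r, q, .piTy k' k => .piTy (k'.rename r q) (k.rename r (upRen q))

def Ty.rename : (ℕ → ℕ) → (ℕ → ℕ) → Ty → Ty
  | _, q, .var n => .var (q n)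
  | r, q, .allTy k T => .allTy (k.rename r q) (T.rename r (upRen q))
  | r, q, .allTm T T' => .allTm (T.rename r q) (T'.rename (upRen r) q)
  | r, q, .pi T T' => .pi (T.rename r q) (T'.rename (upRen r) q)
  | r, q, .lamTm T T' => .lamTm (T.rename r q) (T'.rename (upRen r) q)
  | r, q, .lamTy k T => .lamTy (k.rename r q) (T.rename r (upRen q))
  | r, q, .appTm T t => .appTm (T.rename r q) (t.rename r q)
  | r, q, .appTy T T' => .appTy (T.rename r q) (T'.rename r q)
  | r, q, .iota T T' => .iota (T.rename r q) (T'.rename (upRen r) q)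
  | r, q, .eq t t' => .eq (t.rename r q) (t'.rename r q)

def Tm.rename : (ℕ → ℕ) → (ℕ → ℕ) → Tm → Tm
  | r, _, .var n => .var (r n)
  | r, q, .lam t => .lam (t.rename (upRen r) q)
  | r, q, .app t t' => .app (t.rename r q) (t'.rename r q)
  | r, q, .lamTy t => .lamTy (t.rename r (upRen q))
  | r, q, .appTy t T => .appTy (t.rename r q) (T.rename r q)
  | r, q, .lamE t => .lamE (t.rename (upRen r) q)
  | r, q, .appE t t' => .appE (t.rename r q) (t'.rename r q)
  | r, q, .pair t t' => .pair (t.rename r q) (t'.rename r q)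
  | r, q, .fst t => .fst (t.rename r q)
  | r, q, .snd t => .snd (t.rename r q)
  | r, q, .beta t => .beta (t.rename r q)
  | r, q, .rho t T' t' => .rho (t.rename r q) (T'.rename (upRen r) q) (t'.rename r q)
  | r, q, .phi t t' t'' => .phi (t.rename r q) (t'.rename r q) (t''.rename r q)
  | r, q, .chi T t => .chi (T.rename r q) (t.rename r q)
  | r, q, .letIn T₁ t₁ t₂ => .letIn (T₁.rename r q) (t₁.rename r q) (t₂.rename (upRen r) q)
  | r, q, .delta t => .delta (t.rename r q)
  | r, q, .sym t => .sym (t.rename r q)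

end

/-- Weakening by a term variable. -/
def Kd.wkTm (k : Kd) : Kd := k.rename Nat.succ (fun n => n)
/-- Weakening by a type variable. -/
def Kd.wkTy (k : Kd) : Kd := k.rename (fun n => n) Nat.succ
/-- Weakening by a term variable. -/
def Ty.wkTm (T : Ty) : Ty := T.rename Nat.succ (fun n => n)
/-- Weakening by a type variable. -/
def Ty.wkTy (T : Ty) : Ty := T.rename (fun n => n) Nat.succ
/-- Weakening by a term variable. -/
def Tm.wkTm (t : Tm) : Tm := t.rename Nat.succ (fun n => n)
/-- Weakening by a type variable. -/
def Tm.wkTy (t : Tm) : Tm := t.rename (fun n => n) Nat.succ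

/-- A simultaneous substitution for term variables and type variables. -/
structure Sub : Type where
  tm : ℕ → Tm
  ty : ℕ → Ty

/-- Lift a substitution under the binder of a term variable. -/
def Sub.upTm (s : Sub) : Sub :=
  ⟨scons (.var 0) (fun n => (s.tm n).wkTm), fun n => (s.ty n).wkTm⟩

/-- Lift a substitution under the binder of a type variable. -/
def Sub.upTy (s : Sub) : Sub :=
  ⟨fun n => (s.tm n).wkTy, scons (.var 0) (fun n => (s.ty n).wkTy)⟩

mutual

def Kd.subst : Sub → Kd → Kd
  | _, .star => .star
  | s, .piTm T k => .piTm (T.subst s) (k.subst s.upTm)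
  | s, .piTy k' k => .piTy (k'.subst s) (k.subst s.upTy)

def Ty.subst : Sub → Ty → Ty
  | s, .var n => s.ty n
  | s, .allTy k T => .allTy (k.subst s) (T.subst s.upTy)
  | s, .allTm T T' => .allTm (T.subst s) (T'.subst s.upTm)
  | s, .pi T T' => .pi (T.subst s) (T'.subst s.upTm)
  | s, .lamTm T T' => .lamTm (T.subst s) (T'.subst s.upTm)
  | s, .lamTy k T => .lamTy (k.subst s) (T.subst s.upTy)
  | s, .appTm T t => .appTm (T.subst s) (t.subst s)
  | s, .appTy T T' => .appTy (T.subst s) (T'.subst s)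
  | s, .iota T T' => .iota (T.subst s) (T'.subst s.upTm)
  | s, .eq t t' => .eq (t.subst s) (t'.subst s)

def Tm.subst : Sub → Tm → Tm
  | s, .var n => s.tm n
  | s, .lam t => .lam (t.subst s.upTm)
  | s, .app t t' => .app (t.subst s) (t'.subst s)
  | s, .lamTy t => .lamTy (t.subst s.upTy)
  | s, .appTy t T => .appTy (t.subst s) (T.subst s)
  | s, .lamE t => .lamE (t.subst s.upTm)
  | s, .appE t t' => .appE (t.subst s) (t'.subst s)
  | s, .pair t t' => .pair (t.subst s) (t'.subst s)
  | s, .fst t => .fst (t.subst s)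
  | s, .snd t => .snd (t.subst s)
  | s, .beta t => .beta (t.subst s)
  | s, .rho t T' t' => .rho (t.subst s) (T'.subst s.upTm) (t'.subst s)
  | s, .phi t t' t'' => .phi (t.subst s) (t'.subst s) (t''.subst s)
  | s, .chi T t => .chi (T.subst s) (t.subst s)
  | s, .letIn T₁ t₁ t₂ => .letIn (T₁.subst s) (t₁.subst s) (t₂.subst s.upTm)
  | s, .delta t => .delta (t.subst s)
  | s, .sym t => .sym (t.subst s)

end

/-- The substitution `[u/x]` for the term variable of index `0`. -/
def Sub.oneTm (u : Tm) : Sub := ⟨scons u .var, .var⟩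
/-- The substitution `[A/X]` for the type variable of index `0`. -/
def Sub.oneTy (A : Ty) : Sub := ⟨.var, scons A .var⟩

/-- `[u/x]κ` -/
def Kd.instTm (k : Kd) (u : Tm) : Kd := k.subst (.oneTm u)
/-- `[A/X]κ` -/
def Kd.instTy (k : Kd) (A : Ty) : Kd := k.subst (.oneTy A)
/-- `[u/x]T` -/
def Ty.instTm (T : Ty) (u : Tm) : Ty := T.subst (.oneTm u)
/-- `[A/X]T` -/
def Ty.instTy (T : Ty) (A : Ty) : Ty := T.subst (.oneTy A)

/-! ### Erasure

The binder of `Λ x. t` disappears, so the indices of the variables that are bound further out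
have to be lowered; this is done by substituting a closed term for `x`.  The choice of that term
is immaterial, since `x` does not occur in `|t|` when `Λ x. t` is well typed. -/

/-- The erasure `|t|` of an annotated term. -/
def Tm.erase : Tm → Pure
  | .var n => .var n
  | .lam t => .lam t.erase
  | .app t t' => .app t.erase t'.erase
  | .lamTy t => t.erase
  | .appTy t _ => t.erase
  | .lamE t => t.erase.inst Pure.id
  | .appE t _ => t.erase
  | .pair t _ => t.erase
  | .fst t => t.erase
  | .snd t => t.erase
  | .beta t => t.erase
  | .rho _ _ t' => t'.erase
  | .phi _ _ t'' => t''.erase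
  | .chi _ t => t.erase
  | .letIn _ t₁ t₂ => .app (.lam t₂.erase) t₁.erase
  | .delta _ => Pure.id
  | .sym t => t.erase

/-- `|t| =βη |t'|` -/
def Tm.Eqv (t t' : Tm) : Prop := BetaEta t.erase t'.erase

/-! ### Call-by-name reduction and convertibility of classifiers -/

/-- One step of call-by-name reduction of types. -/
inductive Red : Ty → Ty → Prop
  | betaTm (T T' : Ty) (t : Tm) : Red (.appTm (.lamTm T T') t) (T'.instTm t)
  | betaTy (k : Kd) (T A : Ty) : Red (.appTy (.lamTy k T) A) (T.instTy A)
  | appTm {T T' : Ty} (t : Tm) : Red T T' → Red (.appTm T t) (.appTm T' t)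
  | appTy {T T' : Ty} (A : Ty) : Red T T' → Red (.appTy T A) (.appTy T' A)

/-- Reflexive transitive closure of call-by-name reduction. -/
def Reds : Ty → Ty → Prop := Relation.ReflTransGen Red

/-- `T` has no call-by-name reduct. -/
def Whnf (T : Ty) : Prop := ∀ T', ¬ Red T T'

mutual

/-- `κ₁ ≅ κ₂` -/
inductive ConvKd : Kd → Kd → Prop
  | star : ConvKd .star .star
  | piTm {T T' : Ty} {k k' : Kd} : ConvTy T T' → ConvKd k k' →
      ConvKd (.piTm T k) (.piTm T' k')
  | piTy {k₁ k₁' k₂ k₂' : Kd} : ConvKd k₁ k₁' → ConvKd k₂ k₂' →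
      ConvKd (.piTy k₁ k₂) (.piTy k₁' k₂')

/-- `T₁ ≅ T₂` -/
inductive ConvTy : Ty → Ty → Prop
  | whnf {T₁ T₁' T₂ T₂' : Ty} : Reds T₁ T₁' → Whnf T₁' → Reds T₂ T₂' → Whnf T₂' →
      ConvWhnf T₁' T₂' → ConvTy T₁ T₂

/-- The auxiliary relation on types in weak head normal form. -/
inductive ConvWhnf : Ty → Ty → Prop
  | var (n : ℕ) : ConvWhnf (.var n) (.var n)
  | appTm {T T' : Ty} {t t' : Tm} : ConvWhnf T T' → t.Eqv t' →
      ConvWhnf (.appTm T t) (.appTm T' t')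
  | appTy {T T' A A' : Ty} : ConvWhnf T T' → ConvTy A A' →
      ConvWhnf (.appTy T A) (.appTy T' A')
  | eq {t₁ t₁' t₂ t₂' : Tm} : t₁.Eqv t₁' → t₂.Eqv t₂' →
      ConvWhnf (.eq t₁ t₂) (.eq t₁' t₂')
  | allTy {k k' : Kd} {T T' : Ty} : ConvKd k k' → ConvTy T T' →
      ConvWhnf (.allTy k T) (.allTy k' T')
  | allTm {S S' T T' : Ty} : ConvTy S S' → ConvTy T T' →
      ConvWhnf (.allTm S T) (.allTm S' T')
  | pi {S S' T T' : Ty} : ConvTy S S' → ConvTy T T' →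
      ConvWhnf (.pi S T) (.pi S' T')
  | lamTm {S S' T T' : Ty} : ConvTy S S' → ConvTy T T' →
      ConvWhnf (.lamTm S T) (.lamTm S' T')
  | lamTy {k k' : Kd} {T T' : Ty} : ConvKd k k' → ConvTy T T' →
      ConvWhnf (.lamTy k T) (.lamTy k' T')
  | iota {S S' T T' : Ty} : ConvTy S S' → ConvTy T T' →
      ConvWhnf (.iota S T) (.iota S' T')

end

/-! ### Contexts and scoping -/

/-- A declaration `x : T` or `X : κ`. -/
inductive Entry : Type
  | tm (T : Ty)
  | ty (k : Kd)

/-- Typing contexts; the most recent declaration comes first. -/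
abbrev Ctx : Type := List Entry

/-- `(x : T) ∈ Γ` -/
inductive HasTm : Ctx → ℕ → Ty → Prop
  | here (G : Ctx) (T : Ty) : HasTm (.tm T :: G) 0 T.wkTm
  | thereTm {G : Ctx} {n : ℕ} {T : Ty} (S : Ty) : HasTm G n T → HasTm (.tm S :: G) (n + 1) T.wkTm
  | thereTy {G : Ctx} {n : ℕ} {T : Ty} (k : Kd) : HasTm G n T → HasTm (.ty k :: G) n T.wkTy

/-- `(X : κ) ∈ Γ` -/
inductive HasTy : Ctx → ℕ → Kd → Prop
  | here (G : Ctx) (k : Kd) : HasTy (.ty k :: G) 0 k.wkTy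
  | thereTm {G : Ctx} {n : ℕ} {k : Kd} (S : Ty) : HasTy G n k → HasTy (.tm S :: G) n k.wkTm
  | thereTy {G : Ctx} {n : ℕ} {k : Kd} (k' : Kd) : HasTy G n k → HasTy (.ty k' :: G) (n + 1) k.wkTy

mutual

/-- All free term variables have index below `a`, all free type variables index below `b`. -/
def Kd.Scoped : ℕ → ℕ → Kd → Prop
  | _, _, .star => True
  | a, b, .piTm T k => T.Scoped a b ∧ k.Scoped (a + 1) b
  | a, b, .piTy k' k => k'.Scoped a b ∧ k.Scoped a (b + 1)

/-- All free term variables have index below `a`, all free type variables index below `b`. -/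
def Ty.Scoped : ℕ → ℕ → Ty → Prop
  | _, b, .var n => n < b
  | a, b, .allTy k T => k.Scoped a b ∧ T.Scoped a (b + 1)
  | a, b, .allTm T T' => T.Scoped a b ∧ T'.Scoped (a + 1) b
  | a, b, .pi T T' => T.Scoped a b ∧ T'.Scoped (a + 1) b
  | a, b, .lamTm T T' => T.Scoped a b ∧ T'.Scoped (a + 1) b
  | a, b, .lamTy k T => k.Scoped a b ∧ T.Scoped a (b + 1)
  | a, b, .appTm T t => T.Scoped a b ∧ t.Scoped a b
  | a, b, .appTy T T' => T.Scoped a b ∧ T'.Scoped a b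
  | a, b, .iota T T' => T.Scoped a b ∧ T'.Scoped (a + 1) b
  | a, b, .eq t t' => t.Scoped a b ∧ t'.Scoped a b

/-- All free term variables have index below `a`, all free type variables index below `b`. -/
def Tm.Scoped : ℕ → ℕ → Tm → Prop
  | a, _, .var n => n < a
  | a, b, .lam t => t.Scoped (a + 1) b
  | a, b, .app t t' => t.Scoped a b ∧ t'.Scoped a b
  | a, b, .lamTy t => t.Scoped a (b + 1)
  | a, b, .appTy t T => t.Scoped a b ∧ T.Scoped a b
  | a, b, .lamE t => t.Scoped (a + 1) b
  | a, b, .appE t t' => t.Scoped a b ∧ t'.Scoped a b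
  | a, b, .pair t t' => t.Scoped a b ∧ t'.Scoped a b
  | a, b, .fst t => t.Scoped a b
  | a, b, .snd t => t.Scoped a b
  | a, b, .beta t => t.Scoped a b
  | a, b, .rho t T' t' => t.Scoped a b ∧ T'.Scoped (a + 1) b ∧ t'.Scoped a b
  | a, b, .phi t t' t'' => t.Scoped a b ∧ t'.Scoped a b ∧ t''.Scoped a b
  | a, b, .chi T t => T.Scoped a b ∧ t.Scoped a b
  | a, b, .letIn T₁ t₁ t₂ => T₁.Scoped a b ∧ t₁.Scoped a b ∧ t₂.Scoped (a + 1) b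
  | a, b, .delta t => t.Scoped a b
  | a, b, .sym t => t.Scoped a b

end

/-- Number of term variables that a context declares. -/
def numTm : Ctx → ℕ
  | [] => 0
  | .tm _ :: G => numTm G + 1
  | .ty _ :: G => numTm G

/-- Number of type variables that a context declares. -/
def numTy : Ctx → ℕ
  | [] => 0
  | .tm _ :: G => numTy G
  | .ty _ :: G => numTy G + 1

/-- `FV(t) ⊆ dom(Γ)` -/
def Tm.InScope (t : Tm) (G : Ctx) : Prop := t.Scoped (numTm G) (numTy G)

/-! ### Kinding and typing -/

/-- The untyped term `λ x. x`. -/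
def idTm : Tm := .lam (.var 0)
/-- `λ x. λ y. x` -/
def ttTm : Tm := .lam (.lam (.var 1))
/-- `λ x. λ y. y` -/
def ffTm : Tm := .lam (.lam (.var 0))

mutual

/-- `Γ ⊢ κ` -/
inductive KdOk : Ctx → Kd → Prop
  | star {G : Ctx} : KdOk G .star
  | piTm {G : Ctx} {T : Ty} {k : Kd} :
      TyKind G T .star → KdOk (.tm T :: G) k → KdOk G (.piTm T k)
  | piTy {G : Ctx} {k' k : Kd} :
      KdOk G k' → KdOk (.ty k' :: G) k → KdOk G (.piTy k' k)

/-- `Γ ⊢ T ⇒ κ`: the type constructor `T` is well formed and has kind `κ`. -/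
inductive TyKind : Ctx → Ty → Kd → Prop
  | var {G : Ctx} {n : ℕ} {k : Kd} : HasTy G n k → TyKind G (.var n) k
  | allTy {G : Ctx} {k : Kd} {T : Ty} :
      KdOk G k → TyKind (.ty k :: G) T .star → TyKind G (.allTy k T) .star
  | allTm {G : Ctx} {T T' : Ty} :
      TyKind G T .star → TyKind (.tm T :: G) T' .star → TyKind G (.allTm T T') .star
  | pi {G : Ctx} {T T' : Ty} :
      TyKind G T .star → TyKind (.tm T :: G) T' .star → TyKind G (.pi T T') .star
  | lamTm {G : Ctx} {T T' : Ty} {k : Kd} :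
      TyKind G T .star → TyKind (.tm T :: G) T' k → TyKind G (.lamTm T T') (.piTm T k)
  | lamTy {G : Ctx} {k k' : Kd} {T : Ty} :
      KdOk G k → TyKind (.ty k :: G) T k' → TyKind G (.lamTy k T) (.piTy k k')
  | appTm {G : Ctx} {T T' : Ty} {k : Kd} {t : Tm} :
      TyKind G T (.piTm T' k) → Check G t T' → TyKind G (.appTm T t) (k.instTm t)
  | appTy {G : Ctx} {T₁ T₂ : Ty} {k₁ k₂ k₂' : Kd} :
      TyKind G T₁ (.piTy k₂ k₁) → TyKind G T₂ k₂' → ConvKd k₂ k₂' →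
      TyKind G (.appTy T₁ T₂) (k₁.instTy T₂)
  | iota {G : Ctx} {T T' : Ty} :
      TyKind G T .star → TyKind (.tm T :: G) T' .star → TyKind G (.iota T T') .star
  | eq {G : Ctx} {t t' : Tm} :
      t.InScope G → t'.InScope G → TyKind G (.eq t t') .star

/-- `Γ ⊢ t ⇒ T`: the term `t` synthesizes the type `T`. -/
inductive Synth : Ctx → Tm → Ty → Prop
  | var {G : Ctx} {n : ℕ} {T : Ty} : HasTm G n T → Synth G (.var n) T
  | app {G : Ctx} {t t' : Tm} {U T' T : Ty} :
      Synth G t U → Reds U (.pi T' T) → Check G t' T' → Synth G (.app t t') (T.instTm t')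
  | appTy {G : Ctx} {t : Tm} {U T T' : Ty} {k k' : Kd} :
      Synth G t U → Reds U (.allTy k T) → TyKind G T' k' → ConvKd k' k →
      Synth G (.appTy t T') (T.instTy T')
  | appE {G : Ctx} {t t' : Tm} {U T₁ T₂ : Ty} :
      Synth G t U → Reds U (.allTm T₁ T₂) → Check G t' T₁ → Synth G (.appE t t') (T₂.instTm t')
  | chi {G : Ctx} {T : Ty} {t : Tm} :
      TyKind G T .star → Check G t T → Synth G (.chi T t) T
  | fst {G : Ctx} {t : Tm} {U T₁ T₂ : Ty} :
      Synth G t U → Reds U (.iota T₁ T₂) → Synth G (.fst t) T₁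
  | snd {G : Ctx} {t : Tm} {U T₁ T₂ : Ty} :
      Synth G t U → Reds U (.iota T₁ T₂) → Synth G (.snd t) (T₂.instTm (.fst t))
  | sym {G : Ctx} {t t₁ t₂ : Tm} {U : Ty} :
      Synth G t U → Reds U (.eq t₁ t₂) → Synth G (.sym t) (.eq t₂ t₁)

/-- `Γ ⊢ t ⇐ T`: the term `t` can be checked against the type `T`. -/
inductive Check : Ctx → Tm → Ty → Prop
  | conv {G : Ctx} {t : Tm} {T T' : Ty} : Synth G t T' → ConvTy T' T → Check G t T
  | lam {G : Ctx} {t : Tm} {T T₁ T₂ : Ty} :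
      Reds T (.pi T₁ T₂) → Check (.tm T₁ :: G) t T₂ → Check G (.lam t) T
  | lamTy {G : Ctx} {t : Tm} {T T' : Ty} {k : Kd} :
      Reds T' (.allTy k T) → Check (.ty k :: G) t T → Check G (.lamTy t) T'
  | lamE {G : Ctx} {t : Tm} {T T₁ T₂ : Ty} :
      Reds T (.allTm T₁ T₂) → Check (.tm T₁ :: G) t T₂ → ¬ t.erase.Free 0 → Check G (.lamE t) T
  | letIn {G : Ctx} {T₁ T₂ : Ty} {t₁ t₂ : Tm} :
      TyKind G T₁ .star → Check G t₁ T₁ → Check (.tm T₁ :: G) t₂ T₂.wkTm →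
      Check G (.letIn T₁ t₁ t₂) T₂
  | pair {G : Ctx} {t₁ t₂ : Tm} {T T₁ T₂ : Ty} :
      Reds T (.iota T₁ T₂) → Check G t₁ T₁ → Check G t₂ (T₂.instTm t₁) → t₁.Eqv t₂ →
      Check G (.pair t₁ t₂) T
  | beta {G : Ctx} {t' t₁ t₂ : Tm} {T : Ty} :
      Reds T (.eq t₁ t₂) → t'.InScope G → t₁.Eqv t₂ → Check G (.beta t') T
  | rho {G : Ctx} {t t' t₁ t₂ : Tm} {U T T' : Ty} :
      Synth G t U → Reds U (.eq t₁ t₂) → TyKind G (T'.instTm t₂) .star →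
      Check G t' (T'.instTm t₂) → ConvTy (T'.instTm t₁) T → Check G (.rho t T' t') T
  | phi {G : Ctx} {t t' t'' : Tm} {T : Ty} :
      Check G t (.eq t' t'') → Check G t' T → t''.InScope G → Check G (.phi t t' t'') T
  | delta {G : Ctx} {t : Tm} {T T' : Ty} :
      Synth G t T' → ConvTy T' (.eq ttTm ffTm) → Check G (.delta t) T

end

/-- A closed definition `x ◂ T = t .` is accepted: `T` is a type and `t` checks against it. -/
def Defn (t : Tm) (T : Ty) : Prop := TyKind [] T .star ∧ Check [] t T

/-! ### Notation for the Cedille definitions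

Every definition below is a closed expression.  A module parameter is an additional argument of
each definition of the module: an argument in `{ }` is an erased argument of the terms.  A
defined term `x ◂ T = t .` stands for `χ T - t`, which synthesizes `T` and erases to `|t|`. -/

/-- `T ➔ T'` -/
def arrow (T T' : Ty) : Ty := .pi T T'.wkTm
/-- `T ➾ T'` -/
def earrow (T T' : Ty) : Ty := .allTm T T'.wkTm
/-- `T ➔ ★` -/
def predOn (T : Ty) : Kd := .piTm T .star
/-- `★ ➔ ★` -/
def scheme : Kd := .piTy .star .star

infixr:60 " ⟶ₜ " => arrow
infixr:60 " ⟹ₜ " => earrow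
infixl:75 " ⬝ " => Ty.appTm
infixl:75 " ⬝ₜ " => Ty.appTy
infixl:75 " ⋆ " => Tm.app
infixl:75 " ⋆ₜ " => Tm.appTy
infixl:75 " ⋆ₑ " => Tm.appE

/-- Term variable. -/
abbrev v (n : ℕ) : Tm := .var n
/-- Type variable. -/
abbrev V (n : ℕ) : Ty := .var n
/-- `β`, which abbreviates `β{λ x. x}`. -/
def rfl' : Tm := .beta idTm

/-! ### Views, casts and monotone recursive types -/

/-- `Top ◂ ★ = { λ x. x ≃ λ x. x } .` -/
def Top : Ty := .eq idTm idTm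

/-- `View ◂ Π T: ★. Top ➔ ★ = λ T: ★. λ t: Top. ι x: T. { x ≃ t } .` -/
def View : Ty := .lamTy .star (.lamTm Top (.iota (V 0) (.eq (v 0) (v 1))))

/-- `intrView ◂ ∀ T: ★. Π t1: Top. ∀ t2: T. { t2 ≃ t1 } ➾ View ·T t1`
`= Λ T. λ t1. Λ t2. Λ t. [ φ t - t2 { t1 } , β{ t1 } ] .` -/
def intrView : Tm := .chi
  (.allTy .star (.pi Top (.allTm (V 0) (.eq (v 0) (v 1) ⟹ₜ View ⬝ₜ V 0 ⬝ v 1))))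
  (.lamTy (.lam (.lamE (.lamE (.pair (.phi (v 0) (v 1) (v 2)) (.beta (v 2)))))))

/-- `elimView ◂ ∀ T: ★. Π t: Top. View ·T t ➾ T = Λ T. λ t. Λ v. φ v.2 - v.1 { t } .` -/
def elimView : Tm := .chi
  (.allTy .star (.pi Top (View ⬝ₜ V 0 ⬝ v 0 ⟹ₜ V 0)))
  (.lamTy (.lam (.lamE (.phi (.snd (v 0)) (.fst (v 0)) (v 1)))))

/-- `extView`
`◂ ∀ S: ★. ∀ T: ★. Π t: Top. (Π x: S. View ·T β{ t x }) ➾ View ·(S ➔ T) t`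
`= Λ S. Λ T. λ t. Λ v. intrView ·(S ➔ T) t -(λ x. elimView ·T β{ t x } -(v x)) -β .` -/
def extView : Tm := .chi
  (.allTy .star (.allTy .star (.pi Top
    (.pi (V 1) (View ⬝ₜ V 0 ⬝ .beta (v 1 ⋆ v 0)) ⟹ₜ View ⬝ₜ (V 1 ⟶ₜ V 0) ⬝ v 0))))
  (.lamTy (.lamTy (.lam (.lamE
    (intrView ⋆ₜ (V 1 ⟶ₜ V 0) ⋆ v 1
      ⋆ₑ .lam (elimView ⋆ₜ V 0 ⋆ .beta (v 2 ⋆ v 0) ⋆ₑ (v 1 ⋆ v 0))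
      ⋆ₑ rfl')))))

/-- `Cast ◂ ★ ➔ ★ ➔ ★ = λ S: ★. λ T: ★. View ·(S ➔ T) β{ λ x. x } .` -/
def Cast : Ty :=
  .lamTy .star (.lamTy .star (View ⬝ₜ (V 1 ⟶ₜ V 0) ⬝ .beta idTm))

/-- `intrCast ◂ ∀ S: ★. ∀ T: ★. ∀ t: S ➔ T. (Π x: S. { t x ≃ x }) ➾ Cast ·S ·T`
`= Λ S. Λ T. Λ t. Λ t'.`
`extView ·S ·T β{ λ x. x } -(λ x. intrView ·T β{ x } -(t x) -(t' x)) .` -/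
def intrCast : Tm := .chi
  (.allTy .star (.allTy .star (.allTm (V 1 ⟶ₜ V 0)
    (.pi (V 1) (.eq (v 1 ⋆ v 0) (v 0)) ⟹ₜ Cast ⬝ₜ V 1 ⬝ₜ V 0))))
  (.lamTy (.lamTy (.lamE (.lamE
    (extView ⋆ₜ V 1 ⋆ₜ V 0 ⋆ .beta idTm
      ⋆ₑ .lam (intrView ⋆ₜ V 0 ⋆ .beta (v 0) ⋆ₑ (v 2 ⋆ v 0) ⋆ₑ (v 1 ⋆ v 0)))))))

/-- `elimCast ◂ ∀ S: ★. ∀ T: ★. Cast ·S ·T ➾ S ➔ T`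
`= Λ S. Λ T. Λ c. elimView ·(S ➔ T) β{ λ x. x } -c .` -/
def elimCast : Tm := .chi
  (.allTy .star (.allTy .star (Cast ⬝ₜ V 1 ⬝ₜ V 0 ⟹ₜ V 1 ⟶ₜ V 0)))
  (.lamTy (.lamTy (.lamE (elimView ⋆ₜ (V 1 ⟶ₜ V 0) ⋆ .beta idTm ⋆ₑ v 0))))

/-- `castTrans ◂ ∀ S: ★. ∀ T: ★. ∀ U: ★. Cast ·S ·T ➾ Cast ·T ·U ➾ Cast ·S ·U`
`= Λ S. Λ T. Λ U. Λ c1. Λ c2. intrCast -(λ x. elimCast -c2 (elimCast -c1 x)) -(λ x. β) .` -/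
def castTrans : Tm := .chi
  (.allTy .star (.allTy .star (.allTy .star
    (Cast ⬝ₜ V 2 ⬝ₜ V 1 ⟹ₜ Cast ⬝ₜ V 1 ⬝ₜ V 0 ⟹ₜ Cast ⬝ₜ V 2 ⬝ₜ V 0))))
  (.lamTy (.lamTy (.lamTy (.lamE (.lamE
    (intrCast ⋆ₜ V 2 ⋆ₜ V 0
      ⋆ₑ .lam (elimCast ⋆ₜ V 1 ⋆ₜ V 0 ⋆ₑ v 1 ⋆ (elimCast ⋆ₜ V 2 ⋆ₜ V 1 ⋆ₑ v 2 ⋆ v 0))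
      ⋆ₑ .lam rfl'))))))

/-- `Mono ◂ (★ ➔ ★) ➔ ★`
`= λ F: ★ ➔ ★. ∀ X: ★. ∀ Y: ★. Cast ·X ·Y ➔ Cast ·(F ·X) ·(F ·Y) .` -/
def Mono : Ty :=
  .lamTy scheme (.allTy .star (.allTy .star
    (Cast ⬝ₜ V 1 ⬝ₜ V 0 ⟶ₜ Cast ⬝ₜ (V 2 ⬝ₜ V 1) ⬝ₜ (V 2 ⬝ₜ V 0))))

/-- `Rec ◂ (★ ➔ ★) ➔ ★ = λ F: ★ ➔ ★. ∀ X: ★. Cast ·(F ·X) ·X ➾ X .` -/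
def Rec : Ty :=
  .lamTy scheme (.allTy .star (Cast ⬝ₜ (V 1 ⬝ₜ V 0) ⬝ₜ V 0 ⟹ₜ V 0))

/-- `recLB ◂ ∀ F: ★ ➔ ★. ∀ X: ★. Cast ·(F ·X) ·X ➾ Cast ·(Rec ·F) ·X`
`= Λ F. Λ X. Λ c. intrCast -(λ x. x ·X -c) -(λ x. β) .` -/
def recLB : Tm := .chi
  (.allTy scheme (.allTy .star
    (Cast ⬝ₜ (V 1 ⬝ₜ V 0) ⬝ₜ V 0 ⟹ₜ Cast ⬝ₜ (Rec ⬝ₜ V 1) ⬝ₜ V 0)))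
  (.lamTy (.lamTy (.lamE
    (intrCast ⋆ₜ (Rec ⬝ₜ V 1) ⋆ₜ V 0 ⋆ₑ .lam (v 0 ⋆ₜ V 0 ⋆ₑ v 1) ⋆ₑ .lam rfl'))))

/-- `recGLB ◂ ∀ F: ★ ➔ ★. ∀ Y: ★.`
`(∀ X: ★. Cast ·(F ·X) ·X ➾ Cast ·Y ·X) ➾ Cast ·Y ·(Rec ·F)`
`= Λ F. Λ Y. Λ u. intrCast -(λ y. Λ X. Λ c. elimCast -(u ·X -c) y) -(λ x. β) .` -/
def recGLB : Tm := .chi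
  (.allTy scheme (.allTy .star
    (.allTy .star (Cast ⬝ₜ (V 2 ⬝ₜ V 0) ⬝ₜ V 0 ⟹ₜ Cast ⬝ₜ V 1 ⬝ₜ V 0)
      ⟹ₜ Cast ⬝ₜ V 0 ⬝ₜ (Rec ⬝ₜ V 1))))
  (.lamTy (.lamTy (.lamE
    (intrCast ⋆ₜ V 0 ⋆ₜ (Rec ⬝ₜ V 1)
      ⋆ₑ .lam (.lamTy (.lamE (elimCast ⋆ₜ V 1 ⋆ₜ V 0 ⋆ₑ (v 2 ⋆ₜ V 0 ⋆ₑ v 0) ⋆ v 1)))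
      ⋆ₑ .lam rfl'))))

/-- `recRoll ◂ ∀ F: ★ ➔ ★. Mono ·F ➾ Cast ·(F ·(Rec ·F)) ·(Rec ·F)`
`= Λ F. Λ mono. recGLB ·F ·(F ·(Rec ·F))`
`-(Λ X. Λ c. castTrans ·(F ·(Rec ·F)) ·(F ·X) ·X -(mono (recLB -c)) -c) .` -/
def recRoll : Tm := .chi
  (.allTy scheme (Mono ⬝ₜ V 0 ⟹ₜ Cast ⬝ₜ (V 0 ⬝ₜ (Rec ⬝ₜ V 0)) ⬝ₜ (Rec ⬝ₜ V 0)))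
  (.lamTy (.lamE
    (recGLB ⋆ₜ V 0 ⋆ₜ (V 0 ⬝ₜ (Rec ⬝ₜ V 0))
      ⋆ₑ .lamTy (.lamE
        (castTrans ⋆ₜ (V 1 ⬝ₜ (Rec ⬝ₜ V 1)) ⋆ₜ (V 1 ⬝ₜ V 0) ⋆ₜ V 0
          ⋆ₑ (v 1 ⋆ₜ (Rec ⬝ₜ V 1) ⋆ₜ V 0 ⋆ (recLB ⋆ₜ V 1 ⋆ₜ V 0 ⋆ₑ v 0))
          ⋆ₑ v 0)))))

/-- `roll ◂ ∀ F: ★ ➔ ★. Mono ·F ➾ F ·(Rec ·F) ➔ Rec ·F`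
`= Λ F. Λ m. elimCast -(recRoll ·F -m) .` -/
def roll : Tm := .chi
  (.allTy scheme (Mono ⬝ₜ V 0 ⟹ₜ V 0 ⬝ₜ (Rec ⬝ₜ V 0) ⟶ₜ Rec ⬝ₜ V 0))
  (.lamTy (.lamE
    (elimCast ⋆ₜ (V 0 ⬝ₜ (Rec ⬝ₜ V 0)) ⋆ₜ (Rec ⬝ₜ V 0) ⋆ₑ (recRoll ⋆ₜ V 0 ⋆ₑ v 0))))

/-! ### The generic Scott encoding

Module parameters `(F: ★ ➔ ★) {mono: Mono ·F}`. -/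

/-- `AlgCase ◂ ★ ➔ ★ ➔ ★ = λ D: ★. λ X: ★. F ·D ➔ X .` -/
def AlgCase : Ty :=
  .lamTy scheme (.lamTy .star (.lamTy .star (V 2 ⬝ₜ V 1 ⟶ₜ V 0)))

/-- `DF ◂ ★ ➔ ★ = λ D: ★. ∀ X: ★. AlgCase ·D ·X ➔ X .` -/
def DF : Ty :=
  .lamTy scheme (.lamTy .star (.allTy .star (AlgCase ⬝ₜ V 2 ⬝ₜ V 1 ⬝ₜ V 0 ⟶ₜ V 0)))

/-- `inDF ◂ ∀ D: ★. AlgCase ·D ·(DF ·D) = Λ D. λ xs. Λ X. λ a. a xs .` -/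
def inDF : Tm := .chi
  (.allTy scheme (.allTy .star (AlgCase ⬝ₜ V 1 ⬝ₜ V 0 ⬝ₜ (DF ⬝ₜ V 1 ⬝ₜ V 0))))
  (.lamTy (.lamTy (.lam (.lamTy (.lam (v 0 ⋆ v 1))))))

/-- `monoDF ◂ Mono ·DF = Λ X. Λ Y. λ c.`
`intrCast -(λ d. Λ Z. λ a. d ·Z (λ xs. a (elimCast -(mono c) xs))) -(λ d. β) .` -/
def monoDF : Tm := .chi
  (.allTy scheme (Mono ⬝ₜ V 0 ⟹ₜ Mono ⬝ₜ (DF ⬝ₜ V 0)))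
  (.lamTy (.lamE (.lamTy (.lamTy (.lam
    (intrCast ⋆ₜ (DF ⬝ₜ V 2 ⬝ₜ V 1) ⋆ₜ (DF ⬝ₜ V 2 ⬝ₜ V 0)
      ⋆ₑ .lam (.lamTy (.lam (v 1 ⋆ₜ V 0 ⋆
          .lam (v 1 ⋆ (elimCast ⋆ₜ (V 3 ⬝ₜ V 2) ⋆ₜ (V 3 ⬝ₜ V 1)
            ⋆ₑ (v 4 ⋆ₜ V 2 ⋆ₜ V 1 ⋆ v 3) ⋆ v 0)))))
      ⋆ₑ .lam rfl'))))))

/-- `WkPrfAlg ◂ Π D: ★. (DF ·D ➔ ★) ➔ ★`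
`= λ D: ★. λ P: DF ·D ➔ ★. Π xs: F ·D. P (inDF xs) .` -/
def WkPrfAlg : Ty :=
  .lamTy scheme (.lamTy .star (.lamTy (predOn (DF ⬝ₜ V 1 ⬝ₜ V 0))
    (.pi (V 2 ⬝ₜ V 1) (V 0 ⬝ (inDF ⋆ₜ V 2 ⋆ₜ V 1 ⋆ v 0)))))

/-- `WkIndDF ◂ Π D: ★. DF ·D ➔ ★`
`= λ D: ★. λ x: DF ·D. ∀ P: DF ·D ➔ ★. WkPrfAlg ·D ·P ➔ P x .` -/
def WkIndDF : Ty :=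
  .lamTy scheme (.lamTy .star (.lamTm (DF ⬝ₜ V 1 ⬝ₜ V 0)
    (.allTy (predOn (DF ⬝ₜ V 1 ⬝ₜ V 0))
      (WkPrfAlg ⬝ₜ V 2 ⬝ₜ V 1 ⬝ₜ V 0 ⟶ₜ V 0 ⬝ v 0))))

/-- `inWkIndDF ◂ ∀ D: ★. WkPrfAlg ·D ·(WkIndDF ·D) = Λ D. λ xs. Λ P. λ a. a xs .` -/
def inWkIndDF : Tm := .chi
  (.allTy scheme (.allTy .star (WkPrfAlg ⬝ₜ V 1 ⬝ₜ V 0 ⬝ₜ (WkIndDF ⬝ₜ V 1 ⬝ₜ V 0))))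
  (.lamTy (.lamTy (.lam (.lamTy (.lam (v 0 ⋆ v 1))))))

/-- `DFI ◂ ★ ➔ ★ = λ D: ★. ι x: DF ·D. WkIndDF ·D x .` -/
def DFI : Ty :=
  .lamTy scheme (.lamTy .star
    (.iota (DF ⬝ₜ V 1 ⬝ₜ V 0) (WkIndDF ⬝ₜ V 1 ⬝ₜ V 0 ⬝ v 0)))

/-- `monoDFI ◂ Mono ·DFI = Λ X. Λ Y. λ c. intrCast`
`-(λ d. [ elimCast -(monoDF c) d.1`
`, Λ P. λ a. d.2 ·(λ x: DF ·X. P (elimCast -(monoDF c) x)) (λ xs. a (elimCast -(mono c) xs)) ])`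
`-(λ d. β) .` -/
def monoDFI : Tm := .chi
  (.allTy scheme (Mono ⬝ₜ V 0 ⟹ₜ Mono ⬝ₜ (DFI ⬝ₜ V 0)))
  (.lamTy (.lamE (.lamTy (.lamTy (.lam
    (intrCast ⋆ₜ (DFI ⬝ₜ V 2 ⬝ₜ V 1) ⋆ₜ (DFI ⬝ₜ V 2 ⬝ₜ V 0)
      ⋆ₑ .lam (.pair
        (elimCast ⋆ₜ (DF ⬝ₜ V 2 ⬝ₜ V 1) ⋆ₜ (DF ⬝ₜ V 2 ⬝ₜ V 0)
          ⋆ₑ (monoDF ⋆ₜ V 2 ⋆ₑ v 2 ⋆ₜ V 1 ⋆ₜ V 0 ⋆ v 1) ⋆ .fst (v 0))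
        (.lamTy (.lam (.snd (v 1)
          ⋆ₜ .lamTm (DF ⬝ₜ V 3 ⬝ₜ V 2)
            (V 0 ⬝ (elimCast ⋆ₜ (DF ⬝ₜ V 3 ⬝ₜ V 2) ⋆ₜ (DF ⬝ₜ V 3 ⬝ₜ V 1)
              ⋆ₑ (monoDF ⋆ₜ V 3 ⋆ₑ v 4 ⋆ₜ V 2 ⋆ₜ V 1 ⋆ v 3) ⋆ v 0))
          ⋆ .lam (v 1 ⋆ (elimCast ⋆ₜ (V 3 ⬝ₜ V 2) ⋆ₜ (V 3 ⬝ₜ V 1)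
              ⋆ₑ (v 4 ⋆ₜ V 2 ⋆ₜ V 1 ⋆ v 3) ⋆ v 0))))))
      ⋆ₑ .lam rfl'))))))

/-- `D ◂ ★ = Rec ·DFI .`, the generic Scott encoding. -/
def ScottD : Ty := .lamTy scheme (Rec ⬝ₜ (DFI ⬝ₜ V 0))

/-- `rollD ◂ DFI ·D ➔ D = roll -monoDFI .` -/
def rollD : Tm := .chi
  (.allTy scheme (Mono ⬝ₜ V 0 ⟹ₜ DFI ⬝ₜ V 0 ⬝ₜ (ScottD ⬝ₜ V 0) ⟶ₜ ScottD ⬝ₜ V 0))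
  (.lamTy (.lamE (roll ⋆ₜ (DFI ⬝ₜ V 0) ⋆ₑ (monoDFI ⋆ₜ V 0 ⋆ₑ v 0))))

/-- `inD ◂ AlgCase ·D ·D = λ xs. rollD [ inDF xs , inWkIndDF xs ] .` -/
def scottInD : Tm := .chi
  (.allTy scheme (Mono ⬝ₜ V 0 ⟹ₜ AlgCase ⬝ₜ V 0 ⬝ₜ (ScottD ⬝ₜ V 0) ⬝ₜ (ScottD ⬝ₜ V 0)))
  (.lamTy (.lamE (.lam (rollD ⋆ₜ V 0 ⋆ₑ v 1 ⋆
    .pair (inDF ⋆ₜ V 0 ⋆ₜ (ScottD ⬝ₜ V 0) ⋆ v 0)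
      (inWkIndDF ⋆ₜ V 0 ⋆ₜ (ScottD ⬝ₜ V 0) ⋆ v 0)))))

/-! ### The generic dependent Lepigre-Raffalli encoding

Module parameters `(F: ★ ➔ ★) {mono: Mono ·F}`; `S.D` and `S.inD` are `ScottD` and `scottInD`. -/

/-- `DRec ◂ (S.D ➔ ★) ➔ S.D ➔ ★ ➔ ★`
`= λ P: S.D ➔ ★. λ x: S.D. λ Y: ★. Y ➔ Y ➔ P x .` -/
def DRec : Ty :=
  .lamTy scheme (.lamTy (predOn (ScottD ⬝ₜ V 0)) (.lamTm (ScottD ⬝ₜ V 1) (.lamTy .star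
    (V 0 ⟶ₜ V 0 ⟶ₜ V 1 ⬝ v 0))))

/-- The type `ι x: S.D. DRec ·P x ·Y` of handles for the inductive hypothesis. -/
def handle (F P Y : Ty) : Ty :=
  .iota (ScottD ⬝ₜ F) (DRec ⬝ₜ F.wkTm ⬝ₜ P.wkTm ⬝ v 0 ⬝ₜ Y.wkTm)

/-- `inDRec ◂ ∀ P: S.D ➔ ★. ∀ Y: ★. F ·(ι x: S.D. DRec ·P x ·Y) ➔ S.D`
`= Λ P. Λ Y. λ xs. [c ◂ Cast ·(ι x: S.D. DRec ·P x ·Y) ·S.D = intrCast -(λ x. x.1) -(λ x. β)]`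
`- S.inD (elimCast -(mono c) xs) .` -/
def inDRec : Tm := .chi
  (.allTy scheme (.allTm (Mono ⬝ₜ V 0) (.allTy (predOn (ScottD ⬝ₜ V 0)) (.allTy .star
    (V 2 ⬝ₜ handle (V 2) (V 1) (V 0) ⟶ₜ ScottD ⬝ₜ V 2)))))
  (.lamTy (.lamE (.lamTy (.lamTy (.lam
    (.letIn (Cast ⬝ₜ handle (V 2) (V 1) (V 0) ⬝ₜ (ScottD ⬝ₜ V 2))
      (intrCast ⋆ₜ handle (V 2) (V 1) (V 0) ⋆ₜ (ScottD ⬝ₜ V 2)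
        ⋆ₑ .lam (.fst (v 0)) ⋆ₑ .lam rfl')
      (scottInD ⋆ₜ V 2 ⋆ₑ v 2 ⋆
        (elimCast ⋆ₜ (V 2 ⬝ₜ handle (V 2) (V 1) (V 0)) ⋆ₜ (V 2 ⬝ₜ (ScottD ⬝ₜ V 2))
          ⋆ₑ (v 2 ⋆ₜ handle (V 2) (V 1) (V 0) ⋆ₜ (ScottD ⬝ₜ V 2) ⋆ v 0) ⋆ v 1))))))))

/-- `PrfAlgLR ◂ (S.D ➔ ★) ➔ ★ = λ P: S.D ➔ ★.`
`∀ Y: ★. Π xs: F ·(ι x: S.D. DRec ·P x ·Y). Y ➔ P (inDRec xs) .` -/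
def PrfAlgLR : Ty :=
  .lamTy scheme (.lamTm (Mono ⬝ₜ V 0) (.lamTy (predOn (ScottD ⬝ₜ V 0)) (.allTy .star
    (.pi (V 2 ⬝ₜ handle (V 2) (V 1) (V 0))
      (V 0 ⟶ₜ V 1 ⬝ (inDRec ⋆ₜ V 2 ⋆ₑ v 1 ⋆ₜ V 1 ⋆ₜ V 0 ⋆ v 0))))))

/-- `D ◂ ★ = ι x: S.D. ∀ P: S.D ➔ ★. DRec ·P x ·(PrfAlgLR ·P) .`, the generic dependent
Lepigre-Raffalli encoding. -/
def LRD : Ty :=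
  .lamTy scheme (.lamTm (Mono ⬝ₜ V 0) (.iota (ScottD ⬝ₜ V 0)
    (.allTy (predOn (ScottD ⬝ₜ V 0))
      (DRec ⬝ₜ V 1 ⬝ₜ V 0 ⬝ v 0 ⬝ₜ (PrfAlgLR ⬝ₜ V 1 ⬝ v 1 ⬝ₜ V 0)))))

/-! ### Functors and dependent pairs -/

/-- `Fmap ◂ ★ = ∀ X: ★. ∀ Y: ★. (X ➔ Y) ➔ (F ·X ➔ F ·Y) .` -/
def Fmap : Ty :=
  .lamTy scheme (.allTy .star (.allTy .star
    ((V 1 ⟶ₜ V 0) ⟶ₜ V 2 ⬝ₜ V 1 ⟶ₜ V 2 ⬝ₜ V 0)))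

/-- `FmapId ◂ Fmap ➔ ★ = λ fmap: Fmap.`
`∀ X: ★. ∀ Y: ★. Π c: X ➔ Y. (Π x: X. {c x ≃ x}) ➔ Π x: F ·X. {fmap c x ≃ x} .` -/
def FmapId : Ty :=
  .lamTy scheme (.lamTm (Fmap ⬝ₜ V 0) (.allTy .star (.allTy .star (.pi (V 1 ⟶ₜ V 0)
    (.pi (V 1) (.eq (v 1 ⋆ v 0) (v 0)) ⟶ₜ
      .pi (V 2 ⬝ₜ V 1) (.eq (v 2 ⋆ₜ V 1 ⋆ₜ V 0 ⋆ v 1 ⋆ v 0) (v 0)))))))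

/-- `FmapCompose ◂ Fmap ➔ ★ = λ fmap: Fmap.`
`∀ X: ★. ∀ Y: ★. ∀ Z: ★. Π f: Y ➔ Z. Π g: X ➔ Y. Π x: F ·X.`
`{fmap f (fmap g x) ≃ fmap (λ x. f (g x)) x} .` -/
def FmapCompose : Ty :=
  .lamTy scheme (.lamTm (Fmap ⬝ₜ V 0) (.allTy .star (.allTy .star (.allTy .star
    (.pi (V 1 ⟶ₜ V 0) (.pi (V 2 ⟶ₜ V 1) (.pi (V 3 ⬝ₜ V 2)
      (.eq
        (v 3 ⋆ₜ V 1 ⋆ₜ V 0 ⋆ v 2 ⋆ (v 3 ⋆ₜ V 2 ⋆ₜ V 1 ⋆ v 1 ⋆ v 0))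
        (v 3 ⋆ₜ V 2 ⋆ₜ V 0 ⋆ .lam (v 3 ⋆ (v 2 ⋆ v 0)) ⋆ v 0)))))))))

/-- `monoFunctor ◂ Mono ·F = Λ X. Λ Y. λ c.`
`intrCast -(λ d. fmap (elimCast -c) d) -(λ d. fmapId (elimCast -c) (λ x. β) d) .`
with module parameters
`(F: ★ ➔ ★) (fmap: Fmap ·F) {fmapId: FmapId ·F fmap} {fmapCompose: FmapCompose ·F fmap}`. -/
def monoFunctor : Tm := .chi
  (.allTy scheme (.pi (Fmap ⬝ₜ V 0) (FmapId ⬝ₜ V 0 ⬝ v 0 ⟹ₜ FmapCompose ⬝ₜ V 0 ⬝ v 0 ⟹ₜ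
    Mono ⬝ₜ V 0)))
  (.lamTy (.lam (.lamE (.lamE (.lamTy (.lamTy (.lam
    (intrCast ⋆ₜ (V 2 ⬝ₜ V 1) ⋆ₜ (V 2 ⬝ₜ V 0)
      ⋆ₑ .lam (v 4 ⋆ₜ V 1 ⋆ₜ V 0 ⋆ (elimCast ⋆ₜ V 1 ⋆ₜ V 0 ⋆ₑ v 1) ⋆ v 0)
      ⋆ₑ .lam (v 3 ⋆ₜ V 1 ⋆ₜ V 0 ⋆ (elimCast ⋆ₜ V 1 ⋆ₜ V 0 ⋆ₑ v 1) ⋆ .lam rfl' ⋆ v 0)))))))))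

/-- Impredicative dependent pairs, without induction:
`λ S: ★. λ T: S ➔ ★. ∀ X: ★. (Π s: S. T s ➔ X) ➔ X`. -/
def PreSigma : Ty :=
  .lamTy .star (.lamTy (predOn (V 0)) (.allTy .star
    (.pi (V 2) (V 1 ⬝ v 0 ⟶ₜ V 0) ⟶ₜ V 0)))

/-- `mkPreSigma ◂ ∀ S: ★. ∀ T: S ➔ ★. Π s: S. T s ➔ PreSigma ·S ·T`
`= Λ S. Λ T. λ s. λ t. Λ X. λ k. k s t .` -/
def mkPreSigma : Tm := .chi
  (.allTy .star (.allTy (predOn (V 0)) (.pi (V 1) (V 0 ⬝ v 0 ⟶ₜ PreSigma ⬝ₜ V 1 ⬝ₜ V 0))))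
  (.lamTy (.lamTy (.lam (.lam (.lamTy (.lam (v 0 ⋆ v 2 ⋆ v 1)))))))

/-- The type of dependent pairs, i.e. the members of `PreSigma` that satisfy induction:
`Sigma ◂ Π S: ★. (S ➔ ★) ➔ ★ = λ S: ★. λ T: S ➔ ★. ι p: PreSigma ·S ·T.`
`∀ P: PreSigma ·S ·T ➔ ★. (Π s: S. Π t: T s. P (mkPreSigma s t)) ➔ P p .` -/
def Sigma : Ty :=
  .lamTy .star (.lamTy (predOn (V 0)) (.iota (PreSigma ⬝ₜ V 1 ⬝ₜ V 0)
    (.allTy (predOn (PreSigma ⬝ₜ V 1 ⬝ₜ V 0))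
      (.pi (V 2) (.pi (V 1 ⬝ v 0) (V 0 ⬝ (mkPreSigma ⋆ₜ V 2 ⋆ₜ V 1 ⋆ v 1 ⋆ v 0)))
        ⟶ₜ V 0 ⬝ v 0))))

/-- `proj1 ◂ ∀ S: ★. ∀ T: S ➔ ★. Sigma ·S ·T ➔ S = Λ S. Λ T. λ p. p.1 ·S (λ s. λ t. s) .` -/
def proj1 : Tm := .chi
  (.allTy .star (.allTy (predOn (V 0)) (Sigma ⬝ₜ V 1 ⬝ₜ V 0 ⟶ₜ V 1)))
  (.lamTy (.lamTy (.lam (.fst (v 0) ⋆ₜ V 1 ⋆ .lam (.lam (v 1))))))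

/-- `Alg ◂ ★ ➔ ★ = λ X: ★. F ·X ➔ X .` -/
def Alg : Ty := .lamTy scheme (.lamTy .star (V 1 ⬝ₜ V 0 ⟶ₜ V 0))

/-- `PrfAlgRec ◂ (D ➔ ★) ➔ ★`
`= λ P: D ➔ ★. Π xs: F ·(Sigma ·D ·P). P (inD (fmap (proj1 ·D ·P) xs)) .`
with module parameters `(F: ★ ➔ ★) (fmap: Fmap ·F) (D: ★) (inD: Alg ·F ·D)`. -/
def PrfAlgRec : Ty :=
  .lamTy scheme (.lamTm (Fmap ⬝ₜ V 0) (.lamTy .star (.lamTm (Alg ⬝ₜ V 1 ⬝ₜ V 0)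
    (.lamTy (predOn (V 0)) (.pi (V 2 ⬝ₜ (Sigma ⬝ₜ V 1 ⬝ₜ V 0))
      (V 0 ⬝ (v 1 ⋆ (v 2 ⋆ₜ (Sigma ⬝ₜ V 1 ⬝ₜ V 0) ⋆ₜ V 1 ⋆ (proj1 ⋆ₜ V 1 ⋆ₜ V 0) ⋆ v 0))))))))

/-! ### The three types that are claimed to be inhabited -/

/-- `∀ F: ★ ➔ ★. ∀ mono: Mono ·F. Cast ·S.D ·D` -/
def ToDType : Ty :=
  .allTy scheme (.allTm (Mono ⬝ₜ V 0) (Cast ⬝ₜ (ScottD ⬝ₜ V 0) ⬝ₜ (LRD ⬝ₜ V 0 ⬝ v 0)))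

/-- `∀ F: ★ ➔ ★. ∀ mono: Mono ·F.`
`∀ P: S.D ➔ ★. PrfAlgLR ·P ➔ Π x: S.D. PrfAlgLR ·P ➔ P x` -/
def IndLRDType : Ty :=
  .allTy scheme (.allTm (Mono ⬝ₜ V 0) (.allTy (predOn (ScottD ⬝ₜ V 0))
    (PrfAlgLR ⬝ₜ V 1 ⬝ v 0 ⬝ₜ V 0 ⟶ₜ
      .pi (ScottD ⬝ₜ V 1) (PrfAlgLR ⬝ₜ V 1 ⬝ v 1 ⬝ₜ V 0 ⟶ₜ V 0 ⬝ v 0))))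

/-- `∀ F: ★ ➔ ★. Π fmap: Fmap ·F. ∀ fmapId: FmapId ·F fmap. ∀ fmapCompose: FmapCompose ·F fmap.`
`∀ P: S.D ➔ ★. PrfAlgRec ·F fmap ·S.D S.inD ·P ➔ Π x: S.D. P x`, where `S.inD` is taken at
the proof `monoFunctor` that the functor `F` is monotone. -/
def IndDType : Ty :=
  .allTy scheme (.pi (Fmap ⬝ₜ V 0) (.allTm (FmapId ⬝ₜ V 0 ⬝ v 0)
    (.allTm (FmapCompose ⬝ₜ V 0 ⬝ v 1) (.allTy (predOn (ScottD ⬝ₜ V 0))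
      (PrfAlgRec ⬝ₜ V 1 ⬝ v 2 ⬝ₜ (ScottD ⬝ₜ V 1)
          ⬝ (scottInD ⋆ₜ V 1 ⋆ₑ (monoFunctor ⋆ₜ V 1 ⋆ v 2 ⋆ₑ v 1 ⋆ₑ v 0)) ⬝ₜ V 0 ⟶ₜ
        .pi (ScottD ⬝ₜ V 1) (V 0 ⬝ v 0))))))

end CDLE

namespace CDLE

/-! ### Untyped lambda terms: substitution, free variables and normalization -/

@[simp] theorem scons_zero {α : Type} (a : α) (s : ℕ → α) : scons a s 0 = a := rfl

@[simp] theorem scons_succ {α : Type} (a : α) (s : ℕ → α) (n : ℕ) : scons a s (n + 1) = s n := rfl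

@[simp] theorem upRen_zero (r : ℕ → ℕ) : upRen r 0 = 0 := rfl

@[simp] theorem upRen_succ (r : ℕ → ℕ) (n : ℕ) : upRen r (n + 1) = r n + 1 := rfl

namespace Pure

/-- Lift a substitution under a binder. -/
def up (s : ℕ → Pure) : ℕ → Pure := scons (var 0) (fun n => rename Nat.succ (s n))

theorem subst_lam (s : ℕ → Pure) (t : Pure) : subst s (lam t) = lam (subst (up s) t) := rfl

theorem rename_rename (t : Pure) (r q p : ℕ → ℕ) (h : ∀ n, r (q n) = p n) :
    rename r (rename q t) = rename p t := by
  induction t generalizing r q p with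
  | var n => simp [rename, h]
  | lam t ih =>
    simp only [rename, ih (upRen r) (upRen q) (upRen p) (by rintro (_ | n) <;> simp [h])]
  | app t u iht ihu => simp only [rename, iht r q p h, ihu r q p h]

theorem subst_rename (t : Pure) (s : ℕ → Pure) (r : ℕ → ℕ) (p : ℕ → Pure)
    (h : ∀ n, s (r n) = p n) : subst s (rename r t) = subst p t := by
  induction t generalizing s r p with
  | var n => simp [rename, subst, h]
  | lam t ih =>
    simp only [rename, subst_lam,
      ih (up s) (upRen r) (up p) (by rintro (_ | n) <;> simp [up, h])]
  | app t u iht ihu => simp only [rename, subst, iht s r p h, ihu s r p h]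

theorem rename_subst (t : Pure) (r : ℕ → ℕ) (s p : ℕ → Pure)
    (h : ∀ n, rename r (s n) = p n) : rename r (subst s t) = subst p t := by
  induction t generalizing r s p with
  | var n => simp [subst, h]
  | lam t ih =>
    simp only [rename, subst_lam]
    rw [ih (upRen r) (up s) (up p)]
    rintro (_ | n)
    · rfl
    · simp only [up, scons_succ, ← h]
      exact (rename_rename (s n) (upRen r) Nat.succ (fun n => r n + 1) (fun _ => rfl)).trans
        (rename_rename (s n) Nat.succ r _ (fun _ => rfl)).symm
  | app t u iht ihu => simp only [rename, subst, iht r s p h, ihu r s p h]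

theorem subst_subst (t : Pure) (s₁ s₂ p : ℕ → Pure) (h : ∀ n, subst s₁ (s₂ n) = p n) :
    subst s₁ (subst s₂ t) = subst p t := by
  induction t generalizing s₁ s₂ p with
  | var n => simp [subst, h]
  | lam t ih =>
    simp only [subst_lam]
    rw [ih (up s₁) (up s₂) (up p)]
    rintro (_ | n)
    · rfl
    · simp only [up, scons_succ, ← h]
      rw [subst_rename _ _ _ (fun n => rename Nat.succ (s₁ n)) (fun _ => rfl),
        rename_subst _ _ _ _ (fun _ => rfl)]
  | app t u iht ihu => simp only [subst, iht s₁ s₂ p h, ihu s₁ s₂ p h]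

theorem subst_var (t : Pure) (s : ℕ → Pure) (h : ∀ n, s n = var n) : subst s t = t := by
  induction t generalizing s with
  | var n => simp [subst, h]
  | lam t ih =>
    rw [subst_lam, ih]
    rintro (_ | n) <;> simp [up, h, rename]
  | app t u iht ihu => simp only [subst, iht s h, ihu s h]

theorem inst_subst (t u : Pure) (s : ℕ → Pure) :
    (subst (up s) t).inst (subst s u) = subst s (t.inst u) := by
  unfold inst
  rw [subst_subst t (scons (subst s u) var) (up s) (scons (subst s u) s),
    subst_subst t s (scons u var) (scons (subst s u) s)]
  · rintro (_ | n) <;> rfl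
  · rintro (_ | n)
    · rfl
    · simp only [up, scons_succ]
      exact (subst_rename (s n) (scons _ var) Nat.succ var (fun _ => rfl)).trans
        (subst_var (s n) var (fun _ => rfl))

theorem free_rename {t : Pure} {r : ℕ → ℕ} {n : ℕ} (h : Free n (rename r t)) :
    ∃ m, Free m t ∧ r m = n := by
  induction t generalizing r n with
  | var m => exact ⟨m, rfl, h.symm⟩
  | lam t ih =>
    obtain ⟨_ | m, hm, e⟩ := ih (r := upRen r) (n := n + 1) h
    · simp at e
    · exact ⟨m, hm, by simpa using e⟩
  | app t u iht ihu =>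
    rcases h with h | h
    · obtain ⟨m, hm, e⟩ := iht h
      exact ⟨m, .inl hm, e⟩
    · obtain ⟨m, hm, e⟩ := ihu h
      exact ⟨m, .inr hm, e⟩

theorem free_subst {t : Pure} {s : ℕ → Pure} {n : ℕ} (h : Free n (subst s t)) :
    ∃ m, Free m t ∧ Free n (s m) := by
  induction t generalizing s n with
  | var m => exact ⟨m, rfl, h⟩
  | lam t ih =>
    obtain ⟨_ | m, hm, e⟩ := ih (s := up s) (n := n + 1) h
    · cases e
    · obtain ⟨k, hk, e⟩ := free_rename e
      obtain rfl : k = n := by simpa using e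
      exact ⟨m, hm, hk⟩
  | app t u iht ihu =>
    rcases h with h | h
    · obtain ⟨m, hm, e⟩ := iht h
      exact ⟨m, .inl hm, e⟩
    · obtain ⟨m, hm, e⟩ := ihu h
      exact ⟨m, .inr hm, e⟩

theorem free_inst_id {t : Pure} {n : ℕ} (h : Free n (t.inst id)) : Free (n + 1) t := by
  obtain ⟨_ | m, hm, e⟩ := free_subst h
  · cases e
  · cases e
    exact hm

/-- Syntactic equality. -/
def beq : Pure → Pure → Bool
  | var m, var n => Nat.beq m n
  | lam t, lam t' => beq t t'
  | app t u, app t' u' => beq t t' && beq u u'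
  | _, _ => false

theorem eq_of_beq : ∀ {t u : Pure}, beq t u = true → t = u
  | var _, var _, h => congrArg var (Nat.eq_of_beq_eq_true h)
  | lam _, lam _, h => congrArg lam (eq_of_beq h)
  | app _ _, app _ _, h => by
    simp only [beq, Bool.and_eq_true] at h
    rw [eq_of_beq h.1, eq_of_beq h.2]

/-- `λ x. t x` if `x` is not free in `t`, contracted; otherwise `λ x. u`. -/
def etaLam : Pure → Pure
  | app t (var 0) =>
    bif beq ((t.rename Nat.pred).rename Nat.succ) t then t.rename Nat.pred
    else lam (app t (var 0))
  | u => lam u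

/-- Beta-eta-normalization, stopping at recursion depth `k`. -/
def nf : ℕ → Pure → Pure
  | 0, t => t
  | _ + 1, var n => var n
  | k + 1, lam t => etaLam (nf k t)
  | k + 1, app t u =>
    match nf k t with
    | lam b => nf k (b.inst u)
    | t' => app t' (nf k u)

end Pure

namespace BetaEta

theorem subst {t u : Pure} (h : BetaEta t u) (s : ℕ → Pure) :
    BetaEta (t.subst s) (u.subst s) := by
  induction h generalizing s with
  | beta t u => rw [← Pure.inst_subst]; exact .beta _ _
  | eta t =>
    have e : (t.rename Nat.succ).subst (Pure.up s) = (t.subst s).rename Nat.succ := by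
      rw [Pure.subst_rename _ _ _ _ (fun _ => rfl), Pure.rename_subst _ _ _ _ (fun _ => rfl)]
      rfl
    have := BetaEta.eta (t.subst s)
    rwa [← e] at this
  | lam _ ih => exact .lam (ih (Pure.up s))
  | app _ _ ih₁ ih₂ => exact .app (ih₁ s) (ih₂ s)
  | refl t => exact .refl _
  | symm _ ih => exact .symm (ih s)
  | trans _ _ ih₁ ih₂ => exact .trans (ih₁ s) (ih₂ s)

theorem etaLam (t : Pure) : BetaEta (.lam t) (Pure.etaLam t) := by
  unfold Pure.etaLam
  split
  · next t =>
    cases h : Pure.beq ((t.rename Nat.pred).rename Nat.succ) t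
    · exact .refl _
    · conv_lhs => rw [← Pure.eq_of_beq h]
      exact .eta _
  · exact .refl _

theorem nf (k : ℕ) (t : Pure) : BetaEta t (Pure.nf k t) := by
  induction k generalizing t with
  | zero => exact .refl _
  | succ k ih =>
    cases t with
    | var n => exact .refl _
    | lam t => exact .trans (.lam (ih t)) (.etaLam _)
    | app t u =>
      have ht := ih t
      simp only [Pure.nf]
      split
      · next b hb =>
        rw [hb] at ht
        exact .trans (.trans (.app ht (.refl _)) (.beta _ _)) (ih _)
      · exact .app ht (ih u)

theorem of_nf (k : ℕ) {t u : Pure} (h : Pure.beq (Pure.nf k t) (Pure.nf k u) = true) :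
    BetaEta t u :=
  .trans (.nf k t) (Pure.eq_of_beq h ▸ .symm (.nf k u))

end BetaEta

/-! ### Annotated terms: scoping, renaming and substitution -/

mutual

theorem Kd.scoped_mono : ∀ (k : Kd) {a b a' b' : ℕ}, k.Scoped a b → a ≤ a' → b ≤ b' →
    k.Scoped a' b'
  | .star, _, _, _, _, _, _, _ => trivial
  | .piTm T k, _, _, _, _, h, ha, hb =>
    ⟨T.scoped_mono h.1 ha hb, k.scoped_mono h.2 (Nat.succ_le_succ ha) hb⟩
  | .piTy k' k, _, _, _, _, h, ha, hb =>
    ⟨k'.scoped_mono h.1 ha hb, k.scoped_mono h.2 ha (Nat.succ_le_succ hb)⟩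

theorem Ty.scoped_mono : ∀ (T : Ty) {a b a' b' : ℕ}, T.Scoped a b → a ≤ a' → b ≤ b' →
    T.Scoped a' b'
  | .var _, _, _, _, _, h, _, hb => Nat.lt_of_lt_of_le h hb
  | .allTy k T, _, _, _, _, h, ha, hb =>
    ⟨k.scoped_mono h.1 ha hb, T.scoped_mono h.2 ha (Nat.succ_le_succ hb)⟩
  | .lamTy k T, _, _, _, _, h, ha, hb =>
    ⟨k.scoped_mono h.1 ha hb, T.scoped_mono h.2 ha (Nat.succ_le_succ hb)⟩
  | .allTm S T, _, _, _, _, h, ha, hb | .pi S T, _, _, _, _, h, ha, hb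
  | .lamTm S T, _, _, _, _, h, ha, hb | .iota S T, _, _, _, _, h, ha, hb =>
    ⟨S.scoped_mono h.1 ha hb, T.scoped_mono h.2 (Nat.succ_le_succ ha) hb⟩
  | .appTm T t, _, _, _, _, h, ha, hb => ⟨T.scoped_mono h.1 ha hb, t.scoped_mono h.2 ha hb⟩
  | .appTy T S, _, _, _, _, h, ha, hb => ⟨T.scoped_mono h.1 ha hb, S.scoped_mono h.2 ha hb⟩
  | .eq t u, _, _, _, _, h, ha, hb => ⟨t.scoped_mono h.1 ha hb, u.scoped_mono h.2 ha hb⟩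

theorem Tm.scoped_mono : ∀ (t : Tm) {a b a' b' : ℕ}, t.Scoped a b → a ≤ a' → b ≤ b' →
    t.Scoped a' b'
  | .var _, _, _, _, _, h, ha, _ => Nat.lt_of_lt_of_le h ha
  | .lam t, _, _, _, _, h, ha, hb | .lamE t, _, _, _, _, h, ha, hb =>
    t.scoped_mono (a := _ + 1) h (Nat.succ_le_succ ha) hb
  | .lamTy t, _, _, _, _, h, ha, hb => t.scoped_mono (b := _ + 1) h ha (Nat.succ_le_succ hb)
  | .app t u, _, _, _, _, h, ha, hb | .appE t u, _, _, _, _, h, ha, hb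
  | .pair t u, _, _, _, _, h, ha, hb => ⟨t.scoped_mono h.1 ha hb, u.scoped_mono h.2 ha hb⟩
  | .appTy t T, _, _, _, _, h, ha, hb => ⟨t.scoped_mono h.1 ha hb, T.scoped_mono h.2 ha hb⟩
  | .fst t, _, _, _, _, h, ha, hb | .snd t, _, _, _, _, h, ha, hb
  | .beta t, _, _, _, _, h, ha, hb | .delta t, _, _, _, _, h, ha, hb
  | .sym t, _, _, _, _, h, ha, hb => t.scoped_mono (b := _) h ha hb
  | .rho t T u, _, _, _, _, h, ha, hb =>
    ⟨t.scoped_mono h.1 ha hb, T.scoped_mono h.2.1 (Nat.succ_le_succ ha) hb,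
      u.scoped_mono h.2.2 ha hb⟩
  | .phi t u w, _, _, _, _, h, ha, hb =>
    ⟨t.scoped_mono h.1 ha hb, u.scoped_mono h.2.1 ha hb, w.scoped_mono h.2.2 ha hb⟩
  | .chi T t, _, _, _, _, h, ha, hb => ⟨T.scoped_mono h.1 ha hb, t.scoped_mono h.2 ha hb⟩
  | .letIn T t u, _, _, _, _, h, ha, hb =>
    ⟨T.scoped_mono h.1 ha hb, t.scoped_mono h.2.1 ha hb,
      u.scoped_mono h.2.2 (Nat.succ_le_succ ha) hb⟩

end

theorem upRen_fixed {r : ℕ → ℕ} {a : ℕ} (h : ∀ n < a, r n = n) : ∀ n < a + 1, upRen r n = n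
  | 0, _ => rfl
  | n + 1, hn => congrArg Nat.succ (h n (Nat.lt_of_succ_lt_succ hn))

mutual

theorem Kd.rename_of_scoped : ∀ (e : Kd) {r q : ℕ → ℕ} {a b : ℕ}, (∀ n < a, r n = n) →
    (∀ n < b, q n = n) → e.Scoped a b → e.rename r q = e
  | .star, _, _, _, _, hr, hq, h => rfl
  | .piTm x y, _, _, _, _, hr, hq, h => by
    simp only [Kd.rename, x.rename_of_scoped hr hq h.1, y.rename_of_scoped (upRen_fixed hr) hq h.2]
  | .piTy x y, _, _, _, _, hr, hq, h => by
    simp only [Kd.rename, x.rename_of_scoped hr hq h.1, y.rename_of_scoped hr (upRen_fixed hq) h.2]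

theorem Ty.rename_of_scoped : ∀ (e : Ty) {r q : ℕ → ℕ} {a b : ℕ}, (∀ n < a, r n = n) →
    (∀ n < b, q n = n) → e.Scoped a b → e.rename r q = e
  | .var x, _, _, _, _, hr, hq, h => congrArg Ty.var (hq x h)
  | .allTy x y, _, _, _, _, hr, hq, h => by
    simp only [Ty.rename, x.rename_of_scoped hr hq h.1, y.rename_of_scoped hr (upRen_fixed hq) h.2]
  | .allTm x y, _, _, _, _, hr, hq, h => by
    simp only [Ty.rename, x.rename_of_scoped hr hq h.1, y.rename_of_scoped (upRen_fixed hr) hq h.2]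
  | .pi x y, _, _, _, _, hr, hq, h => by
    simp only [Ty.rename, x.rename_of_scoped hr hq h.1, y.rename_of_scoped (upRen_fixed hr) hq h.2]
  | .lamTm x y, _, _, _, _, hr, hq, h => by
    simp only [Ty.rename, x.rename_of_scoped hr hq h.1, y.rename_of_scoped (upRen_fixed hr) hq h.2]
  | .lamTy x y, _, _, _, _, hr, hq, h => by
    simp only [Ty.rename, x.rename_of_scoped hr hq h.1, y.rename_of_scoped hr (upRen_fixed hq) h.2]
  | .appTm x y, _, _, _, _, hr, hq, h => by
    simp only [Ty.rename, x.rename_of_scoped hr hq h.1, y.rename_of_scoped hr hq h.2]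
  | .appTy x y, _, _, _, _, hr, hq, h => by
    simp only [Ty.rename, x.rename_of_scoped hr hq h.1, y.rename_of_scoped hr hq h.2]
  | .iota x y, _, _, _, _, hr, hq, h => by
    simp only [Ty.rename, x.rename_of_scoped hr hq h.1, y.rename_of_scoped (upRen_fixed hr) hq h.2]
  | .eq x y, _, _, _, _, hr, hq, h => by
    simp only [Ty.rename, x.rename_of_scoped hr hq h.1, y.rename_of_scoped hr hq h.2]

theorem Tm.rename_of_scoped : ∀ (e : Tm) {r q : ℕ → ℕ} {a b : ℕ}, (∀ n < a, r n = n) →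
    (∀ n < b, q n = n) → e.Scoped a b → e.rename r q = e
  | .var x, _, _, _, _, hr, hq, h => congrArg Tm.var (hr x h)
  | .lam x, _, _, _, _, hr, hq, h => by
    simp only [Tm.rename, x.rename_of_scoped (upRen_fixed hr) hq h]
  | .app x y, _, _, _, _, hr, hq, h => by
    simp only [Tm.rename, x.rename_of_scoped hr hq h.1, y.rename_of_scoped hr hq h.2]
  | .lamTy x, _, _, _, _, hr, hq, h => by
    simp only [Tm.rename, x.rename_of_scoped hr (upRen_fixed hq) h]
  | .appTy x y, _, _, _, _, hr, hq, h => by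
    simp only [Tm.rename, x.rename_of_scoped hr hq h.1, y.rename_of_scoped hr hq h.2]
  | .lamE x, _, _, _, _, hr, hq, h => by
    simp only [Tm.rename, x.rename_of_scoped (upRen_fixed hr) hq h]
  | .appE x y, _, _, _, _, hr, hq, h => by
    simp only [Tm.rename, x.rename_of_scoped hr hq h.1, y.rename_of_scoped hr hq h.2]
  | .pair x y, _, _, _, _, hr, hq, h => by
    simp only [Tm.rename, x.rename_of_scoped hr hq h.1, y.rename_of_scoped hr hq h.2]
  | .fst x, _, _, _, _, hr, hq, h => by
    simp only [Tm.rename, x.rename_of_scoped hr hq h]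
  | .snd x, _, _, _, _, hr, hq, h => by
    simp only [Tm.rename, x.rename_of_scoped hr hq h]
  | .beta x, _, _, _, _, hr, hq, h => by
    simp only [Tm.rename, x.rename_of_scoped hr hq h]
  | .rho x y z, _, _, _, _, hr, hq, h => by
    simp only [Tm.rename, x.rename_of_scoped hr hq h.1, y.rename_of_scoped (upRen_fixed hr) hq h.2.1, z.rename_of_scoped hr hq h.2.2]
  | .phi x y z, _, _, _, _, hr, hq, h => by
    simp only [Tm.rename, x.rename_of_scoped hr hq h.1, y.rename_of_scoped hr hq h.2.1, z.rename_of_scoped hr hq h.2.2]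
  | .chi x y, _, _, _, _, hr, hq, h => by
    simp only [Tm.rename, x.rename_of_scoped hr hq h.1, y.rename_of_scoped hr hq h.2]
  | .letIn x y z, _, _, _, _, hr, hq, h => by
    simp only [Tm.rename, x.rename_of_scoped hr hq h.1, y.rename_of_scoped hr hq h.2.1, z.rename_of_scoped (upRen_fixed hr) hq h.2.2]
  | .delta x, _, _, _, _, hr, hq, h => by
    simp only [Tm.rename, x.rename_of_scoped hr hq h]
  | .sym x, _, _, _, _, hr, hq, h => by
    simp only [Tm.rename, x.rename_of_scoped hr hq h]

end

/-- The substitution `s` is the identity on the first `a` term variables and the first `b` type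
variables. -/
structure Sub.Fixes (s : Sub) (a b : ℕ) : Prop where
  tm : ∀ n < a, s.tm n = .var n
  ty : ∀ n < b, s.ty n = .var n

theorem Sub.Fixes.upTm {s : Sub} {a b : ℕ} (h : s.Fixes a b) : s.upTm.Fixes (a + 1) b where
  tm
    | 0, _ => rfl
    | n + 1, hn => congrArg Tm.wkTm (h.tm n (Nat.lt_of_succ_lt_succ hn))
  ty n hn := congrArg Ty.wkTm (h.ty n hn)

theorem Sub.Fixes.upTy {s : Sub} {a b : ℕ} (h : s.Fixes a b) : s.upTy.Fixes a (b + 1) where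
  ty
    | 0, _ => rfl
    | n + 1, hn => congrArg Ty.wkTy (h.ty n (Nat.lt_of_succ_lt_succ hn))
  tm n hn := congrArg Tm.wkTy (h.tm n hn)

mutual

theorem Kd.subst_of_scoped : ∀ (e : Kd) {s : Sub} {a b : ℕ}, s.Fixes a b → e.Scoped a b → e.subst s = e
  | .star, _, _, _, hs, h => rfl
  | .piTm x y, _, _, _, hs, h => by
    simp only [Kd.subst, x.subst_of_scoped hs h.1, y.subst_of_scoped hs.upTm h.2]
  | .piTy x y, _, _, _, hs, h => by
    simp only [Kd.subst, x.subst_of_scoped hs h.1, y.subst_of_scoped hs.upTy h.2]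

theorem Ty.subst_of_scoped : ∀ (e : Ty) {s : Sub} {a b : ℕ}, s.Fixes a b → e.Scoped a b → e.subst s = e
  | .var x, _, _, _, hs, h => hs.ty x h
  | .allTy x y, _, _, _, hs, h => by
    simp only [Ty.subst, x.subst_of_scoped hs h.1, y.subst_of_scoped hs.upTy h.2]
  | .allTm x y, _, _, _, hs, h => by
    simp only [Ty.subst, x.subst_of_scoped hs h.1, y.subst_of_scoped hs.upTm h.2]
  | .pi x y, _, _, _, hs, h => by
    simp only [Ty.subst, x.subst_of_scoped hs h.1, y.subst_of_scoped hs.upTm h.2]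
  | .lamTm x y, _, _, _, hs, h => by
    simp only [Ty.subst, x.subst_of_scoped hs h.1, y.subst_of_scoped hs.upTm h.2]
  | .lamTy x y, _, _, _, hs, h => by
    simp only [Ty.subst, x.subst_of_scoped hs h.1, y.subst_of_scoped hs.upTy h.2]
  | .appTm x y, _, _, _, hs, h => by
    simp only [Ty.subst, x.subst_of_scoped hs h.1, y.subst_of_scoped hs h.2]
  | .appTy x y, _, _, _, hs, h => by
    simp only [Ty.subst, x.subst_of_scoped hs h.1, y.subst_of_scoped hs h.2]
  | .iota x y, _, _, _, hs, h => by
    simp only [Ty.subst, x.subst_of_scoped hs h.1, y.subst_of_scoped hs.upTm h.2]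
  | .eq x y, _, _, _, hs, h => by
    simp only [Ty.subst, x.subst_of_scoped hs h.1, y.subst_of_scoped hs h.2]

theorem Tm.subst_of_scoped : ∀ (e : Tm) {s : Sub} {a b : ℕ}, s.Fixes a b → e.Scoped a b → e.subst s = e
  | .var x, _, _, _, hs, h => hs.tm x h
  | .lam x, _, _, _, hs, h => by
    simp only [Tm.subst, x.subst_of_scoped hs.upTm h]
  | .app x y, _, _, _, hs, h => by
    simp only [Tm.subst, x.subst_of_scoped hs h.1, y.subst_of_scoped hs h.2]
  | .lamTy x, _, _, _, hs, h => by
    simp only [Tm.subst, x.subst_of_scoped hs.upTy h]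
  | .appTy x y, _, _, _, hs, h => by
    simp only [Tm.subst, x.subst_of_scoped hs h.1, y.subst_of_scoped hs h.2]
  | .lamE x, _, _, _, hs, h => by
    simp only [Tm.subst, x.subst_of_scoped hs.upTm h]
  | .appE x y, _, _, _, hs, h => by
    simp only [Tm.subst, x.subst_of_scoped hs h.1, y.subst_of_scoped hs h.2]
  | .pair x y, _, _, _, hs, h => by
    simp only [Tm.subst, x.subst_of_scoped hs h.1, y.subst_of_scoped hs h.2]
  | .fst x, _, _, _, hs, h => by
    simp only [Tm.subst, x.subst_of_scoped hs h]
  | .snd x, _, _, _, hs, h => by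
    simp only [Tm.subst, x.subst_of_scoped hs h]
  | .beta x, _, _, _, hs, h => by
    simp only [Tm.subst, x.subst_of_scoped hs h]
  | .rho x y z, _, _, _, hs, h => by
    simp only [Tm.subst, x.subst_of_scoped hs h.1, y.subst_of_scoped hs.upTm h.2.1, z.subst_of_scoped hs h.2.2]
  | .phi x y z, _, _, _, hs, h => by
    simp only [Tm.subst, x.subst_of_scoped hs h.1, y.subst_of_scoped hs h.2.1, z.subst_of_scoped hs h.2.2]
  | .chi x y, _, _, _, hs, h => by
    simp only [Tm.subst, x.subst_of_scoped hs h.1, y.subst_of_scoped hs h.2]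
  | .letIn x y z, _, _, _, hs, h => by
    simp only [Tm.subst, x.subst_of_scoped hs h.1, y.subst_of_scoped hs h.2.1, z.subst_of_scoped hs.upTm h.2.2]
  | .delta x, _, _, _, hs, h => by
    simp only [Tm.subst, x.subst_of_scoped hs h]
  | .sym x, _, _, _, hs, h => by
    simp only [Tm.subst, x.subst_of_scoped hs h]

end

/-- The substitution `s` undoes the renaming `r`, `q`. -/
structure Sub.Undoes (s : Sub) (r q : ℕ → ℕ) : Prop where
  tm : ∀ n, s.tm (r n) = .var n
  ty : ∀ n, s.ty (q n) = .var n

theorem Sub.Undoes.upTm {s : Sub} {r q : ℕ → ℕ} (h : s.Undoes r q) :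
    s.upTm.Undoes (upRen r) q where
  tm
    | 0 => rfl
    | n + 1 => congrArg Tm.wkTm (h.tm n)
  ty n := congrArg Ty.wkTm (h.ty n)

theorem Sub.Undoes.upTy {s : Sub} {r q : ℕ → ℕ} (h : s.Undoes r q) :
    s.upTy.Undoes r (upRen q) where
  ty
    | 0 => rfl
    | n + 1 => congrArg Ty.wkTy (h.ty n)
  tm n := congrArg Tm.wkTy (h.tm n)

mutual

theorem Kd.subst_rename : ∀ (e : Kd) {s : Sub} {r q : ℕ → ℕ}, s.Undoes r q → (e.rename r q).subst s = e
  | .star, _, _, _, hs => rfl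
  | .piTm x y, _, _, _, hs => by
    simp only [Kd.rename, Kd.subst, x.subst_rename hs, y.subst_rename hs.upTm]
  | .piTy x y, _, _, _, hs => by
    simp only [Kd.rename, Kd.subst, x.subst_rename hs, y.subst_rename hs.upTy]

theorem Ty.subst_rename : ∀ (e : Ty) {s : Sub} {r q : ℕ → ℕ}, s.Undoes r q → (e.rename r q).subst s = e
  | .var x, _, _, _, hs => hs.ty x
  | .allTy x y, _, _, _, hs => by
    simp only [Ty.rename, Ty.subst, x.subst_rename hs, y.subst_rename hs.upTy]
  | .allTm x y, _, _, _, hs => by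
    simp only [Ty.rename, Ty.subst, x.subst_rename hs, y.subst_rename hs.upTm]
  | .pi x y, _, _, _, hs => by
    simp only [Ty.rename, Ty.subst, x.subst_rename hs, y.subst_rename hs.upTm]
  | .lamTm x y, _, _, _, hs => by
    simp only [Ty.rename, Ty.subst, x.subst_rename hs, y.subst_rename hs.upTm]
  | .lamTy x y, _, _, _, hs => by
    simp only [Ty.rename, Ty.subst, x.subst_rename hs, y.subst_rename hs.upTy]
  | .appTm x y, _, _, _, hs => by
    simp only [Ty.rename, Ty.subst, x.subst_rename hs, y.subst_rename hs]
  | .appTy x y, _, _, _, hs => by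
    simp only [Ty.rename, Ty.subst, x.subst_rename hs, y.subst_rename hs]
  | .iota x y, _, _, _, hs => by
    simp only [Ty.rename, Ty.subst, x.subst_rename hs, y.subst_rename hs.upTm]
  | .eq x y, _, _, _, hs => by
    simp only [Ty.rename, Ty.subst, x.subst_rename hs, y.subst_rename hs]

theorem Tm.subst_rename : ∀ (e : Tm) {s : Sub} {r q : ℕ → ℕ}, s.Undoes r q → (e.rename r q).subst s = e
  | .var x, _, _, _, hs => hs.tm x
  | .lam x, _, _, _, hs => by
    simp only [Tm.rename, Tm.subst, x.subst_rename hs.upTm]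
  | .app x y, _, _, _, hs => by
    simp only [Tm.rename, Tm.subst, x.subst_rename hs, y.subst_rename hs]
  | .lamTy x, _, _, _, hs => by
    simp only [Tm.rename, Tm.subst, x.subst_rename hs.upTy]
  | .appTy x y, _, _, _, hs => by
    simp only [Tm.rename, Tm.subst, x.subst_rename hs, y.subst_rename hs]
  | .lamE x, _, _, _, hs => by
    simp only [Tm.rename, Tm.subst, x.subst_rename hs.upTm]
  | .appE x y, _, _, _, hs => by
    simp only [Tm.rename, Tm.subst, x.subst_rename hs, y.subst_rename hs]
  | .pair x y, _, _, _, hs => by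
    simp only [Tm.rename, Tm.subst, x.subst_rename hs, y.subst_rename hs]
  | .fst x, _, _, _, hs => by
    simp only [Tm.rename, Tm.subst, x.subst_rename hs]
  | .snd x, _, _, _, hs => by
    simp only [Tm.rename, Tm.subst, x.subst_rename hs]
  | .beta x, _, _, _, hs => by
    simp only [Tm.rename, Tm.subst, x.subst_rename hs]
  | .rho x y z, _, _, _, hs => by
    simp only [Tm.rename, Tm.subst, x.subst_rename hs, y.subst_rename hs.upTm, z.subst_rename hs]
  | .phi x y z, _, _, _, hs => by
    simp only [Tm.rename, Tm.subst, x.subst_rename hs, y.subst_rename hs, z.subst_rename hs]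
  | .chi x y, _, _, _, hs => by
    simp only [Tm.rename, Tm.subst, x.subst_rename hs, y.subst_rename hs]
  | .letIn x y z, _, _, _, hs => by
    simp only [Tm.rename, Tm.subst, x.subst_rename hs, y.subst_rename hs, z.subst_rename hs.upTm]
  | .delta x, _, _, _, hs => by
    simp only [Tm.rename, Tm.subst, x.subst_rename hs]
  | .sym x, _, _, _, hs => by
    simp only [Tm.rename, Tm.subst, x.subst_rename hs]

end

theorem Ty.wkTm_instTm (T : Ty) (u : Tm) : T.wkTm.instTm u = T :=
  T.subst_rename ⟨fun _ => rfl, fun _ => rfl⟩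

theorem Ty.wkTy_instTy (T A : Ty) : T.wkTy.instTy A = T :=
  T.subst_rename ⟨fun _ => rfl, fun _ => rfl⟩

/-! ### The definitions that inhabit the three types -/

/-- `rollCast ◂ ∀ D: ★. Cast ·D ·S.D ➔ DFI ·D ➔ S.D = Λ D. λ c. λ d. rollD ((monoDFI c).1 d)`
with module parameters `(F: ★ ➔ ★) {mono: Mono ·F}`. -/
def rollCast : Tm := .chi
  (.allTy scheme (.allTm (Mono ⬝ₜ V 0) (.allTy .star
    (Cast ⬝ₜ V 0 ⬝ₜ (ScottD ⬝ₜ V 1) ⟶ₜ DFI ⬝ₜ V 1 ⬝ₜ V 0 ⟶ₜ ScottD ⬝ₜ V 1))))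
  (.lamTy (.lamE (.lamTy (.lam (.lam (rollD ⋆ₜ V 1 ⋆ₑ v 2 ⋆
    (.fst (monoDFI ⋆ₜ V 1 ⋆ₑ v 2 ⋆ₜ V 0 ⋆ₜ (ScottD ⬝ₜ V 1) ⋆ v 1) ⋆ v 0)))))))

/-- `indCast ◂ ∀ D: ★. Π c: Cast ·D ·S.D. ∀ P: S.D ➔ ★. ∀ Y: ★.`
`Cast ·D ·(ι x: S.D. DRec ·P x ·Y) ➾ Π d: DFI ·D.`
`(Π xs: F ·(ι x: S.D. DRec ·P x ·Y). Y ➔ P (inDRec xs)) ➔ Y ➔ P (rollCast c d)`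
`= Λ D. λ c. Λ P. Λ Y. Λ c'. λ d. λ a. λ y. d.2`
`·(λ x: DF ·D. ∀ eq: {rollCast c d ≃ x}. Y ➔ P (φ eq - (rollCast c d) {x}))`
`(λ xs. Λ eq. λ b. a (elimCast -(mono c') xs) b) -β y`
with module parameters `(F: ★ ➔ ★) {mono: Mono ·F}`. -/
def indCast : Tm := .chi
  (.allTy scheme (.allTm (Mono ⬝ₜ V 0) (.allTy .star (.pi (Cast ⬝ₜ V 0 ⬝ₜ (ScottD ⬝ₜ V 1))
    (.allTy (predOn (ScottD ⬝ₜ V 1)) (.allTy .star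
      (Cast ⬝ₜ V 2 ⬝ₜ handle (V 3) (V 1) (V 0) ⟹ₜ .pi (DFI ⬝ₜ V 3 ⬝ₜ V 2)
        (.pi (V 3 ⬝ₜ handle (V 3) (V 1) (V 0))
            (V 0 ⟶ₜ V 1 ⬝ (inDRec ⋆ₜ V 3 ⋆ₑ v 3 ⋆ₜ V 1 ⋆ₜ V 0 ⋆ v 0)) ⟶ₜ
          V 0 ⟶ₜ V 1 ⬝ (rollCast ⋆ₜ V 3 ⋆ₑ v 2 ⋆ₜ V 2 ⋆ v 1 ⋆ v 0)))))))))
  (.lamTy (.lamE (.lamTy (.lam (.lamTy (.lamTy (.lamE (.lam (.lam (.lam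
    (.snd (v 2)
      ⋆ₜ .lamTm (DF ⬝ₜ V 3 ⬝ₜ V 2)
        (.allTm (.eq (rollCast ⋆ₜ V 3 ⋆ₑ v 6 ⋆ₜ V 2 ⋆ v 5 ⋆ v 3) (v 0))
          (V 0 ⟶ₜ V 1 ⬝ .phi (v 0) (rollCast ⋆ₜ V 3 ⋆ₑ v 7 ⋆ₜ V 2 ⋆ v 6 ⋆ v 4) (v 1)))
      ⋆ .lam (.lamE (.lam (v 4
        ⋆ (elimCast ⋆ₜ (V 3 ⬝ₜ V 2) ⋆ₜ (V 3 ⬝ₜ handle (V 3) (V 1) (V 0))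
          ⋆ₑ (v 8 ⋆ₜ V 2 ⋆ₜ handle (V 3) (V 1) (V 0) ⋆ v 6) ⋆ v 2)
        ⋆ v 0)))
      ⋆ₑ rfl' ⋆ v 0)))))))))))

/-- `toD = [λ x. x ·D -[λ d. [rollCast fromD d, Λ P. λ a. λ a'.`
`indCast fromD ·P ·(PrfAlgLR ·P) -[λ z. [z.1, z.2 ·P], β] d (a ·(PrfAlgLR ·P)) a'], β], β]`,
where `D` is `LRD` and `fromD` is `[λ z. z.1, β] : Cast ·D ·S.D`. -/
def toD : Tm := .chi
  (ToDType)
  (.lamTy (.lamE (.pair (.lam (v 0 ⋆ₜ (LRD ⬝ₜ V 0 ⬝ v 1) ⋆ₑ .pair (.lam (.pair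
      (rollCast ⋆ₜ V 0 ⋆ₑ v 2 ⋆ₜ (LRD ⬝ₜ V 0 ⬝ v 2) ⋆ .pair (.lam (.fst (v 0))) rfl' ⋆ v 0)
      (.lamTy (.lam (.lam (indCast ⋆ₜ V 1 ⋆ₑ v 4 ⋆ₜ (LRD ⬝ₜ V 1 ⬝ v 4)
        ⋆ .pair (.lam (.fst (v 0))) rfl' ⋆ₜ V 0 ⋆ₜ (PrfAlgLR ⬝ₜ V 1 ⬝ v 4 ⬝ₜ V 0)
        ⋆ₑ .pair (.lam (.pair (.fst (v 0)) (.snd (v 0) ⋆ₜ V 0))) rfl' ⋆ v 2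
        ⋆ (v 1 ⋆ₜ (PrfAlgLR ⬝ₜ V 1 ⬝ v 4 ⬝ₜ V 0)) ⋆ v 0)))))) rfl')) rfl')))

/-- `indLRD = Λ P. λ a. λ x. λ a'. (toD.1 x).2 ·P a a'` with module parameters
`(F: ★ ➔ ★) {mono: Mono ·F}`. -/
def indLRD : Tm := .chi
  (IndLRDType)
  (.lamTy (.lamE (.lamTy (.lam (.lam (.lam
    (.snd (.fst (toD ⋆ₜ V 1 ⋆ₑ v 3) ⋆ v 1) ⋆ₜ V 0 ⋆ v 2 ⋆ v 0)))))))

/-- `mkSigma ◂ ∀ S: ★. ∀ T: S ➔ ★. Π s: S. T s ➔ Sigma ·S ·T`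
`= Λ S. Λ T. λ s. λ t. [mkPreSigma s t, Λ P. λ k. k s t] .` -/
def mkSigma : Tm := .chi
  (.allTy .star (.allTy (predOn (V 0)) (.pi (V 1) (V 0 ⬝ v 0 ⟶ₜ Sigma ⬝ₜ V 1 ⬝ₜ V 0))))
  (.lamTy (.lamTy (.lam (.lam (.pair (mkPreSigma ⋆ₜ V 1 ⋆ₜ V 0 ⋆ v 1 ⋆ v 0)
    (.lamTy (.lam (v 0 ⋆ v 2 ⋆ v 1))))))))

/-- `fmapSection ◂ ∀ X: ★. ∀ Y: ★. ∀ Z: ★. Π p: Y ➔ Z. Π q: X ➔ Y. (Π x: X. {p (q x) ≃ x}) ➔`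
`Π xs: F ·X. {fmap p (fmap q xs) ≃ xs}`
`= Λ X. Λ Y. Λ Z. λ p. λ q. λ h. λ xs.`
`ρ (fmapCompose p q xs) @z. {z ≃ xs} - (fmapId (λ x. p (q x)) h xs)`
with module parameters
`(F: ★ ➔ ★) (fmap: Fmap ·F) (fmapId: FmapId ·F fmap) (fmapCompose: FmapCompose ·F fmap)`. -/
def fmapSection : Tm := .chi
  (.allTy scheme (.pi (Fmap ⬝ₜ V 0) (.pi (FmapId ⬝ₜ V 0 ⬝ v 0) (.pi (FmapCompose ⬝ₜ V 0 ⬝ v 1)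
    (.allTy .star (.allTy .star (.allTy .star (.pi (V 1 ⟶ₜ V 0) (.pi (V 2 ⟶ₜ V 1)
      (.pi (V 2) (.eq (v 2 ⋆ (v 1 ⋆ v 0)) (v 0)) ⟶ₜ .pi (V 3 ⬝ₜ V 2)
        (.eq (v 5 ⋆ₜ V 1 ⋆ₜ V 0 ⋆ v 2 ⋆ (v 5 ⋆ₜ V 2 ⋆ₜ V 1 ⋆ v 1 ⋆ v 0)) (v 0))))))))))))
  (.lamTy (.lam (.lam (.lam (.lamTy (.lamTy (.lamTy (.lam (.lam (.lam (.lam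
    (.rho (v 4 ⋆ₜ V 2 ⋆ₜ V 1 ⋆ₜ V 0 ⋆ v 3 ⋆ v 2 ⋆ v 0) (.eq (v 0) (v 1))
      (v 5 ⋆ₜ V 2 ⋆ₜ V 0 ⋆ .lam (v 4 ⋆ (v 3 ⋆ v 0)) ⋆ v 1 ⋆ v 0)))))))))))))

/-- `algLROfRec ◂ ∀ P: S.D ➔ ★. PrfAlgRec ·P ➔ PrfAlgLR ·P = Λ P. λ a. Λ Y. λ xs. λ y.`
`ρ (ς (fmapSection proj1 (λ h. mkSigma h.1 (h.2 y y)) (λ h. β) xs)) @z. P (S.inD z) -`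
`a (fmap (λ h. mkSigma h.1 (h.2 y y)) xs)`
with module parameters
`(F: ★ ➔ ★) (fmap: Fmap ·F) {fmapId: FmapId ·F fmap} {fmapCompose: FmapCompose ·F fmap}`. -/
def algLROfRec : Tm := .chi
  (.allTy scheme (.pi (Fmap ⬝ₜ V 0) (.allTm (FmapId ⬝ₜ V 0 ⬝ v 0)
    (.allTm (FmapCompose ⬝ₜ V 0 ⬝ v 1) (.allTy (predOn (ScottD ⬝ₜ V 0))
      (PrfAlgRec ⬝ₜ V 1 ⬝ v 2 ⬝ₜ (ScottD ⬝ₜ V 1)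
          ⬝ (scottInD ⋆ₜ V 1 ⋆ₑ (monoFunctor ⋆ₜ V 1 ⋆ v 2 ⋆ₑ v 1 ⋆ₑ v 0)) ⬝ₜ V 0 ⟶ₜ
        PrfAlgLR ⬝ₜ V 1 ⬝ (monoFunctor ⋆ₜ V 1 ⋆ v 2 ⋆ₑ v 1 ⋆ₑ v 0) ⬝ₜ V 0))))))
  (.lamTy (.lam (.lamE (.lamE (.lamTy (.lam (.lamTy (.lam (.lam
    (.rho (.sym (fmapSection ⋆ₜ V 2 ⋆ v 5 ⋆ v 4 ⋆ v 3 ⋆ₜ handle (V 2) (V 1) (V 0)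
        ⋆ₜ (Sigma ⬝ₜ (ScottD ⬝ₜ V 2) ⬝ₜ V 1) ⋆ₜ (ScottD ⬝ₜ V 2)
        ⋆ (proj1 ⋆ₜ (ScottD ⬝ₜ V 2) ⋆ₜ V 1)
        ⋆ .lam (mkSigma ⋆ₜ (ScottD ⬝ₜ V 2) ⋆ₜ V 1 ⋆ .fst (v 0) ⋆ (.snd (v 0) ⋆ v 1 ⋆ v 1))
        ⋆ .lam rfl' ⋆ v 1))
      (V 1 ⬝ (scottInD ⋆ₜ V 2 ⋆ₑ (monoFunctor ⋆ₜ V 2 ⋆ v 6 ⋆ₑ v 5 ⋆ₑ v 4) ⋆ v 0))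
      (v 2 ⋆ (v 5 ⋆ₜ handle (V 2) (V 1) (V 0) ⋆ₜ (Sigma ⬝ₜ (ScottD ⬝ₜ V 2) ⬝ₜ V 1)
        ⋆ .lam (mkSigma ⋆ₜ (ScottD ⬝ₜ V 2) ⋆ₜ V 1 ⋆ .fst (v 0) ⋆ (.snd (v 0) ⋆ v 1 ⋆ v 1))
        ⋆ v 1))))))))))))

/-- `indD = Λ P. λ a. λ x. indLRD -monoFunctor ·P (algLROfRec a) x (algLROfRec a)` with module
parameters
`(F: ★ ➔ ★) (fmap: Fmap ·F) {fmapId: FmapId ·F fmap} {fmapCompose: FmapCompose ·F fmap}`. -/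
def indD : Tm := .chi
  (IndDType)
  (.lamTy (.lam (.lamE (.lamE (.lamTy (.lam (.lam
    (indLRD ⋆ₜ V 1 ⋆ₑ (monoFunctor ⋆ₜ V 1 ⋆ v 4 ⋆ₑ v 3 ⋆ₑ v 2) ⋆ₜ V 0
      ⋆ (algLROfRec ⋆ₜ V 1 ⋆ v 4 ⋆ₑ v 3 ⋆ₑ v 2 ⋆ₜ V 0 ⋆ v 1) ⋆ v 0
      ⋆ (algLROfRec ⋆ₜ V 1 ⋆ v 4 ⋆ₑ v 3 ⋆ₑ v 2 ⋆ₜ V 0 ⋆ v 1)))))))))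

/-! ### The Cedille definitions are closed -/

section Closed

theorem upRen_one (r : ℕ → ℕ) : upRen r 1 = r 0 + 1 := rfl
theorem upRen_two (r : ℕ → ℕ) : upRen r 2 = r 1 + 1 := rfl
theorem upRen_three (r : ℕ → ℕ) : upRen r 3 = r 2 + 1 := rfl
theorem upRen_four (r : ℕ → ℕ) : upRen r 4 = r 3 + 1 := rfl

attribute [local simp] upRen_one upRen_two upRen_three upRen_four Kd.rename Ty.rename Tm.rename
  arrow earrow predOn scheme idTm rfl' handle Ty.wkTm

@[simp] theorem Top_rename (r q : ℕ → ℕ) : Top.rename r q = Top := by simp [Top]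
@[simp] theorem View_rename (r q : ℕ → ℕ) : View.rename r q = View := by simp [View]
@[simp] theorem intrView_rename (r q : ℕ → ℕ) : intrView.rename r q = intrView := by simp [intrView]
@[simp] theorem elimView_rename (r q : ℕ → ℕ) : elimView.rename r q = elimView := by simp [elimView]
@[simp] theorem extView_rename (r q : ℕ → ℕ) : extView.rename r q = extView := by simp [extView]
@[simp] theorem Cast_rename (r q : ℕ → ℕ) : Cast.rename r q = Cast := by simp [Cast]
@[simp] theorem intrCast_rename (r q : ℕ → ℕ) : intrCast.rename r q = intrCast := by simp [intrCast]
@[simp] theorem elimCast_rename (r q : ℕ → ℕ) : elimCast.rename r q = elimCast := by simp [elimCast]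
@[simp] theorem castTrans_rename (r q : ℕ → ℕ) : castTrans.rename r q = castTrans := by simp [castTrans]
@[simp] theorem Mono_rename (r q : ℕ → ℕ) : Mono.rename r q = Mono := by simp [Mono]
@[simp] theorem Rec_rename (r q : ℕ → ℕ) : Rec.rename r q = Rec := by simp [Rec]
@[simp] theorem recLB_rename (r q : ℕ → ℕ) : recLB.rename r q = recLB := by simp [recLB]
@[simp] theorem recGLB_rename (r q : ℕ → ℕ) : recGLB.rename r q = recGLB := by simp [recGLB]
@[simp] theorem recRoll_rename (r q : ℕ → ℕ) : recRoll.rename r q = recRoll := by simp [recRoll]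
@[simp] theorem roll_rename (r q : ℕ → ℕ) : roll.rename r q = roll := by simp [roll]
@[simp] theorem AlgCase_rename (r q : ℕ → ℕ) : AlgCase.rename r q = AlgCase := by simp [AlgCase]
@[simp] theorem DF_rename (r q : ℕ → ℕ) : DF.rename r q = DF := by simp [DF]
@[simp] theorem inDF_rename (r q : ℕ → ℕ) : inDF.rename r q = inDF := by simp [inDF]
@[simp] theorem monoDF_rename (r q : ℕ → ℕ) : monoDF.rename r q = monoDF := by simp [monoDF]
@[simp] theorem WkPrfAlg_rename (r q : ℕ → ℕ) : WkPrfAlg.rename r q = WkPrfAlg := by simp [WkPrfAlg]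
@[simp] theorem WkIndDF_rename (r q : ℕ → ℕ) : WkIndDF.rename r q = WkIndDF := by simp [WkIndDF]
@[simp] theorem inWkIndDF_rename (r q : ℕ → ℕ) : inWkIndDF.rename r q = inWkIndDF := by simp [inWkIndDF]
@[simp] theorem DFI_rename (r q : ℕ → ℕ) : DFI.rename r q = DFI := by simp [DFI]
@[simp] theorem monoDFI_rename (r q : ℕ → ℕ) : monoDFI.rename r q = monoDFI := by simp [monoDFI]
@[simp] theorem ScottD_rename (r q : ℕ → ℕ) : ScottD.rename r q = ScottD := by simp [ScottD]
@[simp] theorem rollD_rename (r q : ℕ → ℕ) : rollD.rename r q = rollD := by simp [rollD]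
@[simp] theorem scottInD_rename (r q : ℕ → ℕ) : scottInD.rename r q = scottInD := by simp [scottInD]
@[simp] theorem DRec_rename (r q : ℕ → ℕ) : DRec.rename r q = DRec := by simp [DRec]
@[simp] theorem inDRec_rename (r q : ℕ → ℕ) : inDRec.rename r q = inDRec := by simp [inDRec]
@[simp] theorem PrfAlgLR_rename (r q : ℕ → ℕ) : PrfAlgLR.rename r q = PrfAlgLR := by simp [PrfAlgLR]
@[simp] theorem LRD_rename (r q : ℕ → ℕ) : LRD.rename r q = LRD := by simp [LRD]
@[simp] theorem Fmap_rename (r q : ℕ → ℕ) : Fmap.rename r q = Fmap := by simp [Fmap]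
@[simp] theorem FmapId_rename (r q : ℕ → ℕ) : FmapId.rename r q = FmapId := by simp [FmapId]
@[simp] theorem FmapCompose_rename (r q : ℕ → ℕ) : FmapCompose.rename r q = FmapCompose := by simp [FmapCompose]
@[simp] theorem monoFunctor_rename (r q : ℕ → ℕ) : monoFunctor.rename r q = monoFunctor := by simp [monoFunctor]
@[simp] theorem PreSigma_rename (r q : ℕ → ℕ) : PreSigma.rename r q = PreSigma := by simp [PreSigma]
@[simp] theorem mkPreSigma_rename (r q : ℕ → ℕ) : mkPreSigma.rename r q = mkPreSigma := by simp [mkPreSigma]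
@[simp] theorem Sigma_rename (r q : ℕ → ℕ) : Sigma.rename r q = Sigma := by simp [Sigma]
@[simp] theorem proj1_rename (r q : ℕ → ℕ) : proj1.rename r q = proj1 := by simp [proj1]
@[simp] theorem Alg_rename (r q : ℕ → ℕ) : Alg.rename r q = Alg := by simp [Alg]
@[simp] theorem PrfAlgRec_rename (r q : ℕ → ℕ) : PrfAlgRec.rename r q = PrfAlgRec := by simp [PrfAlgRec]
@[simp] theorem ToDType_rename (r q : ℕ → ℕ) : ToDType.rename r q = ToDType := by simp [ToDType]
@[simp] theorem IndLRDType_rename (r q : ℕ → ℕ) : IndLRDType.rename r q = IndLRDType := by simp [IndLRDType]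
@[simp] theorem IndDType_rename (r q : ℕ → ℕ) : IndDType.rename r q = IndDType := by simp [IndDType]
@[simp] theorem rollCast_rename (r q : ℕ → ℕ) : rollCast.rename r q = rollCast := by simp [rollCast]
@[simp] theorem indCast_rename (r q : ℕ → ℕ) : indCast.rename r q = indCast := by simp [indCast]
@[simp] theorem toD_rename (r q : ℕ → ℕ) : toD.rename r q = toD := by simp [toD]
@[simp] theorem indLRD_rename (r q : ℕ → ℕ) : indLRD.rename r q = indLRD := by simp [indLRD]
@[simp] theorem mkSigma_rename (r q : ℕ → ℕ) : mkSigma.rename r q = mkSigma := by simp [mkSigma]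
@[simp] theorem fmapSection_rename (r q : ℕ → ℕ) : fmapSection.rename r q = fmapSection := by simp [fmapSection]
@[simp] theorem algLROfRec_rename (r q : ℕ → ℕ) : algLROfRec.rename r q = algLROfRec := by simp [algLROfRec]
@[simp] theorem indD_rename (r q : ℕ → ℕ) : indD.rename r q = indD := by simp [indD]

end Closed

/-! ### Codes for kinds, types and terms

A code is an expression in which the Cedille definitions occur as constants. -/

/-- The Cedille definitions, in the order of their dependencies. -/
inductive Const : Type
  | Top | View | intrView | elimView | extView | Cast | intrCast | elimCast | castTrans | Mono
  | Rec | recLB | recGLB | recRoll | roll | AlgCase | DF | inDF | monoDF | WkPrfAlg | WkIndDF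
  | inWkIndDF | DFI | monoDFI | ScottD | rollD | scottInD | DRec | inDRec | PrfAlgLR | LRD
  | Fmap | FmapId | FmapCompose | monoFunctor | PreSigma | mkPreSigma | Sigma | proj1 | Alg
  | PrfAlgRec | ToDType | IndLRDType | IndDType | rollCast | indCast | toD | indLRD | mkSigma
  | fmapSection | algLROfRec | indD

mutual

/-- Codes for kinds. -/
inductive KdC : Type
  | star
  | piTm (x : TyC) (y : KdC)
  | piTy (x : KdC) (y : KdC)

/-- Codes for type constructors. -/
inductive TyC : Type
  | var (n : ℕ)
  | cst (c : Const)
  | allTy (x : KdC) (y : TyC)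
  | allTm (x : TyC) (y : TyC)
  | pi (x : TyC) (y : TyC)
  | lamTm (x : TyC) (y : TyC)
  | lamTy (x : KdC) (y : TyC)
  | appTm (x : TyC) (y : TmC)
  | appTy (x : TyC) (y : TyC)
  | iota (x : TyC) (y : TyC)
  | eq (x : TmC) (y : TmC)

/-- Codes for annotated terms. -/
inductive TmC : Type
  | var (n : ℕ)
  | cst (c : Const)
  | lam (x : TmC)
  | app (x : TmC) (y : TmC)
  | lamTy (x : TmC)
  | appTy (x : TmC) (y : TyC)
  | lamE (x : TmC)
  | appE (x : TmC) (y : TmC)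
  | pair (x : TmC) (y : TmC)
  | fst (x : TmC)
  | snd (x : TmC)
  | beta (x : TmC)
  | rho (x : TmC) (y : TyC) (z : TmC)
  | phi (x : TmC) (y : TmC) (z : TmC)
  | chi (x : TyC) (y : TmC)
  | letIn (x : TyC) (y : TmC) (z : TmC)
  | sym (x : TmC)

end

mutual

def KdC.rename : (ℕ → ℕ) → (ℕ → ℕ) → KdC → KdC
  | _, _, .star => .star
  | r, q, .piTm x y => .piTm (x.rename r q) (y.rename (upRen r) q)
  | r, q, .piTy x y => .piTy (x.rename r q) (y.rename r (upRen q))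

def TyC.rename : (ℕ → ℕ) → (ℕ → ℕ) → TyC → TyC
  | _, q, .var n => .var (q n)
  | _, _, .cst c => .cst c
  | r, q, .allTy x y => .allTy (x.rename r q) (y.rename r (upRen q))
  | r, q, .allTm x y => .allTm (x.rename r q) (y.rename (upRen r) q)
  | r, q, .pi x y => .pi (x.rename r q) (y.rename (upRen r) q)
  | r, q, .lamTm x y => .lamTm (x.rename r q) (y.rename (upRen r) q)
  | r, q, .lamTy x y => .lamTy (x.rename r q) (y.rename r (upRen q))
  | r, q, .appTm x y => .appTm (x.rename r q) (y.rename r q)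
  | r, q, .appTy x y => .appTy (x.rename r q) (y.rename r q)
  | r, q, .iota x y => .iota (x.rename r q) (y.rename (upRen r) q)
  | r, q, .eq x y => .eq (x.rename r q) (y.rename r q)

def TmC.rename : (ℕ → ℕ) → (ℕ → ℕ) → TmC → TmC
  | r, _, .var n => .var (r n)
  | _, _, .cst c => .cst c
  | r, q, .lam x => .lam (x.rename (upRen r) q)
  | r, q, .app x y => .app (x.rename r q) (y.rename r q)
  | r, q, .lamTy x => .lamTy (x.rename r (upRen q))
  | r, q, .appTy x y => .appTy (x.rename r q) (y.rename r q)
  | r, q, .lamE x => .lamE (x.rename (upRen r) q)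
  | r, q, .appE x y => .appE (x.rename r q) (y.rename r q)
  | r, q, .pair x y => .pair (x.rename r q) (y.rename r q)
  | r, q, .fst x => .fst (x.rename r q)
  | r, q, .snd x => .snd (x.rename r q)
  | r, q, .beta x => .beta (x.rename r q)
  | r, q, .rho x y z => .rho (x.rename r q) (y.rename (upRen r) q) (z.rename r q)
  | r, q, .phi x y z => .phi (x.rename r q) (y.rename r q) (z.rename r q)
  | r, q, .chi x y => .chi (x.rename r q) (y.rename r q)
  | r, q, .letIn x y z => .letIn (x.rename r q) (y.rename r q) (z.rename (upRen r) q)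
  | r, q, .sym x => .sym (x.rename r q)

end

/-- Weakening by a term variable. -/
def KdC.wkTm (k : KdC) : KdC := k.rename Nat.succ (fun n => n)
/-- Weakening by a type variable. -/
def KdC.wkTy (k : KdC) : KdC := k.rename (fun n => n) Nat.succ
/-- Weakening by a term variable. -/
def TyC.wkTm (T : TyC) : TyC := T.rename Nat.succ (fun n => n)
/-- Weakening by a type variable. -/
def TyC.wkTy (T : TyC) : TyC := T.rename (fun n => n) Nat.succ
/-- Weakening by a term variable. -/
def TmC.wkTm (t : TmC) : TmC := t.rename Nat.succ (fun n => n)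
/-- Weakening by a type variable. -/
def TmC.wkTy (t : TmC) : TmC := t.rename (fun n => n) Nat.succ

/-- A simultaneous substitution of codes for term variables and type variables. -/
structure SubC : Type where
  tm : ℕ → TmC
  ty : ℕ → TyC

/-- Lift a substitution under the binder of a term variable. -/
def SubC.upTm (s : SubC) : SubC :=
  ⟨scons (.var 0) (fun n => (s.tm n).wkTm), fun n => (s.ty n).wkTm⟩

/-- Lift a substitution under the binder of a type variable. -/
def SubC.upTy (s : SubC) : SubC :=
  ⟨fun n => (s.tm n).wkTy, scons (.var 0) (fun n => (s.ty n).wkTy)⟩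

mutual

def KdC.subst : SubC → KdC → KdC
  | _, .star => .star
  | s, .piTm x y => .piTm (x.subst s) (y.subst s.upTm)
  | s, .piTy x y => .piTy (x.subst s) (y.subst s.upTy)

def TyC.subst : SubC → TyC → TyC
  | s, .var n => s.ty n
  | _, .cst c => .cst c
  | s, .allTy x y => .allTy (x.subst s) (y.subst s.upTy)
  | s, .allTm x y => .allTm (x.subst s) (y.subst s.upTm)
  | s, .pi x y => .pi (x.subst s) (y.subst s.upTm)
  | s, .lamTm x y => .lamTm (x.subst s) (y.subst s.upTm)
  | s, .lamTy x y => .lamTy (x.subst s) (y.subst s.upTy)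
  | s, .appTm x y => .appTm (x.subst s) (y.subst s)
  | s, .appTy x y => .appTy (x.subst s) (y.subst s)
  | s, .iota x y => .iota (x.subst s) (y.subst s.upTm)
  | s, .eq x y => .eq (x.subst s) (y.subst s)

def TmC.subst : SubC → TmC → TmC
  | s, .var n => s.tm n
  | _, .cst c => .cst c
  | s, .lam x => .lam (x.subst s.upTm)
  | s, .app x y => .app (x.subst s) (y.subst s)
  | s, .lamTy x => .lamTy (x.subst s.upTy)
  | s, .appTy x y => .appTy (x.subst s) (y.subst s)
  | s, .lamE x => .lamE (x.subst s.upTm)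
  | s, .appE x y => .appE (x.subst s) (y.subst s)
  | s, .pair x y => .pair (x.subst s) (y.subst s)
  | s, .fst x => .fst (x.subst s)
  | s, .snd x => .snd (x.subst s)
  | s, .beta x => .beta (x.subst s)
  | s, .rho x y z => .rho (x.subst s) (y.subst s.upTm) (z.subst s)
  | s, .phi x y z => .phi (x.subst s) (y.subst s) (z.subst s)
  | s, .chi x y => .chi (x.subst s) (y.subst s)
  | s, .letIn x y z => .letIn (x.subst s) (y.subst s) (z.subst s.upTm)
  | s, .sym x => .sym (x.subst s)

end

/-- The substitution `[u/x]` for the term variable of index `0`. -/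
def SubC.oneTm (u : TmC) : SubC := ⟨scons u .var, .var⟩
/-- The substitution `[A/X]` for the type variable of index `0`. -/
def SubC.oneTy (A : TyC) : SubC := ⟨.var, scons A .var⟩

/-- `[u/x]κ` -/
def KdC.instTm (k : KdC) (u : TmC) : KdC := k.subst (.oneTm u)
/-- `[A/X]κ` -/
def KdC.instTy (k : KdC) (A : TyC) : KdC := k.subst (.oneTy A)
/-- `[u/x]T` -/
def TyC.instTm (T : TyC) (u : TmC) : TyC := T.subst (.oneTm u)
/-- `[A/X]T` -/
def TyC.instTy (T A : TyC) : TyC := T.subst (.oneTy A)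

/-! ### The signature -/

/-- The untyped term `λ x. λ a. a x`. -/
def Pure.inj : Pure := .lam (.lam (.app (.var 0) (.var 1)))

/-- Code for `β`. -/
def TmC.rfl : TmC := .beta (.lam (.var 0))
/-- Code for `λ x. x`. -/
def TmC.id : TmC := .lam (.var 0)
/-- Code for `T ➔ T'`. -/
def TyC.arrow (T T' : TyC) : TyC := .pi T T'.wkTm
/-- Code for `T ➾ T'`. -/
def TyC.earrow (T T' : TyC) : TyC := .allTm T T'.wkTm
/-- Code for `T ➔ ★`. -/
def KdC.predOn (T : TyC) : KdC := .piTm T .star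
/-- Code for `★ ➔ ★`. -/
def KdC.scheme : KdC := .piTy .star .star

infixr:60 " ⟶ₜᶜ " => TyC.arrow
infixr:60 " ⟹ₜᶜ " => TyC.earrow
infixl:75 " ⬝ᶜ " => TyC.appTm
infixl:75 " ⬝ₜᶜ " => TyC.appTy
infixl:75 " ⋆ᶜ " => TmC.app
infixl:75 " ⋆ₜᶜ " => TmC.appTy
infixl:75 " ⋆ₑᶜ " => TmC.appE

/-- Code of a term variable. -/
abbrev x (n : ℕ) : TmC := .var n
/-- Code of a type variable. -/
abbrev X (n : ℕ) : TyC := .var n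

/-- Code for the type `ι x: S.D. DRec ·P x ·Y`. -/
def TyC.handle (F P Y : TyC) : TyC :=
  .iota (.cst .ScottD ⬝ₜᶜ F) (.cst .DRec ⬝ₜᶜ F.wkTm ⬝ₜᶜ P.wkTm ⬝ᶜ x 0 ⬝ₜᶜ Y.wkTm)

/-- The meaning of a constant, with codes for its parts. -/
inductive Decl : Type
  /-- the type constructor `T`, which `A` codes -/
  | ty (T : Ty) (A : TyC)
  /-- the definition `t ◂ A = u`; the erasure `|t|` is convertible to `e` -/
  | tm (t : Tm) (A : TyC) (u : TmC) (e : Pure)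

/-- The signature. -/
def Const.decl : Const → Decl
  | .Top => .ty CDLE.Top <|
    .eq TmC.id TmC.id
  | .View => .ty CDLE.View <|
    .lamTy .star (.lamTm (.cst .Top) (.iota (X 0) (.eq (x 0) (x 1))))
  | .intrView => .tm CDLE.intrView
    (.allTy .star (.pi (.cst .Top) (.allTm (X 0) (.eq (x 0) (x 1) ⟹ₜᶜ .cst .View ⬝ₜᶜ X 0 ⬝ᶜ x 1))))
    (.lamTy (.lam (.lamE (.lamE (.pair (.phi (x 0) (x 1) (x 2)) (.beta (x 2)))))))
    (.id)
  | .elimView => .tm CDLE.elimView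
    (.allTy .star (.pi (.cst .Top) (.cst .View ⬝ₜᶜ X 0 ⬝ᶜ x 0 ⟹ₜᶜ X 0)))
    (.lamTy (.lam (.lamE (.phi (.snd (x 0)) (.fst (x 0)) (x 1)))))
    (.id)
  | .extView => .tm CDLE.extView
    (.allTy .star (.allTy .star (.pi (.cst .Top)
    (.pi (X 1) (.cst .View ⬝ₜᶜ X 0 ⬝ᶜ .beta (x 1 ⋆ᶜ x 0)) ⟹ₜᶜ .cst .View ⬝ₜᶜ (X 1 ⟶ₜᶜ X 0) ⬝ᶜ x 0))))
    (.lamTy (.lamTy (.lam (.lamE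
    (.cst .intrView ⋆ₜᶜ (X 1 ⟶ₜᶜ X 0) ⋆ᶜ x 1
      ⋆ₑᶜ .lam (.cst .elimView ⋆ₜᶜ X 0 ⋆ᶜ .beta (x 2 ⋆ᶜ x 0) ⋆ₑᶜ (x 1 ⋆ᶜ x 0))
      ⋆ₑᶜ TmC.rfl)))))
    (.id)
  | .Cast => .ty CDLE.Cast <|
    .lamTy .star (.lamTy .star (.cst .View ⬝ₜᶜ (X 1 ⟶ₜᶜ X 0) ⬝ᶜ .beta TmC.id))
  | .intrCast => .tm CDLE.intrCast
    (.allTy .star (.allTy .star (.allTm (X 1 ⟶ₜᶜ X 0)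
    (.pi (X 1) (.eq (x 1 ⋆ᶜ x 0) (x 0)) ⟹ₜᶜ .cst .Cast ⬝ₜᶜ X 1 ⬝ₜᶜ X 0))))
    (.lamTy (.lamTy (.lamE (.lamE
    (.cst .extView ⋆ₜᶜ X 1 ⋆ₜᶜ X 0 ⋆ᶜ .beta TmC.id
      ⋆ₑᶜ .lam (.cst .intrView ⋆ₜᶜ X 0 ⋆ᶜ .beta (x 0) ⋆ₑᶜ (x 2 ⋆ᶜ x 0) ⋆ₑᶜ (x 1 ⋆ᶜ x 0)))))))
    (.id)
  | .elimCast => .tm CDLE.elimCast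
    (.allTy .star (.allTy .star (.cst .Cast ⬝ₜᶜ X 1 ⬝ₜᶜ X 0 ⟹ₜᶜ X 1 ⟶ₜᶜ X 0)))
    (.lamTy (.lamTy (.lamE (.cst .elimView ⋆ₜᶜ (X 1 ⟶ₜᶜ X 0) ⋆ᶜ .beta TmC.id ⋆ₑᶜ x 0))))
    (.id)
  | .castTrans => .tm CDLE.castTrans
    (.allTy .star (.allTy .star (.allTy .star
    (.cst .Cast ⬝ₜᶜ X 2 ⬝ₜᶜ X 1 ⟹ₜᶜ .cst .Cast ⬝ₜᶜ X 1 ⬝ₜᶜ X 0 ⟹ₜᶜ .cst .Cast ⬝ₜᶜ X 2 ⬝ₜᶜ X 0))))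
    (.lamTy (.lamTy (.lamTy (.lamE (.lamE
    (.cst .intrCast ⋆ₜᶜ X 2 ⋆ₜᶜ X 0
      ⋆ₑᶜ .lam (.cst .elimCast ⋆ₜᶜ X 1 ⋆ₜᶜ X 0 ⋆ₑᶜ x 1 ⋆ᶜ (.cst .elimCast ⋆ₜᶜ X 2 ⋆ₜᶜ X 1 ⋆ₑᶜ x 2 ⋆ᶜ x 0))
      ⋆ₑᶜ .lam TmC.rfl))))))
    (.id)
  | .Mono => .ty CDLE.Mono <|
    .lamTy KdC.scheme (.allTy .star (.allTy .star
    (.cst .Cast ⬝ₜᶜ X 1 ⬝ₜᶜ X 0 ⟶ₜᶜ .cst .Cast ⬝ₜᶜ (X 2 ⬝ₜᶜ X 1) ⬝ₜᶜ (X 2 ⬝ₜᶜ X 0))))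
  | .Rec => .ty CDLE.Rec <|
    .lamTy KdC.scheme (.allTy .star (.cst .Cast ⬝ₜᶜ (X 1 ⬝ₜᶜ X 0) ⬝ₜᶜ X 0 ⟹ₜᶜ X 0))
  | .recLB => .tm CDLE.recLB
    (.allTy KdC.scheme (.allTy .star
    (.cst .Cast ⬝ₜᶜ (X 1 ⬝ₜᶜ X 0) ⬝ₜᶜ X 0 ⟹ₜᶜ .cst .Cast ⬝ₜᶜ (.cst .Rec ⬝ₜᶜ X 1) ⬝ₜᶜ X 0)))
    (.lamTy (.lamTy (.lamE
    (.cst .intrCast ⋆ₜᶜ (.cst .Rec ⬝ₜᶜ X 1) ⋆ₜᶜ X 0 ⋆ₑᶜ .lam (x 0 ⋆ₜᶜ X 0 ⋆ₑᶜ x 1) ⋆ₑᶜ .lam TmC.rfl))))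
    (.id)
  | .recGLB => .tm CDLE.recGLB
    (.allTy KdC.scheme (.allTy .star
    (.allTy .star (.cst .Cast ⬝ₜᶜ (X 2 ⬝ₜᶜ X 0) ⬝ₜᶜ X 0 ⟹ₜᶜ .cst .Cast ⬝ₜᶜ X 1 ⬝ₜᶜ X 0)
      ⟹ₜᶜ .cst .Cast ⬝ₜᶜ X 0 ⬝ₜᶜ (.cst .Rec ⬝ₜᶜ X 1))))
    (.lamTy (.lamTy (.lamE
    (.cst .intrCast ⋆ₜᶜ X 0 ⋆ₜᶜ (.cst .Rec ⬝ₜᶜ X 1)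
      ⋆ₑᶜ .lam (.lamTy (.lamE (.cst .elimCast ⋆ₜᶜ X 1 ⋆ₜᶜ X 0 ⋆ₑᶜ (x 2 ⋆ₜᶜ X 0 ⋆ₑᶜ x 0) ⋆ᶜ x 1)))
      ⋆ₑᶜ .lam TmC.rfl))))
    (.id)
  | .recRoll => .tm CDLE.recRoll
    (.allTy KdC.scheme (.cst .Mono ⬝ₜᶜ X 0 ⟹ₜᶜ .cst .Cast ⬝ₜᶜ (X 0 ⬝ₜᶜ (.cst .Rec ⬝ₜᶜ X 0)) ⬝ₜᶜ (.cst .Rec ⬝ₜᶜ X 0)))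
    (.lamTy (.lamE
    (.cst .recGLB ⋆ₜᶜ X 0 ⋆ₜᶜ (X 0 ⬝ₜᶜ (.cst .Rec ⬝ₜᶜ X 0))
      ⋆ₑᶜ .lamTy (.lamE
        (.cst .castTrans ⋆ₜᶜ (X 1 ⬝ₜᶜ (.cst .Rec ⬝ₜᶜ X 1)) ⋆ₜᶜ (X 1 ⬝ₜᶜ X 0) ⋆ₜᶜ X 0
          ⋆ₑᶜ (x 1 ⋆ₜᶜ (.cst .Rec ⬝ₜᶜ X 1) ⋆ₜᶜ X 0 ⋆ᶜ (.cst .recLB ⋆ₜᶜ X 1 ⋆ₜᶜ X 0 ⋆ₑᶜ x 0))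
          ⋆ₑᶜ x 0)))))
    (.id)
  | .roll => .tm CDLE.roll
    (.allTy KdC.scheme (.cst .Mono ⬝ₜᶜ X 0 ⟹ₜᶜ X 0 ⬝ₜᶜ (.cst .Rec ⬝ₜᶜ X 0) ⟶ₜᶜ .cst .Rec ⬝ₜᶜ X 0))
    (.lamTy (.lamE
    (.cst .elimCast ⋆ₜᶜ (X 0 ⬝ₜᶜ (.cst .Rec ⬝ₜᶜ X 0)) ⋆ₜᶜ (.cst .Rec ⬝ₜᶜ X 0) ⋆ₑᶜ (.cst .recRoll ⋆ₜᶜ X 0 ⋆ₑᶜ x 0))))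
    (.id)
  | .AlgCase => .ty CDLE.AlgCase <|
    .lamTy KdC.scheme (.lamTy .star (.lamTy .star (X 2 ⬝ₜᶜ X 1 ⟶ₜᶜ X 0)))
  | .DF => .ty CDLE.DF <|
    .lamTy KdC.scheme (.lamTy .star (.allTy .star (.cst .AlgCase ⬝ₜᶜ X 2 ⬝ₜᶜ X 1 ⬝ₜᶜ X 0 ⟶ₜᶜ X 0)))
  | .inDF => .tm CDLE.inDF
    (.allTy KdC.scheme (.allTy .star (.cst .AlgCase ⬝ₜᶜ X 1 ⬝ₜᶜ X 0 ⬝ₜᶜ (.cst .DF ⬝ₜᶜ X 1 ⬝ₜᶜ X 0))))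
    (.lamTy (.lamTy (.lam (.lamTy (.lam (x 0 ⋆ᶜ x 1))))))
    (.inj)
  | .monoDF => .tm CDLE.monoDF
    (.allTy KdC.scheme (.cst .Mono ⬝ₜᶜ X 0 ⟹ₜᶜ .cst .Mono ⬝ₜᶜ (.cst .DF ⬝ₜᶜ X 0)))
    (.lamTy (.lamE (.lamTy (.lamTy (.lam
    (.cst .intrCast ⋆ₜᶜ (.cst .DF ⬝ₜᶜ X 2 ⬝ₜᶜ X 1) ⋆ₜᶜ (.cst .DF ⬝ₜᶜ X 2 ⬝ₜᶜ X 0)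
      ⋆ₑᶜ .lam (.lamTy (.lam (x 1 ⋆ₜᶜ X 0 ⋆ᶜ
          .lam (x 1 ⋆ᶜ (.cst .elimCast ⋆ₜᶜ (X 3 ⬝ₜᶜ X 2) ⋆ₜᶜ (X 3 ⬝ₜᶜ X 1)
            ⋆ₑᶜ (x 4 ⋆ₜᶜ X 2 ⋆ₜᶜ X 1 ⋆ᶜ x 3) ⋆ᶜ x 0)))))
      ⋆ₑᶜ .lam TmC.rfl))))))
    (.lam .id)
  | .WkPrfAlg => .ty CDLE.WkPrfAlg <|
    .lamTy KdC.scheme (.lamTy .star (.lamTy (KdC.predOn (.cst .DF ⬝ₜᶜ X 1 ⬝ₜᶜ X 0))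
    (.pi (X 2 ⬝ₜᶜ X 1) (X 0 ⬝ᶜ (.cst .inDF ⋆ₜᶜ X 2 ⋆ₜᶜ X 1 ⋆ᶜ x 0)))))
  | .WkIndDF => .ty CDLE.WkIndDF <|
    .lamTy KdC.scheme (.lamTy .star (.lamTm (.cst .DF ⬝ₜᶜ X 1 ⬝ₜᶜ X 0)
    (.allTy (KdC.predOn (.cst .DF ⬝ₜᶜ X 1 ⬝ₜᶜ X 0))
      (.cst .WkPrfAlg ⬝ₜᶜ X 2 ⬝ₜᶜ X 1 ⬝ₜᶜ X 0 ⟶ₜᶜ X 0 ⬝ᶜ x 0))))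
  | .inWkIndDF => .tm CDLE.inWkIndDF
    (.allTy KdC.scheme (.allTy .star (.cst .WkPrfAlg ⬝ₜᶜ X 1 ⬝ₜᶜ X 0 ⬝ₜᶜ (.cst .WkIndDF ⬝ₜᶜ X 1 ⬝ₜᶜ X 0))))
    (.lamTy (.lamTy (.lam (.lamTy (.lam (x 0 ⋆ᶜ x 1))))))
    (.inj)
  | .DFI => .ty CDLE.DFI <|
    .lamTy KdC.scheme (.lamTy .star
    (.iota (.cst .DF ⬝ₜᶜ X 1 ⬝ₜᶜ X 0) (.cst .WkIndDF ⬝ₜᶜ X 1 ⬝ₜᶜ X 0 ⬝ᶜ x 0)))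
  | .monoDFI => .tm CDLE.monoDFI
    (.allTy KdC.scheme (.cst .Mono ⬝ₜᶜ X 0 ⟹ₜᶜ .cst .Mono ⬝ₜᶜ (.cst .DFI ⬝ₜᶜ X 0)))
    (.lamTy (.lamE (.lamTy (.lamTy (.lam
    (.cst .intrCast ⋆ₜᶜ (.cst .DFI ⬝ₜᶜ X 2 ⬝ₜᶜ X 1) ⋆ₜᶜ (.cst .DFI ⬝ₜᶜ X 2 ⬝ₜᶜ X 0)
      ⋆ₑᶜ .lam (.pair
        (.cst .elimCast ⋆ₜᶜ (.cst .DF ⬝ₜᶜ X 2 ⬝ₜᶜ X 1) ⋆ₜᶜ (.cst .DF ⬝ₜᶜ X 2 ⬝ₜᶜ X 0)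
          ⋆ₑᶜ (.cst .monoDF ⋆ₜᶜ X 2 ⋆ₑᶜ x 2 ⋆ₜᶜ X 1 ⋆ₜᶜ X 0 ⋆ᶜ x 1) ⋆ᶜ .fst (x 0))
        (.lamTy (.lam (.snd (x 1)
          ⋆ₜᶜ .lamTm (.cst .DF ⬝ₜᶜ X 3 ⬝ₜᶜ X 2)
            (X 0 ⬝ᶜ (.cst .elimCast ⋆ₜᶜ (.cst .DF ⬝ₜᶜ X 3 ⬝ₜᶜ X 2) ⋆ₜᶜ (.cst .DF ⬝ₜᶜ X 3 ⬝ₜᶜ X 1)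
              ⋆ₑᶜ (.cst .monoDF ⋆ₜᶜ X 3 ⋆ₑᶜ x 4 ⋆ₜᶜ X 2 ⋆ₜᶜ X 1 ⋆ᶜ x 3) ⋆ᶜ x 0))
          ⋆ᶜ .lam (x 1 ⋆ᶜ (.cst .elimCast ⋆ₜᶜ (X 3 ⬝ₜᶜ X 2) ⋆ₜᶜ (X 3 ⬝ₜᶜ X 1)
              ⋆ₑᶜ (x 4 ⋆ₜᶜ X 2 ⋆ₜᶜ X 1 ⋆ᶜ x 3) ⋆ᶜ x 0))))))
      ⋆ₑᶜ .lam TmC.rfl))))))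
    (.lam .id)
  | .ScottD => .ty CDLE.ScottD <|
    .lamTy KdC.scheme (.cst .Rec ⬝ₜᶜ (.cst .DFI ⬝ₜᶜ X 0))
  | .rollD => .tm CDLE.rollD
    (.allTy KdC.scheme (.cst .Mono ⬝ₜᶜ X 0 ⟹ₜᶜ .cst .DFI ⬝ₜᶜ X 0 ⬝ₜᶜ (.cst .ScottD ⬝ₜᶜ X 0) ⟶ₜᶜ .cst .ScottD ⬝ₜᶜ X 0))
    (.lamTy (.lamE (.cst .roll ⋆ₜᶜ (.cst .DFI ⬝ₜᶜ X 0) ⋆ₑᶜ (.cst .monoDFI ⋆ₜᶜ X 0 ⋆ₑᶜ x 0))))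
    (.id)
  | .scottInD => .tm CDLE.scottInD
    (.allTy KdC.scheme (.cst .Mono ⬝ₜᶜ X 0 ⟹ₜᶜ .cst .AlgCase ⬝ₜᶜ X 0 ⬝ₜᶜ (.cst .ScottD ⬝ₜᶜ X 0) ⬝ₜᶜ (.cst .ScottD ⬝ₜᶜ X 0)))
    (.lamTy (.lamE (.lam (.cst .rollD ⋆ₜᶜ X 0 ⋆ₑᶜ x 1 ⋆ᶜ
    .pair (.cst .inDF ⋆ₜᶜ X 0 ⋆ₜᶜ (.cst .ScottD ⬝ₜᶜ X 0) ⋆ᶜ x 0)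
      (.cst .inWkIndDF ⋆ₜᶜ X 0 ⋆ₜᶜ (.cst .ScottD ⬝ₜᶜ X 0) ⋆ᶜ x 0)))))
    (.inj)
  | .DRec => .ty CDLE.DRec <|
    .lamTy KdC.scheme (.lamTy (KdC.predOn (.cst .ScottD ⬝ₜᶜ X 0)) (.lamTm (.cst .ScottD ⬝ₜᶜ X 1) (.lamTy .star
    (X 0 ⟶ₜᶜ X 0 ⟶ₜᶜ X 1 ⬝ᶜ x 0))))
  | .inDRec => .tm CDLE.inDRec
    (.allTy KdC.scheme (.allTm (.cst .Mono ⬝ₜᶜ X 0) (.allTy (KdC.predOn (.cst .ScottD ⬝ₜᶜ X 0)) (.allTy .star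
    (X 2 ⬝ₜᶜ TyC.handle (X 2) (X 1) (X 0) ⟶ₜᶜ .cst .ScottD ⬝ₜᶜ X 2)))))
    (.lamTy (.lamE (.lamTy (.lamTy (.lam
    (.letIn (.cst .Cast ⬝ₜᶜ TyC.handle (X 2) (X 1) (X 0) ⬝ₜᶜ (.cst .ScottD ⬝ₜᶜ X 2))
      (.cst .intrCast ⋆ₜᶜ TyC.handle (X 2) (X 1) (X 0) ⋆ₜᶜ (.cst .ScottD ⬝ₜᶜ X 2)
        ⋆ₑᶜ .lam (.fst (x 0)) ⋆ₑᶜ .lam TmC.rfl)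
      (.cst .scottInD ⋆ₜᶜ X 2 ⋆ₑᶜ x 2 ⋆ᶜ
        (.cst .elimCast ⋆ₜᶜ (X 2 ⬝ₜᶜ TyC.handle (X 2) (X 1) (X 0)) ⋆ₜᶜ (X 2 ⬝ₜᶜ (.cst .ScottD ⬝ₜᶜ X 2))
          ⋆ₑᶜ (x 2 ⋆ₜᶜ TyC.handle (X 2) (X 1) (X 0) ⋆ₜᶜ (.cst .ScottD ⬝ₜᶜ X 2) ⋆ᶜ x 0) ⋆ᶜ x 1))))))))
    (.inj)
  | .PrfAlgLR => .ty CDLE.PrfAlgLR <|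
    .lamTy KdC.scheme (.lamTm (.cst .Mono ⬝ₜᶜ X 0) (.lamTy (KdC.predOn (.cst .ScottD ⬝ₜᶜ X 0)) (.allTy .star
    (.pi (X 2 ⬝ₜᶜ TyC.handle (X 2) (X 1) (X 0))
      (X 0 ⟶ₜᶜ X 1 ⬝ᶜ (.cst .inDRec ⋆ₜᶜ X 2 ⋆ₑᶜ x 1 ⋆ₜᶜ X 1 ⋆ₜᶜ X 0 ⋆ᶜ x 0))))))
  | .LRD => .ty CDLE.LRD <|
    .lamTy KdC.scheme (.lamTm (.cst .Mono ⬝ₜᶜ X 0) (.iota (.cst .ScottD ⬝ₜᶜ X 0)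
    (.allTy (KdC.predOn (.cst .ScottD ⬝ₜᶜ X 0))
      (.cst .DRec ⬝ₜᶜ X 1 ⬝ₜᶜ X 0 ⬝ᶜ x 0 ⬝ₜᶜ (.cst .PrfAlgLR ⬝ₜᶜ X 1 ⬝ᶜ x 1 ⬝ₜᶜ X 0)))))
  | .Fmap => .ty CDLE.Fmap <|
    .lamTy KdC.scheme (.allTy .star (.allTy .star
    ((X 1 ⟶ₜᶜ X 0) ⟶ₜᶜ X 2 ⬝ₜᶜ X 1 ⟶ₜᶜ X 2 ⬝ₜᶜ X 0)))
  | .FmapId => .ty CDLE.FmapId <|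
    .lamTy KdC.scheme (.lamTm (.cst .Fmap ⬝ₜᶜ X 0) (.allTy .star (.allTy .star (.pi (X 1 ⟶ₜᶜ X 0)
    (.pi (X 1) (.eq (x 1 ⋆ᶜ x 0) (x 0)) ⟶ₜᶜ
      .pi (X 2 ⬝ₜᶜ X 1) (.eq (x 2 ⋆ₜᶜ X 1 ⋆ₜᶜ X 0 ⋆ᶜ x 1 ⋆ᶜ x 0) (x 0)))))))
  | .FmapCompose => .ty CDLE.FmapCompose <|
    .lamTy KdC.scheme (.lamTm (.cst .Fmap ⬝ₜᶜ X 0) (.allTy .star (.allTy .star (.allTy .star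
    (.pi (X 1 ⟶ₜᶜ X 0) (.pi (X 2 ⟶ₜᶜ X 1) (.pi (X 3 ⬝ₜᶜ X 2)
      (.eq
        (x 3 ⋆ₜᶜ X 1 ⋆ₜᶜ X 0 ⋆ᶜ x 2 ⋆ᶜ (x 3 ⋆ₜᶜ X 2 ⋆ₜᶜ X 1 ⋆ᶜ x 1 ⋆ᶜ x 0))
        (x 3 ⋆ₜᶜ X 2 ⋆ₜᶜ X 0 ⋆ᶜ .lam (x 3 ⋆ᶜ (x 2 ⋆ᶜ x 0)) ⋆ᶜ x 0)))))))))
  | .monoFunctor => .tm CDLE.monoFunctor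
    (.allTy KdC.scheme (.pi (.cst .Fmap ⬝ₜᶜ X 0) (.cst .FmapId ⬝ₜᶜ X 0 ⬝ᶜ x 0 ⟹ₜᶜ .cst .FmapCompose ⬝ₜᶜ X 0 ⬝ᶜ x 0 ⟹ₜᶜ
    (.cst .Mono) ⬝ₜᶜ X 0)))
    (.lamTy (.lam (.lamE (.lamE (.lamTy (.lamTy (.lam
    (.cst .intrCast ⋆ₜᶜ (X 2 ⬝ₜᶜ X 1) ⋆ₜᶜ (X 2 ⬝ₜᶜ X 0)
      ⋆ₑᶜ .lam (x 4 ⋆ₜᶜ X 1 ⋆ₜᶜ X 0 ⋆ᶜ (.cst .elimCast ⋆ₜᶜ X 1 ⋆ₜᶜ X 0 ⋆ₑᶜ x 1) ⋆ᶜ x 0)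
      ⋆ₑᶜ .lam (x 3 ⋆ₜᶜ X 1 ⋆ₜᶜ X 0 ⋆ᶜ (.cst .elimCast ⋆ₜᶜ X 1 ⋆ₜᶜ X 0 ⋆ₑᶜ x 1) ⋆ᶜ .lam TmC.rfl ⋆ᶜ x 0)))))))))
    (.lam (.lam .id))
  | .PreSigma => .ty CDLE.PreSigma <|
    .lamTy .star (.lamTy (KdC.predOn (X 0)) (.allTy .star
    (.pi (X 2) (X 1 ⬝ᶜ x 0 ⟶ₜᶜ X 0) ⟶ₜᶜ X 0)))
  | .mkPreSigma => .tm CDLE.mkPreSigma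
    (.allTy .star (.allTy (KdC.predOn (X 0)) (.pi (X 1) (X 0 ⬝ᶜ x 0 ⟶ₜᶜ .cst .PreSigma ⬝ₜᶜ X 1 ⬝ₜᶜ X 0))))
    (.lamTy (.lamTy (.lam (.lam (.lamTy (.lam (x 0 ⋆ᶜ x 2 ⋆ᶜ x 1)))))))
    (.lam (.lam (.lam (.app (.app (.var 0) (.var 2)) (.var 1)))))
  | .Sigma => .ty CDLE.Sigma <|
    .lamTy .star (.lamTy (KdC.predOn (X 0)) (.iota (.cst .PreSigma ⬝ₜᶜ X 1 ⬝ₜᶜ X 0)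
    (.allTy (KdC.predOn (.cst .PreSigma ⬝ₜᶜ X 1 ⬝ₜᶜ X 0))
      (.pi (X 2) (.pi (X 1 ⬝ᶜ x 0) (X 0 ⬝ᶜ (.cst .mkPreSigma ⋆ₜᶜ X 2 ⋆ₜᶜ X 1 ⋆ᶜ x 1 ⋆ᶜ x 0)))
        ⟶ₜᶜ X 0 ⬝ᶜ x 0))))
  | .proj1 => .tm CDLE.proj1
    (.allTy .star (.allTy (KdC.predOn (X 0)) (.cst .Sigma ⬝ₜᶜ X 1 ⬝ₜᶜ X 0 ⟶ₜᶜ X 1)))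
    (.lamTy (.lamTy (.lam (.fst (x 0) ⋆ₜᶜ X 1 ⋆ᶜ .lam (.lam (x 1))))))
    (.lam (.app (.var 0) (.lam (.lam (.var 1)))))
  | .Alg => .ty CDLE.Alg <|
    .lamTy KdC.scheme (.lamTy .star (X 1 ⬝ₜᶜ X 0 ⟶ₜᶜ X 0))
  | .PrfAlgRec => .ty CDLE.PrfAlgRec <|
    .lamTy KdC.scheme (.lamTm (.cst .Fmap ⬝ₜᶜ X 0) (.lamTy .star (.lamTm (.cst .Alg ⬝ₜᶜ X 1 ⬝ₜᶜ X 0)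
    (.lamTy (KdC.predOn (X 0)) (.pi (X 2 ⬝ₜᶜ (.cst .Sigma ⬝ₜᶜ X 1 ⬝ₜᶜ X 0))
      (X 0 ⬝ᶜ (x 1 ⋆ᶜ (x 2 ⋆ₜᶜ (.cst .Sigma ⬝ₜᶜ X 1 ⬝ₜᶜ X 0) ⋆ₜᶜ X 1 ⋆ᶜ (.cst .proj1 ⋆ₜᶜ X 1 ⋆ₜᶜ X 0) ⋆ᶜ x 0))))))))
  | .ToDType => .ty CDLE.ToDType <|
    .allTy KdC.scheme (.allTm (.cst .Mono ⬝ₜᶜ X 0) (.cst .Cast ⬝ₜᶜ (.cst .ScottD ⬝ₜᶜ X 0) ⬝ₜᶜ (.cst .LRD ⬝ₜᶜ X 0 ⬝ᶜ x 0)))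
  | .IndLRDType => .ty CDLE.IndLRDType <|
    .allTy KdC.scheme (.allTm (.cst .Mono ⬝ₜᶜ X 0) (.allTy (KdC.predOn (.cst .ScottD ⬝ₜᶜ X 0))
    (.cst .PrfAlgLR ⬝ₜᶜ X 1 ⬝ᶜ x 0 ⬝ₜᶜ X 0 ⟶ₜᶜ
      .pi (.cst .ScottD ⬝ₜᶜ X 1) (.cst .PrfAlgLR ⬝ₜᶜ X 1 ⬝ᶜ x 1 ⬝ₜᶜ X 0 ⟶ₜᶜ X 0 ⬝ᶜ x 0))))
  | .IndDType => .ty CDLE.IndDType <|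
    .allTy KdC.scheme (.pi (.cst .Fmap ⬝ₜᶜ X 0) (.allTm (.cst .FmapId ⬝ₜᶜ X 0 ⬝ᶜ x 0)
    (.allTm (.cst .FmapCompose ⬝ₜᶜ X 0 ⬝ᶜ x 1) (.allTy (KdC.predOn (.cst .ScottD ⬝ₜᶜ X 0))
      (.cst .PrfAlgRec ⬝ₜᶜ X 1 ⬝ᶜ x 2 ⬝ₜᶜ (.cst .ScottD ⬝ₜᶜ X 1)
          ⬝ᶜ (.cst .scottInD ⋆ₜᶜ X 1 ⋆ₑᶜ (.cst .monoFunctor ⋆ₜᶜ X 1 ⋆ᶜ x 2 ⋆ₑᶜ x 1 ⋆ₑᶜ x 0)) ⬝ₜᶜ X 0 ⟶ₜᶜ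
        .pi (.cst .ScottD ⬝ₜᶜ X 1) (X 0 ⬝ᶜ x 0))))))
  | .rollCast => .tm CDLE.rollCast
    (.allTy KdC.scheme (.allTm (.cst .Mono ⬝ₜᶜ X 0) (.allTy .star
    (.cst .Cast ⬝ₜᶜ X 0 ⬝ₜᶜ (.cst .ScottD ⬝ₜᶜ X 1) ⟶ₜᶜ .cst .DFI ⬝ₜᶜ X 1 ⬝ₜᶜ X 0 ⟶ₜᶜ .cst .ScottD ⬝ₜᶜ X 1))))
    (.lamTy (.lamE (.lamTy (.lam (.lam (.cst .rollD ⋆ₜᶜ X 1 ⋆ₑᶜ x 2 ⋆ᶜ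
    (.fst (.cst .monoDFI ⋆ₜᶜ X 1 ⋆ₑᶜ x 2 ⋆ₜᶜ X 0 ⋆ₜᶜ (.cst .ScottD ⬝ₜᶜ X 1) ⋆ᶜ x 1) ⋆ᶜ x 0)))))))
    (.lam .id)
  | .indCast => .tm CDLE.indCast
    (.allTy KdC.scheme (.allTm (.cst .Mono ⬝ₜᶜ X 0) (.allTy .star (.pi (.cst .Cast ⬝ₜᶜ X 0 ⬝ₜᶜ (.cst .ScottD ⬝ₜᶜ X 1))
    (.allTy (KdC.predOn (.cst .ScottD ⬝ₜᶜ X 1)) (.allTy .star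
      (.cst .Cast ⬝ₜᶜ X 2 ⬝ₜᶜ TyC.handle (X 3) (X 1) (X 0) ⟹ₜᶜ .pi (.cst .DFI ⬝ₜᶜ X 3 ⬝ₜᶜ X 2)
        (.pi (X 3 ⬝ₜᶜ TyC.handle (X 3) (X 1) (X 0))
            (X 0 ⟶ₜᶜ X 1 ⬝ᶜ (.cst .inDRec ⋆ₜᶜ X 3 ⋆ₑᶜ x 3 ⋆ₜᶜ X 1 ⋆ₜᶜ X 0 ⋆ᶜ x 0)) ⟶ₜᶜ
          X 0 ⟶ₜᶜ X 1 ⬝ᶜ (.cst .rollCast ⋆ₜᶜ X 3 ⋆ₑᶜ x 2 ⋆ₜᶜ X 2 ⋆ᶜ x 1 ⋆ᶜ x 0)))))))))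
    (.lamTy (.lamE (.lamTy (.lam (.lamTy (.lamTy (.lamE (.lam (.lam (.lam
    (.snd (x 2)
      ⋆ₜᶜ .lamTm (.cst .DF ⬝ₜᶜ X 3 ⬝ₜᶜ X 2)
        (.allTm (.eq (.cst .rollCast ⋆ₜᶜ X 3 ⋆ₑᶜ x 6 ⋆ₜᶜ X 2 ⋆ᶜ x 5 ⋆ᶜ x 3) (x 0))
          (X 0 ⟶ₜᶜ X 1 ⬝ᶜ .phi (x 0) (.cst .rollCast ⋆ₜᶜ X 3 ⋆ₑᶜ x 7 ⋆ₜᶜ X 2 ⋆ᶜ x 6 ⋆ᶜ x 4) (x 1)))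
      ⋆ᶜ .lam (.lamE (.lam (x 4
        ⋆ᶜ (.cst .elimCast ⋆ₜᶜ (X 3 ⬝ₜᶜ X 2) ⋆ₜᶜ (X 3 ⬝ₜᶜ TyC.handle (X 3) (X 1) (X 0))
          ⋆ₑᶜ (x 8 ⋆ₜᶜ X 2 ⋆ₜᶜ TyC.handle (X 3) (X 1) (X 0) ⋆ᶜ x 6) ⋆ᶜ x 2)
        ⋆ᶜ x 0)))
      ⋆ₑᶜ TmC.rfl ⋆ᶜ x 0)))))))))))
    (.lam (.lam (.lam (.lam (.app (.app (.var 2) (.var 1)) (.var 0))))))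
  | .toD => .tm CDLE.toD
    ((.cst .ToDType))
    (.lamTy (.lamE (.pair (.lam (x 0 ⋆ₜᶜ (.cst .LRD ⬝ₜᶜ X 0 ⬝ᶜ x 1) ⋆ₑᶜ .pair (.lam (.pair
      (.cst .rollCast ⋆ₜᶜ X 0 ⋆ₑᶜ x 2 ⋆ₜᶜ (.cst .LRD ⬝ₜᶜ X 0 ⬝ᶜ x 2) ⋆ᶜ .pair (.lam (.fst (x 0))) TmC.rfl ⋆ᶜ x 0)
      (.lamTy (.lam (.lam (.cst .indCast ⋆ₜᶜ X 1 ⋆ₑᶜ x 4 ⋆ₜᶜ (.cst .LRD ⬝ₜᶜ X 1 ⬝ᶜ x 4)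
        ⋆ᶜ .pair (.lam (.fst (x 0))) TmC.rfl ⋆ₜᶜ X 0 ⋆ₜᶜ (.cst .PrfAlgLR ⬝ₜᶜ X 1 ⬝ᶜ x 4 ⬝ₜᶜ X 0)
        ⋆ₑᶜ .pair (.lam (.pair (.fst (x 0)) (.snd (x 0) ⋆ₜᶜ X 0))) TmC.rfl ⋆ᶜ x 2
        ⋆ᶜ (x 1 ⋆ₜᶜ (.cst .PrfAlgLR ⬝ₜᶜ X 1 ⬝ᶜ x 4 ⬝ₜᶜ X 0)) ⋆ᶜ x 0)))))) TmC.rfl)) TmC.rfl)))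
    (.id)
  | .indLRD => .tm CDLE.indLRD
    ((.cst .IndLRDType))
    (.lamTy (.lamE (.lamTy (.lam (.lam (.lam
    (.snd (.fst (.cst .toD ⋆ₜᶜ X 1 ⋆ₑᶜ x 3) ⋆ᶜ x 1) ⋆ₜᶜ X 0 ⋆ᶜ x 2 ⋆ᶜ x 0)))))))
    (.lam (.lam (.lam (.app (.app (.var 1) (.var 2)) (.var 0)))))
  | .mkSigma => .tm CDLE.mkSigma
    (.allTy .star (.allTy (KdC.predOn (X 0)) (.pi (X 1) (X 0 ⬝ᶜ x 0 ⟶ₜᶜ .cst .Sigma ⬝ₜᶜ X 1 ⬝ₜᶜ X 0))))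
    (.lamTy (.lamTy (.lam (.lam (.pair (.cst .mkPreSigma ⋆ₜᶜ X 1 ⋆ₜᶜ X 0 ⋆ᶜ x 1 ⋆ᶜ x 0)
    (.lamTy (.lam (x 0 ⋆ᶜ x 2 ⋆ᶜ x 1))))))))
    (.lam (.lam (.lam (.app (.app (.var 0) (.var 2)) (.var 1)))))
  | .fmapSection => .tm CDLE.fmapSection
    (.allTy KdC.scheme (.pi (.cst .Fmap ⬝ₜᶜ X 0) (.pi (.cst .FmapId ⬝ₜᶜ X 0 ⬝ᶜ x 0) (.pi (.cst .FmapCompose ⬝ₜᶜ X 0 ⬝ᶜ x 1)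
    (.allTy .star (.allTy .star (.allTy .star (.pi (X 1 ⟶ₜᶜ X 0) (.pi (X 2 ⟶ₜᶜ X 1)
      (.pi (X 2) (.eq (x 2 ⋆ᶜ (x 1 ⋆ᶜ x 0)) (x 0)) ⟶ₜᶜ .pi (X 3 ⬝ₜᶜ X 2)
        (.eq (x 5 ⋆ₜᶜ X 1 ⋆ₜᶜ X 0 ⋆ᶜ x 2 ⋆ᶜ (x 5 ⋆ₜᶜ X 2 ⋆ₜᶜ X 1 ⋆ᶜ x 1 ⋆ᶜ x 0)) (x 0))))))))))))
    (.lamTy (.lam (.lam (.lam (.lamTy (.lamTy (.lamTy (.lam (.lam (.lam (.lam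
    (.rho (x 4 ⋆ₜᶜ X 2 ⋆ₜᶜ X 1 ⋆ₜᶜ X 0 ⋆ᶜ x 3 ⋆ᶜ x 2 ⋆ᶜ x 0) (.eq (x 0) (x 1))
      (x 5 ⋆ₜᶜ X 2 ⋆ₜᶜ X 0 ⋆ᶜ .lam (x 4 ⋆ᶜ (x 3 ⋆ᶜ x 0)) ⋆ᶜ x 1 ⋆ᶜ x 0)))))))))))))
    (.lam (.lam (.lam (.lam (.lam (.lam (.lam (.app (.app (.app (.var 5)
      (.lam (.app (.var 4) (.app (.var 3) (.var 0))))) (.var 1)) (.var 0)))))))))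
  | .algLROfRec => .tm CDLE.algLROfRec
    (.allTy KdC.scheme (.pi (.cst .Fmap ⬝ₜᶜ X 0) (.allTm (.cst .FmapId ⬝ₜᶜ X 0 ⬝ᶜ x 0)
    (.allTm (.cst .FmapCompose ⬝ₜᶜ X 0 ⬝ᶜ x 1) (.allTy (KdC.predOn (.cst .ScottD ⬝ₜᶜ X 0))
      (.cst .PrfAlgRec ⬝ₜᶜ X 1 ⬝ᶜ x 2 ⬝ₜᶜ (.cst .ScottD ⬝ₜᶜ X 1)
          ⬝ᶜ (.cst .scottInD ⋆ₜᶜ X 1 ⋆ₑᶜ (.cst .monoFunctor ⋆ₜᶜ X 1 ⋆ᶜ x 2 ⋆ₑᶜ x 1 ⋆ₑᶜ x 0)) ⬝ₜᶜ X 0 ⟶ₜᶜ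
        (.cst .PrfAlgLR) ⬝ₜᶜ X 1 ⬝ᶜ (.cst .monoFunctor ⋆ₜᶜ X 1 ⋆ᶜ x 2 ⋆ₑᶜ x 1 ⋆ₑᶜ x 0) ⬝ₜᶜ X 0))))))
    (.lamTy (.lam (.lamE (.lamE (.lamTy (.lam (.lamTy (.lam (.lam
    (.rho (.sym (.cst .fmapSection ⋆ₜᶜ X 2 ⋆ᶜ x 5 ⋆ᶜ x 4 ⋆ᶜ x 3 ⋆ₜᶜ TyC.handle (X 2) (X 1) (X 0)
        ⋆ₜᶜ (.cst .Sigma ⬝ₜᶜ (.cst .ScottD ⬝ₜᶜ X 2) ⬝ₜᶜ X 1) ⋆ₜᶜ (.cst .ScottD ⬝ₜᶜ X 2)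
        ⋆ᶜ (.cst .proj1 ⋆ₜᶜ (.cst .ScottD ⬝ₜᶜ X 2) ⋆ₜᶜ X 1)
        ⋆ᶜ .lam (.cst .mkSigma ⋆ₜᶜ (.cst .ScottD ⬝ₜᶜ X 2) ⋆ₜᶜ X 1 ⋆ᶜ .fst (x 0) ⋆ᶜ (.snd (x 0) ⋆ᶜ x 1 ⋆ᶜ x 1))
        ⋆ᶜ .lam TmC.rfl ⋆ᶜ x 1))
      (X 1 ⬝ᶜ (.cst .scottInD ⋆ₜᶜ X 2 ⋆ₑᶜ (.cst .monoFunctor ⋆ₜᶜ X 2 ⋆ᶜ x 6 ⋆ₑᶜ x 5 ⋆ₑᶜ x 4) ⋆ᶜ x 0))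
      (x 2 ⋆ᶜ (x 5 ⋆ₜᶜ TyC.handle (X 2) (X 1) (X 0) ⋆ₜᶜ (.cst .Sigma ⬝ₜᶜ (.cst .ScottD ⬝ₜᶜ X 2) ⬝ₜᶜ X 1)
        ⋆ᶜ .lam (.cst .mkSigma ⋆ₜᶜ (.cst .ScottD ⬝ₜᶜ X 2) ⋆ₜᶜ X 1 ⋆ᶜ .fst (x 0) ⋆ᶜ (.snd (x 0) ⋆ᶜ x 1 ⋆ᶜ x 1))
        ⋆ᶜ x 1))))))))))))
    (.lam (.lam (.lam (.lam (.app (.var 2) (.app (.app (.var 3) (.lam (.lam (.app (.app (.var 0) (.var 1))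
      (.app (.app (.var 1) (.var 2)) (.var 2)))))) (.var 1)))))))
  | .indD => .tm CDLE.indD
    ((.cst .IndDType))
    (.lamTy (.lam (.lamE (.lamE (.lamTy (.lam (.lam
    (.cst .indLRD ⋆ₜᶜ X 1 ⋆ₑᶜ (.cst .monoFunctor ⋆ₜᶜ X 1 ⋆ᶜ x 4 ⋆ₑᶜ x 3 ⋆ₑᶜ x 2) ⋆ₜᶜ X 0
      ⋆ᶜ (.cst .algLROfRec ⋆ₜᶜ X 1 ⋆ᶜ x 4 ⋆ₑᶜ x 3 ⋆ₑᶜ x 2 ⋆ₜᶜ X 0 ⋆ᶜ x 1) ⋆ᶜ x 0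
      ⋆ᶜ (.cst .algLROfRec ⋆ₜᶜ X 1 ⋆ᶜ x 4 ⋆ₑᶜ x 3 ⋆ₑᶜ x 2 ⋆ₜᶜ X 0 ⋆ᶜ x 1)))))))))
    (.lam (.lam (.lam (.app (.app (.var 0)
      (.lam (.lam (.app (.var 3) (.app (.app (.var 4) (.lam (.lam (.app (.app (.var 0) (.var 1))
      (.app (.app (.var 1) (.var 2)) (.var 2)))))) (.var 1))))))
      (.lam (.lam (.app (.var 3) (.app (.app (.var 4) (.lam (.lam (.app (.app (.var 0) (.var 1))
      (.app (.app (.var 1) (.var 2)) (.var 2)))))) (.var 1)))))))))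

/-! ### Denotations -/

/-- The type constructor that a constant denotes. -/
def Const.tyVal (c : Const) : Ty :=
  match c.decl with
  | .ty T _ => T
  | .tm .. => CDLE.Top

/-- The term that a constant denotes. -/
def Const.tmVal (c : Const) : Tm :=
  match c.decl with
  | .ty .. => rfl'
  | .tm t .. => t

mutual

def KdC.den : KdC → Kd
  | .star => .star
  | .piTm x y => .piTm x.den y.den
  | .piTy x y => .piTy x.den y.den

def TyC.den : TyC → Ty
  | .var n => .var n
  | .cst c => c.tyVal
  | .allTy x y => .allTy x.den y.den
  | .allTm x y => .allTm x.den y.den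
  | .pi x y => .pi x.den y.den
  | .lamTm x y => .lamTm x.den y.den
  | .lamTy x y => .lamTy x.den y.den
  | .appTm x y => .appTm x.den y.den
  | .appTy x y => .appTy x.den y.den
  | .iota x y => .iota x.den y.den
  | .eq x y => .eq x.den y.den

def TmC.den : TmC → Tm
  | .var n => .var n
  | .cst c => c.tmVal
  | .lam x => .lam x.den
  | .app x y => .app x.den y.den
  | .lamTy x => .lamTy x.den
  | .appTy x y => .appTy x.den y.den
  | .lamE x => .lamE x.den
  | .appE x y => .appE x.den y.den
  | .pair x y => .pair x.den y.den
  | .fst x => .fst x.den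
  | .snd x => .snd x.den
  | .beta x => .beta x.den
  | .rho x y z => .rho x.den y.den z.den
  | .phi x y z => .phi x.den y.den z.den
  | .chi x y => .chi x.den y.den
  | .letIn x y z => .letIn x.den y.den z.den
  | .sym x => .sym x.den

end

section Denotation

attribute [local simp] Const.decl Const.tyVal Const.tmVal KdC.den TyC.den TmC.den KdC.predOn
  KdC.scheme TyC.arrow TyC.earrow TyC.handle TmC.id TmC.rfl TyC.wkTm KdC.rename TyC.rename
  TmC.rename Kd.rename Ty.rename Tm.rename arrow earrow predOn scheme idTm rfl' handle Ty.wkTm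

/-- The part of the signature that describes `c` is correct. -/
theorem decl_den (c : Const) :
    match c.decl with
    | .ty T A => T = A.den
    | .tm t A u _ => t = .chi A.den u.den := by
  cases c with
  | Top => simp [Top]
  | View => simp [View]
  | intrView => simp [intrView]
  | elimView => simp [elimView]
  | extView => simp [extView]
  | Cast => simp [Cast]
  | intrCast => simp [intrCast]
  | elimCast => simp [elimCast]
  | castTrans => simp [castTrans]
  | Mono => simp [Mono]
  | Rec => simp [Rec]
  | recLB => simp [recLB]
  | recGLB => simp [recGLB]
  | recRoll => simp [recRoll]
  | roll => simp [roll]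
  | AlgCase => simp [AlgCase]
  | DF => simp [DF]
  | inDF => simp [inDF]
  | monoDF => simp [monoDF]
  | WkPrfAlg => simp [WkPrfAlg]
  | WkIndDF => simp [WkIndDF]
  | inWkIndDF => simp [inWkIndDF]
  | DFI => simp [DFI]
  | monoDFI => simp [monoDFI]
  | ScottD => simp [ScottD]
  | rollD => simp [rollD]
  | scottInD => simp [scottInD]
  | DRec => simp [DRec]
  | inDRec => simp [inDRec]
  | PrfAlgLR => simp [PrfAlgLR]
  | LRD => simp [LRD]
  | Fmap => simp [Fmap]
  | FmapId => simp [FmapId]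
  | FmapCompose => simp [FmapCompose]
  | monoFunctor => simp [monoFunctor]
  | PreSigma => simp [PreSigma]
  | mkPreSigma => simp [mkPreSigma]
  | Sigma => simp [Sigma]
  | proj1 => simp [proj1]
  | Alg => simp [Alg]
  | PrfAlgRec => simp [PrfAlgRec]
  | ToDType => simp [ToDType]
  | IndLRDType => simp [IndLRDType]
  | IndDType => simp [IndDType]
  | rollCast => simp [rollCast]
  | indCast => simp [indCast]
  | toD => simp [toD]
  | indLRD => simp [indLRD]
  | mkSigma => simp [mkSigma]
  | fmapSection => simp [fmapSection]
  | algLROfRec => simp [algLROfRec]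
  | indD => simp [indD]

end Denotation

/-- The erasures that the signature lists are correct. -/
theorem decl_erase (c : Const) :
    match c.decl with
    | .ty .. => True
    | .tm t _ _ e => BetaEta t.erase e := by
  cases c <;> first | trivial | exact BetaEta.of_nf 50 (by decide +kernel)

/-! ### Scoping of codes -/

/-- The position of a constant in the signature. -/
def Const.idx (c : Const) : ℕ := c.ctorIdx

mutual

/-- All free term variables have index below `a`, all free type variables index below `b`, and
all constants are among the first `n`. -/
def KdC.scoped : ℕ → ℕ → ℕ → KdC → Bool
  | _, _, _, .star => true
  | n, a, b, .piTm x y => x.scoped n a b && y.scoped n (a + 1) b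
  | n, a, b, .piTy x y => x.scoped n a b && y.scoped n a (b + 1)

def TyC.scoped : ℕ → ℕ → ℕ → TyC → Bool
  | _, _, b, .var i => Nat.blt i b
  | n, _, _, .cst c => Nat.blt c.idx n
  | n, a, b, .allTy x y => x.scoped n a b && y.scoped n a (b + 1)
  | n, a, b, .allTm x y => x.scoped n a b && y.scoped n (a + 1) b
  | n, a, b, .pi x y => x.scoped n a b && y.scoped n (a + 1) b
  | n, a, b, .lamTm x y => x.scoped n a b && y.scoped n (a + 1) b
  | n, a, b, .lamTy x y => x.scoped n a b && y.scoped n a (b + 1)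
  | n, a, b, .appTm x y => x.scoped n a b && y.scoped n a b
  | n, a, b, .appTy x y => x.scoped n a b && y.scoped n a b
  | n, a, b, .iota x y => x.scoped n a b && y.scoped n (a + 1) b
  | n, a, b, .eq x y => x.scoped n a b && y.scoped n a b

def TmC.scoped : ℕ → ℕ → ℕ → TmC → Bool
  | _, a, _, .var i => Nat.blt i a
  | n, _, _, .cst c => Nat.blt c.idx n
  | n, a, b, .lam x => x.scoped n (a + 1) b
  | n, a, b, .app x y => x.scoped n a b && y.scoped n a b
  | n, a, b, .lamTy x => x.scoped n a (b + 1)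
  | n, a, b, .appTy x y => x.scoped n a b && y.scoped n a b
  | n, a, b, .lamE x => x.scoped n (a + 1) b
  | n, a, b, .appE x y => x.scoped n a b && y.scoped n a b
  | n, a, b, .pair x y => x.scoped n a b && y.scoped n a b
  | n, a, b, .fst x => x.scoped n a b
  | n, a, b, .snd x => x.scoped n a b
  | n, a, b, .beta x => x.scoped n a b
  | n, a, b, .rho x y z => x.scoped n a b && (y.scoped n (a + 1) b && z.scoped n a b)
  | n, a, b, .phi x y z => x.scoped n a b && (y.scoped n a b && z.scoped n a b)
  | n, a, b, .chi x y => x.scoped n a b && y.scoped n a b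
  | n, a, b, .letIn x y z => x.scoped n a b && (y.scoped n a b && z.scoped n (a + 1) b)
  | n, a, b, .sym x => x.scoped n a b

end

mutual

theorem KdC.den_scoped : ∀ (e : KdC) {n a b : ℕ},
    (∀ c : Const, c.idx < n → c.tyVal.Scoped 0 0 ∧ c.tmVal.Scoped 0 0) →
    e.scoped n a b = true → e.den.Scoped a b
  | .star, _, _, _, _, _ => trivial
  | .piTm x y, _, _, _, H, h => by
    simp only [KdC.scoped, Bool.and_eq_true] at h
    exact ⟨x.den_scoped H h.1, y.den_scoped H h.2⟩
  | .piTy x y, _, _, _, H, h => by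
    simp only [KdC.scoped, Bool.and_eq_true] at h
    exact ⟨x.den_scoped H h.1, y.den_scoped H h.2⟩

theorem TyC.den_scoped : ∀ (e : TyC) {n a b : ℕ},
    (∀ c : Const, c.idx < n → c.tyVal.Scoped 0 0 ∧ c.tmVal.Scoped 0 0) →
    e.scoped n a b = true → e.den.Scoped a b
  | .var _, _, _, _, _, h => Nat.blt_eq.mp h
  | .cst c, _, _, _, H, h => c.tyVal.scoped_mono (H c (Nat.blt_eq.mp h)).1 (Nat.zero_le _) (Nat.zero_le _)
  | .allTy x y, _, _, _, H, h => by
    simp only [TyC.scoped, Bool.and_eq_true] at h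
    exact ⟨x.den_scoped H h.1, y.den_scoped H h.2⟩
  | .allTm x y, _, _, _, H, h => by
    simp only [TyC.scoped, Bool.and_eq_true] at h
    exact ⟨x.den_scoped H h.1, y.den_scoped H h.2⟩
  | .pi x y, _, _, _, H, h => by
    simp only [TyC.scoped, Bool.and_eq_true] at h
    exact ⟨x.den_scoped H h.1, y.den_scoped H h.2⟩
  | .lamTm x y, _, _, _, H, h => by
    simp only [TyC.scoped, Bool.and_eq_true] at h
    exact ⟨x.den_scoped H h.1, y.den_scoped H h.2⟩
  | .lamTy x y, _, _, _, H, h => by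
    simp only [TyC.scoped, Bool.and_eq_true] at h
    exact ⟨x.den_scoped H h.1, y.den_scoped H h.2⟩
  | .appTm x y, _, _, _, H, h => by
    simp only [TyC.scoped, Bool.and_eq_true] at h
    exact ⟨x.den_scoped H h.1, y.den_scoped H h.2⟩
  | .appTy x y, _, _, _, H, h => by
    simp only [TyC.scoped, Bool.and_eq_true] at h
    exact ⟨x.den_scoped H h.1, y.den_scoped H h.2⟩
  | .iota x y, _, _, _, H, h => by
    simp only [TyC.scoped, Bool.and_eq_true] at h
    exact ⟨x.den_scoped H h.1, y.den_scoped H h.2⟩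
  | .eq x y, _, _, _, H, h => by
    simp only [TyC.scoped, Bool.and_eq_true] at h
    exact ⟨x.den_scoped H h.1, y.den_scoped H h.2⟩

theorem TmC.den_scoped : ∀ (e : TmC) {n a b : ℕ},
    (∀ c : Const, c.idx < n → c.tyVal.Scoped 0 0 ∧ c.tmVal.Scoped 0 0) →
    e.scoped n a b = true → e.den.Scoped a b
  | .var _, _, _, _, _, h => Nat.blt_eq.mp h
  | .cst c, _, _, _, H, h => c.tmVal.scoped_mono (H c (Nat.blt_eq.mp h)).2 (Nat.zero_le _) (Nat.zero_le _)
  | .lam x, _, _, _, H, h => x.den_scoped H h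
  | .app x y, _, _, _, H, h => by
    simp only [TmC.scoped, Bool.and_eq_true] at h
    exact ⟨x.den_scoped H h.1, y.den_scoped H h.2⟩
  | .lamTy x, _, _, _, H, h => x.den_scoped H h
  | .appTy x y, _, _, _, H, h => by
    simp only [TmC.scoped, Bool.and_eq_true] at h
    exact ⟨x.den_scoped H h.1, y.den_scoped H h.2⟩
  | .lamE x, _, _, _, H, h => x.den_scoped H h
  | .appE x y, _, _, _, H, h => by
    simp only [TmC.scoped, Bool.and_eq_true] at h
    exact ⟨x.den_scoped H h.1, y.den_scoped H h.2⟩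
  | .pair x y, _, _, _, H, h => by
    simp only [TmC.scoped, Bool.and_eq_true] at h
    exact ⟨x.den_scoped H h.1, y.den_scoped H h.2⟩
  | .fst x, _, _, _, H, h => x.den_scoped H h
  | .snd x, _, _, _, H, h => x.den_scoped H h
  | .beta x, _, _, _, H, h => x.den_scoped H h
  | .rho x y z, _, _, _, H, h => by
    simp only [TmC.scoped, Bool.and_eq_true] at h
    exact ⟨x.den_scoped H h.1, y.den_scoped H h.2.1, z.den_scoped H h.2.2⟩
  | .phi x y z, _, _, _, H, h => by
    simp only [TmC.scoped, Bool.and_eq_true] at h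
    exact ⟨x.den_scoped H h.1, y.den_scoped H h.2.1, z.den_scoped H h.2.2⟩
  | .chi x y, _, _, _, H, h => by
    simp only [TmC.scoped, Bool.and_eq_true] at h
    exact ⟨x.den_scoped H h.1, y.den_scoped H h.2⟩
  | .letIn x y z, _, _, _, H, h => by
    simp only [TmC.scoped, Bool.and_eq_true] at h
    exact ⟨x.den_scoped H h.1, y.den_scoped H h.2.1, z.den_scoped H h.2.2⟩
  | .sym x, _, _, _, H, h => x.den_scoped H h

end

theorem decl_scoped (c : Const) :
    (match c.decl with
    | .ty _ A => A.scoped c.idx 0 0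
    | .tm _ A u _ => A.scoped c.idx 0 0 && u.scoped c.idx 0 0) = true := by
  cases c <;> decide +kernel

theorem Const.scoped (c : Const) : c.tyVal.Scoped 0 0 ∧ c.tmVal.Scoped 0 0 := by
  induction hc : c.idx using Nat.strong_induction_on generalizing c with
  | _ n ih =>
    subst hc
    have H : ∀ d : Const, d.idx < c.idx → d.tyVal.Scoped 0 0 ∧ d.tmVal.Scoped 0 0 :=
      fun d hd => ih d.idx hd d rfl
    have h₁ := decl_scoped c
    have h₂ := decl_den c
    unfold Const.tyVal Const.tmVal
    cases hd : c.decl with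
    | ty T A =>
      rw [hd] at h₁ h₂
      obtain rfl : T = A.den := h₂
      exact ⟨A.den_scoped H h₁, Nat.zero_lt_one⟩
    | tm t A u e =>
      rw [hd] at h₁ h₂
      obtain rfl : t = .chi A.den u.den := h₂
      have h₁ := (Bool.and_eq_true _ _).mp h₁
      exact ⟨⟨Nat.zero_lt_one, Nat.zero_lt_one⟩, A.den_scoped H h₁.1, u.den_scoped H h₁.2⟩

/-! ### Denotation commutes with renaming and substitution -/

mutual

theorem KdC.den_rename : ∀ (e : KdC) (r q : ℕ → ℕ),
    (e.rename r q).den = e.den.rename r q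
  | .star, _, _ => rfl
  | .piTm x y, r, q => by
    simp only [KdC.rename, KdC.den, Kd.rename, x.den_rename r q, y.den_rename (upRen r) q]
  | .piTy x y, r, q => by
    simp only [KdC.rename, KdC.den, Kd.rename, x.den_rename r q, y.den_rename r (upRen q)]

theorem TyC.den_rename : ∀ (e : TyC) (r q : ℕ → ℕ),
    (e.rename r q).den = e.den.rename r q
  | .var n, _, _ => rfl
  | .cst c, _, _ => (c.tyVal.rename_of_scoped (fun _ h => absurd h (Nat.not_lt_zero _))
      (fun _ h => absurd h (Nat.not_lt_zero _)) c.scoped.1).symm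
  | .allTy x y, r, q => by
    simp only [TyC.rename, TyC.den, Ty.rename, x.den_rename r q, y.den_rename r (upRen q)]
  | .allTm x y, r, q => by
    simp only [TyC.rename, TyC.den, Ty.rename, x.den_rename r q, y.den_rename (upRen r) q]
  | .pi x y, r, q => by
    simp only [TyC.rename, TyC.den, Ty.rename, x.den_rename r q, y.den_rename (upRen r) q]
  | .lamTm x y, r, q => by
    simp only [TyC.rename, TyC.den, Ty.rename, x.den_rename r q, y.den_rename (upRen r) q]
  | .lamTy x y, r, q => by
    simp only [TyC.rename, TyC.den, Ty.rename, x.den_rename r q, y.den_rename r (upRen q)]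
  | .appTm x y, r, q => by
    simp only [TyC.rename, TyC.den, Ty.rename, x.den_rename r q, y.den_rename r q]
  | .appTy x y, r, q => by
    simp only [TyC.rename, TyC.den, Ty.rename, x.den_rename r q, y.den_rename r q]
  | .iota x y, r, q => by
    simp only [TyC.rename, TyC.den, Ty.rename, x.den_rename r q, y.den_rename (upRen r) q]
  | .eq x y, r, q => by
    simp only [TyC.rename, TyC.den, Ty.rename, x.den_rename r q, y.den_rename r q]

theorem TmC.den_rename : ∀ (e : TmC) (r q : ℕ → ℕ),
    (e.rename r q).den = e.den.rename r q
  | .var n, _, _ => rfl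
  | .cst c, _, _ => (c.tmVal.rename_of_scoped (fun _ h => absurd h (Nat.not_lt_zero _))
      (fun _ h => absurd h (Nat.not_lt_zero _)) c.scoped.2).symm
  | .lam x, r, q => by
    simp only [TmC.rename, TmC.den, Tm.rename, x.den_rename (upRen r) q]
  | .app x y, r, q => by
    simp only [TmC.rename, TmC.den, Tm.rename, x.den_rename r q, y.den_rename r q]
  | .lamTy x, r, q => by
    simp only [TmC.rename, TmC.den, Tm.rename, x.den_rename r (upRen q)]
  | .appTy x y, r, q => by
    simp only [TmC.rename, TmC.den, Tm.rename, x.den_rename r q, y.den_rename r q]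
  | .lamE x, r, q => by
    simp only [TmC.rename, TmC.den, Tm.rename, x.den_rename (upRen r) q]
  | .appE x y, r, q => by
    simp only [TmC.rename, TmC.den, Tm.rename, x.den_rename r q, y.den_rename r q]
  | .pair x y, r, q => by
    simp only [TmC.rename, TmC.den, Tm.rename, x.den_rename r q, y.den_rename r q]
  | .fst x, r, q => by
    simp only [TmC.rename, TmC.den, Tm.rename, x.den_rename r q]
  | .snd x, r, q => by
    simp only [TmC.rename, TmC.den, Tm.rename, x.den_rename r q]
  | .beta x, r, q => by
    simp only [TmC.rename, TmC.den, Tm.rename, x.den_rename r q]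
  | .rho x y z, r, q => by
    simp only [TmC.rename, TmC.den, Tm.rename, x.den_rename r q, y.den_rename (upRen r) q, z.den_rename r q]
  | .phi x y z, r, q => by
    simp only [TmC.rename, TmC.den, Tm.rename, x.den_rename r q, y.den_rename r q, z.den_rename r q]
  | .chi x y, r, q => by
    simp only [TmC.rename, TmC.den, Tm.rename, x.den_rename r q, y.den_rename r q]
  | .letIn x y z, r, q => by
    simp only [TmC.rename, TmC.den, Tm.rename, x.den_rename r q, y.den_rename r q, z.den_rename (upRen r) q]
  | .sym x, r, q => by
    simp only [TmC.rename, TmC.den, Tm.rename, x.den_rename r q]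

end

/-- The denotation of a substitution. -/
def SubC.den (s : SubC) : Sub := ⟨fun n => (s.tm n).den, fun n => (s.ty n).den⟩

theorem SubC.den_upTm (s : SubC) : s.upTm.den = s.den.upTm := by
  have h₁ : s.upTm.den.tm = s.den.upTm.tm := by
    funext n
    cases n
    · rfl
    · exact (s.tm _).den_rename _ _
  have h₂ : s.upTm.den.ty = s.den.upTm.ty := funext fun n => (s.ty n).den_rename _ _
  exact congrArg₂ Sub.mk h₁ h₂

theorem SubC.den_upTy (s : SubC) : s.upTy.den = s.den.upTy := by
  have h₁ : s.upTy.den.ty = s.den.upTy.ty := by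
    funext n
    cases n
    · rfl
    · exact (s.ty _).den_rename _ _
  have h₂ : s.upTy.den.tm = s.den.upTy.tm := funext fun n => (s.tm n).den_rename _ _
  exact congrArg₂ Sub.mk h₂ h₁

theorem Sub.fixes_zero (s : Sub) : s.Fixes 0 0 :=
  ⟨fun _ h => absurd h (Nat.not_lt_zero _), fun _ h => absurd h (Nat.not_lt_zero _)⟩

mutual

theorem KdC.den_subst : ∀ (e : KdC) (s : SubC),
    (e.subst s).den = e.den.subst s.den
  | .star, _ => rfl
  | .piTm x y, s => by
    simp only [KdC.subst, KdC.den, Kd.subst, SubC.den_upTm, x.den_subst s, y.den_subst s.upTm]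
  | .piTy x y, s => by
    simp only [KdC.subst, KdC.den, Kd.subst, SubC.den_upTy, x.den_subst s, y.den_subst s.upTy]

theorem TyC.den_subst : ∀ (e : TyC) (s : SubC),
    (e.subst s).den = e.den.subst s.den
  | .var n, _ => rfl
  | .cst c, s => (c.tyVal.subst_of_scoped s.den.fixes_zero c.scoped.1).symm
  | .allTy x y, s => by
    simp only [TyC.subst, TyC.den, Ty.subst, SubC.den_upTy, x.den_subst s, y.den_subst s.upTy]
  | .allTm x y, s => by
    simp only [TyC.subst, TyC.den, Ty.subst, SubC.den_upTm, x.den_subst s, y.den_subst s.upTm]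
  | .pi x y, s => by
    simp only [TyC.subst, TyC.den, Ty.subst, SubC.den_upTm, x.den_subst s, y.den_subst s.upTm]
  | .lamTm x y, s => by
    simp only [TyC.subst, TyC.den, Ty.subst, SubC.den_upTm, x.den_subst s, y.den_subst s.upTm]
  | .lamTy x y, s => by
    simp only [TyC.subst, TyC.den, Ty.subst, SubC.den_upTy, x.den_subst s, y.den_subst s.upTy]
  | .appTm x y, s => by
    simp only [TyC.subst, TyC.den, Ty.subst, x.den_subst s, y.den_subst s]
  | .appTy x y, s => by
    simp only [TyC.subst, TyC.den, Ty.subst, x.den_subst s, y.den_subst s]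
  | .iota x y, s => by
    simp only [TyC.subst, TyC.den, Ty.subst, SubC.den_upTm, x.den_subst s, y.den_subst s.upTm]
  | .eq x y, s => by
    simp only [TyC.subst, TyC.den, Ty.subst, x.den_subst s, y.den_subst s]

theorem TmC.den_subst : ∀ (e : TmC) (s : SubC),
    (e.subst s).den = e.den.subst s.den
  | .var n, _ => rfl
  | .cst c, s => (c.tmVal.subst_of_scoped s.den.fixes_zero c.scoped.2).symm
  | .lam x, s => by
    simp only [TmC.subst, TmC.den, Tm.subst, SubC.den_upTm, x.den_subst s.upTm]
  | .app x y, s => by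
    simp only [TmC.subst, TmC.den, Tm.subst, x.den_subst s, y.den_subst s]
  | .lamTy x, s => by
    simp only [TmC.subst, TmC.den, Tm.subst, SubC.den_upTy, x.den_subst s.upTy]
  | .appTy x y, s => by
    simp only [TmC.subst, TmC.den, Tm.subst, x.den_subst s, y.den_subst s]
  | .lamE x, s => by
    simp only [TmC.subst, TmC.den, Tm.subst, SubC.den_upTm, x.den_subst s.upTm]
  | .appE x y, s => by
    simp only [TmC.subst, TmC.den, Tm.subst, x.den_subst s, y.den_subst s]
  | .pair x y, s => by
    simp only [TmC.subst, TmC.den, Tm.subst, x.den_subst s, y.den_subst s]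
  | .fst x, s => by
    simp only [TmC.subst, TmC.den, Tm.subst, x.den_subst s]
  | .snd x, s => by
    simp only [TmC.subst, TmC.den, Tm.subst, x.den_subst s]
  | .beta x, s => by
    simp only [TmC.subst, TmC.den, Tm.subst, x.den_subst s]
  | .rho x y z, s => by
    simp only [TmC.subst, TmC.den, Tm.subst, SubC.den_upTm, x.den_subst s, y.den_subst s.upTm, z.den_subst s]
  | .phi x y z, s => by
    simp only [TmC.subst, TmC.den, Tm.subst, x.den_subst s, y.den_subst s, z.den_subst s]
  | .chi x y, s => by
    simp only [TmC.subst, TmC.den, Tm.subst, x.den_subst s, y.den_subst s]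
  | .letIn x y z, s => by
    simp only [TmC.subst, TmC.den, Tm.subst, SubC.den_upTm, x.den_subst s, y.den_subst s, z.den_subst s.upTm]
  | .sym x, s => by
    simp only [TmC.subst, TmC.den, Tm.subst, x.den_subst s]

end

theorem SubC.den_oneTm (u : TmC) : (SubC.oneTm u).den = Sub.oneTm u.den := by
  have h : (SubC.oneTm u).den.tm = (Sub.oneTm u.den).tm := by
    funext n
    cases n <;> rfl
  exact congrArg (Sub.mk · _) h

theorem SubC.den_oneTy (A : TyC) : (SubC.oneTy A).den = Sub.oneTy A.den := by
  have h : (SubC.oneTy A).den.ty = (Sub.oneTy A.den).ty := by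
    funext n
    cases n <;> rfl
  exact congrArg (Sub.mk _ ·) h

theorem KdC.den_instTm (k : KdC) (u : TmC) : (k.instTm u).den = k.den.instTm u.den :=
  (k.den_subst _).trans (congrArg (Kd.subst · _) (SubC.den_oneTm u))

theorem KdC.den_instTy (k : KdC) (A : TyC) : (k.instTy A).den = k.den.instTy A.den :=
  (k.den_subst _).trans (congrArg (Kd.subst · _) (SubC.den_oneTy A))

theorem TyC.den_instTm (T : TyC) (u : TmC) : (T.instTm u).den = T.den.instTm u.den :=
  (T.den_subst _).trans (congrArg (Ty.subst · _) (SubC.den_oneTm u))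

theorem TyC.den_instTy (T A : TyC) : (T.instTy A).den = T.den.instTy A.den :=
  (T.den_subst _).trans (congrArg (Ty.subst · _) (SubC.den_oneTy A))

/-! ### Erasure of codes -/

/-- The erasure of a constant, up to conversion. -/
def Const.er (c : Const) : Pure :=
  match c.decl with
  | .ty .. => Pure.id
  | .tm _ _ _ e => e

theorem Const.erase_tmVal (c : Const) : BetaEta c.tmVal.erase c.er := by
  have h := decl_erase c
  unfold Const.tmVal Const.er
  cases hd : c.decl with
  | ty T A => exact .refl _
  | tm t A u e => rwa [hd] at h

/-- The erasure of the term that is coded, up to conversion. -/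
def TmC.er : TmC → Pure
  | .var n => .var n
  | .cst c => c.er
  | .lam t => .lam t.er
  | .app t t' => .app t.er t'.er
  | .lamE t => t.er.inst Pure.id
  | .lamTy t | .appTy t _ | .appE t _ | .pair t _ | .fst t | .snd t | .beta t | .rho _ _ t
  | .phi _ _ t | .chi _ t | .sym t => t.er
  | .letIn _ t₁ t₂ => .app (.lam t₂.er) t₁.er

theorem TmC.erase_den : ∀ t : TmC, BetaEta t.den.erase t.er
  | .var _ => .refl _
  | .cst c => c.erase_tmVal
  | .lam t => .lam t.erase_den
  | .app t u => .app t.erase_den u.erase_den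
  | .lamE t => t.erase_den.subst _
  | .lamTy t | .appTy t _ | .appE t _ | .pair t _ | .fst t | .snd t | .beta t | .rho _ _ t
  | .phi _ _ t | .chi _ t | .sym t => t.erase_den
  | .letIn _ t u => .app (.lam u.erase_den) t.erase_den

/-- Convertibility of the erasures of coded terms. -/
def TmC.eqv (t u : TmC) : Bool := Pure.beq (t.er.nf 50) (u.er.nf 50)

theorem TmC.den_eqv {t u : TmC} (h : t.eqv u = true) : t.den.Eqv u.den :=
  .trans t.erase_den (.trans (.of_nf 50 h) (.symm u.erase_den))

theorem Tm.lt_of_free_erase : ∀ (t : Tm) {a b n : ℕ}, t.Scoped a b → t.erase.Free n → n < a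
  | .var _, _, _, _, h, hn => hn ▸ h
  | .lam t, _, _, _, h, hn => Nat.lt_of_succ_lt_succ (t.lt_of_free_erase (a := _ + 1) h hn)
  | .lamE t, _, _, _, h, hn =>
    Nat.lt_of_succ_lt_succ (t.lt_of_free_erase (a := _ + 1) h (Pure.free_inst_id hn))
  | .app t u, _, _, _, h, hn => hn.elim (t.lt_of_free_erase h.1) (u.lt_of_free_erase h.2)
  | .lamTy t, _, b, _, h, hn => t.lt_of_free_erase (b := b + 1) h hn
  | .appTy t _, _, _, _, h, hn | .appE t _, _, _, _, h, hn | .pair t _, _, _, _, h, hn =>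
    t.lt_of_free_erase h.1 hn
  | .fst t, _, b, _, h, hn | .snd t, _, b, _, h, hn | .beta t, _, b, _, h, hn
  | .sym t, _, b, _, h, hn => t.lt_of_free_erase (b := b) h hn
  | .rho _ _ t, _, _, _, h, hn | .phi _ _ t, _, _, _, h, hn => t.lt_of_free_erase h.2.2 hn
  | .chi _ t, _, _, _, h, hn => t.lt_of_free_erase h.2 hn
  | .letIn _ t u, _, _, _, h, hn =>
    hn.elim (fun hn => Nat.lt_of_succ_lt_succ (u.lt_of_free_erase h.2.2 hn))
      (t.lt_of_free_erase h.2.1)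
  | .delta _, _, _, _, _, hn => nomatch hn

/-- The variable of index `n` may occur in the erasure of the term that is coded. -/
def TmC.free : ℕ → TmC → Bool
  | n, .var m => Nat.beq n m
  | _, .cst _ => false
  | n, .lam t | n, .lamE t => t.free (n + 1)
  | n, .app t u => t.free n || u.free n
  | n, .lamTy t | n, .appTy t _ | n, .appE t _ | n, .pair t _ | n, .fst t | n, .snd t
  | n, .beta t | n, .rho _ _ t | n, .phi _ _ t | n, .chi _ t | n, .sym t => t.free n
  | n, .letIn _ t u => u.free (n + 1) || t.free n

theorem TmC.free_of_free_erase : ∀ (t : TmC) {n : ℕ}, t.den.erase.Free n → t.free n = true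
  | .var _, _, h => Nat.beq_eq ▸ h
  | .cst c, _, h => absurd (c.tmVal.lt_of_free_erase c.scoped.2 h) (Nat.not_lt_zero _)
  | .lam t, _, h => t.free_of_free_erase (n := _ + 1) h
  | .lamE t, _, h => t.free_of_free_erase (n := _ + 1) (Pure.free_inst_id h)
  | .app t u, _, h => (Bool.or_eq_true _ _).mpr
    (h.imp t.free_of_free_erase u.free_of_free_erase)
  | .lamTy t, n, h | .appTy t _, n, h | .appE t _, n, h | .pair t _, n, h | .fst t, n, h
  | .snd t, n, h | .beta t, n, h | .rho _ _ t, n, h | .phi _ _ t, n, h | .chi _ t, n, h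
  | .sym t, n, h => t.free_of_free_erase (n := n) h
  | .letIn _ t u, _, h => (Bool.or_eq_true _ _).mpr
    (h.imp u.free_of_free_erase t.free_of_free_erase)

/-! ### Weak head normalization and conversion of codes -/

/-- Weak head normalization, unfolding constants, up to recursion depth `k`. -/
def TyC.whnf : ℕ → TyC → TyC
  | k + 1, .cst c =>
    match c.decl with
    | .ty _ A => A.whnf k
    | .tm .. => .cst c
  | k + 1, .appTm T t =>
    match T.whnf k with
    | .lamTm _ U => (U.instTm t).whnf k
    | U => .appTm U t
  | k + 1, .appTy T A =>
    match T.whnf k with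
    | .lamTy _ U => (U.instTy A).whnf k
    | U => .appTy U A
  | _, T => T

theorem Reds.appTm {T T' : Ty} (h : Reds T T') (t : Tm) : Reds (.appTm T t) (.appTm T' t) :=
  Relation.ReflTransGen.lift (Ty.appTm · t) (fun _ _ => Red.appTm t) _ _ h

theorem Reds.appTy {T T' : Ty} (h : Reds T T') (A : Ty) : Reds (.appTy T A) (.appTy T' A) :=
  Relation.ReflTransGen.lift (Ty.appTy · A) (fun _ _ => Red.appTy A) _ _ h

theorem TyC.reds_whnf (k : ℕ) (T : TyC) : Reds T.den (T.whnf k).den := by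
  induction k generalizing T with
  | zero => cases T <;> exact .refl
  | succ k ih =>
    cases T with
    | cst c =>
      have hc := decl_den c
      simp only [whnf]
      cases hd : c.decl with
      | ty T A =>
        rw [hd] at hc
        have : (TyC.cst c).den = A.den := by simpa [den, Const.tyVal, hd] using hc
        rw [this]
        exact ih A
      | tm => exact .refl
    | appTm T t =>
      have hT := Reds.appTm (ih T) t.den
      simp only [whnf]
      split
      · next S U hU =>
        rw [hU] at hT
        refine hT.trans (.head (.betaTm _ _ _) ?_)
        rw [← TyC.den_instTm]
        exact ih _
      · exact hT
    | appTy T A =>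
      have hT := Reds.appTy (ih T) A.den
      simp only [whnf]
      split
      · next S U hU =>
        rw [hU] at hT
        refine hT.trans (.head (.betaTy _ _ _) ?_)
        rw [← TyC.den_instTy]
        exact ih _
      · exact hT
    | _ => exact .refl

/-- A variable applied to arguments. -/
def TyC.isNeutral : TyC → Bool
  | .var _ => true
  | .appTm T _ | .appTy T _ => T.isNeutral
  | _ => false

/-- Weak head normal forms that are recognized as such. -/
def TyC.isWhnf : TyC → Bool
  | .cst _ => false
  | .appTm T _ | .appTy T _ => T.isNeutral
  | _ => true

theorem TyC.not_red_of_isNeutral : ∀ {T : TyC}, T.isNeutral = true → ∀ U, ¬ Red T.den U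
  | .var _, _, _, h => nomatch h
  | .appTm (.var _) _, _, _, .appTm _ h => nomatch h
  | .appTm (.appTm T t) _, h, _, .appTm _ h' =>
    not_red_of_isNeutral (T := .appTm T t) h _ h'
  | .appTm (.appTy T A) _, h, _, .appTm _ h' =>
    not_red_of_isNeutral (T := .appTy T A) h _ h'
  | .appTy (.var _) _, _, _, .appTy _ h => nomatch h
  | .appTy (.appTm T t) _, h, _, .appTy _ h' =>
    not_red_of_isNeutral (T := .appTm T t) h _ h'
  | .appTy (.appTy T A) _, h, _, .appTy _ h' =>
    not_red_of_isNeutral (T := .appTy T A) h _ h'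

theorem TyC.whnf_of_isWhnf {T : TyC} (h : T.isWhnf = true) : Whnf T.den := by
  cases T with
  | cst => cases h
  | appTm T t => exact not_red_of_isNeutral (T := .appTm T t) h
  | appTy T A => exact not_red_of_isNeutral (T := .appTy T A) h
  | _ => intro U hU; cases hU

mutual

/-- Convertibility of kinds. -/
def KdC.conv : ℕ → KdC → KdC → Bool
  | _ + 1, .star, .star => true
  | k + 1, .piTm T κ, .piTm T' κ' => T.conv k T' && κ.conv k κ'
  | k + 1, .piTy κ₁ κ₂, .piTy κ₁' κ₂' => κ₁.conv k κ₁' && κ₂.conv k κ₂'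
  | _, _, _ => false

/-- Convertibility of types. -/
def TyC.conv : ℕ → TyC → TyC → Bool
  | k + 1, T, T' =>
    (T.whnf 50).isWhnf && ((T'.whnf 50).isWhnf && (T.whnf 50).convWhnf k (T'.whnf 50))
  | _, _, _ => false

/-- Convertibility of types in weak head normal form. -/
def TyC.convWhnf : ℕ → TyC → TyC → Bool
  | _ + 1, .var m, .var n => Nat.beq m n
  | k + 1, .appTm T t, .appTm T' t' => T.convWhnf k T' && t.eqv t'
  | k + 1, .appTy T A, .appTy T' A' => T.convWhnf k T' && A.conv k A'
  | _ + 1, .eq t u, .eq t' u' => t.eqv t' && u.eqv u'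
  | k + 1, .allTy κ T, .allTy κ' T' => κ.conv k κ' && T.conv k T'
  | k + 1, .lamTy κ T, .lamTy κ' T' => κ.conv k κ' && T.conv k T'
  | k + 1, .allTm S T, .allTm S' T' => S.conv k S' && T.conv k T'
  | k + 1, .pi S T, .pi S' T' => S.conv k S' && T.conv k T'
  | k + 1, .lamTm S T, .lamTm S' T' => S.conv k S' && T.conv k T'
  | k + 1, .iota S T, .iota S' T' => S.conv k S' && T.conv k T'
  | _, _, _ => false

end

theorem conv_sound (k : ℕ) :
    (∀ κ κ' : KdC, κ.conv k κ' = true → ConvKd κ.den κ'.den) ∧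
    (∀ T T' : TyC, T.conv k T' = true → ConvTy T.den T'.den) ∧
    (∀ T T' : TyC, T.convWhnf k T' = true → ConvWhnf T.den T'.den) := by
  induction k with
  | zero =>
    refine ⟨fun _ _ h => ?_, fun _ _ h => ?_, fun _ _ h => ?_⟩
    · simp [KdC.conv] at h
    · simp [TyC.conv] at h
    · simp [TyC.convWhnf] at h
  | succ k ih =>
    obtain ⟨ihκ, ihT, ihW⟩ := ih
    refine ⟨fun κ κ' h => ?_, fun T T' h => ?_, fun T T' h => ?_⟩
    · unfold KdC.conv at h
      split at h <;> try simp only [Bool.and_eq_true] at h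
      · exact .star
      · next e => cases e; exact .piTm (ihT _ _ h.1) (ihκ _ _ h.2)
      · next e => cases e; exact .piTy (ihκ _ _ h.1) (ihκ _ _ h.2)
      · cases h
    · simp only [TyC.conv, Bool.and_eq_true] at h
      exact .whnf (T.reds_whnf 50) (TyC.whnf_of_isWhnf h.1) (T'.reds_whnf 50)
        (TyC.whnf_of_isWhnf h.2.1) (ihW _ _ h.2.2)
    · unfold TyC.convWhnf at h
      split at h <;> (try simp only [Bool.and_eq_true] at h) <;>
        try (rename_i e; cases e)
      · rw [Nat.eq_of_beq_eq_true h]; exact .var _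
      · exact .appTm (ihW _ _ h.1) (TmC.den_eqv h.2)
      · exact .appTy (ihW _ _ h.1) (ihT _ _ h.2)
      · exact .eq (TmC.den_eqv h.1) (TmC.den_eqv h.2)
      · exact .allTy (ihκ _ _ h.1) (ihT _ _ h.2)
      · exact .lamTy (ihκ _ _ h.1) (ihT _ _ h.2)
      · exact .allTm (ihT _ _ h.1) (ihT _ _ h.2)
      · exact .pi (ihT _ _ h.1) (ihT _ _ h.2)
      · exact .lamTm (ihT _ _ h.1) (ihT _ _ h.2)
      · exact .iota (ihT _ _ h.1) (ihT _ _ h.2)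
      · cases h

theorem KdC.den_conv {k : ℕ} {κ κ' : KdC} (h : κ.conv k κ' = true) : ConvKd κ.den κ'.den :=
  (conv_sound k).1 _ _ h

theorem TyC.den_conv {k : ℕ} {T T' : TyC} (h : T.conv k T' = true) : ConvTy T.den T'.den :=
  (conv_sound k).2.1 _ _ h

/-! ### Contexts of codes -/

/-- Codes for declarations. -/
inductive EntryC : Type
  | tm (T : TyC)
  | ty (k : KdC)

/-- Codes for contexts. -/
abbrev CtxC : Type := List EntryC

def EntryC.den : EntryC → Entry
  | .tm T => .tm T.den
  | .ty k => .ty k.den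

/-- The context that is coded, on top of the context `Δ`. -/
def CtxC.den (Δ : Ctx) : CtxC → Ctx
  | [] => Δ
  | e :: G => e.den :: CtxC.den Δ G

/-- The type of a term variable. -/
def CtxC.lookupTm : CtxC → ℕ → Option TyC
  | [], _ => none
  | .tm T :: _, 0 => some T.wkTm
  | .tm _ :: G, n + 1 => (CtxC.lookupTm G n).map TyC.wkTm
  | .ty _ :: G, n => (CtxC.lookupTm G n).map TyC.wkTy

/-- The kind of a type variable. -/
def CtxC.lookupTy : CtxC → ℕ → Option KdC
  | [], _ => none
  | .ty k :: _, 0 => some k.wkTy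
  | .ty _ :: G, n + 1 => (CtxC.lookupTy G n).map KdC.wkTy
  | .tm _ :: G, n => (CtxC.lookupTy G n).map KdC.wkTm

/-- Number of term variables that a context declares. -/
def CtxC.numTm : CtxC → ℕ
  | [] => 0
  | .tm _ :: G => CtxC.numTm G + 1
  | .ty _ :: G => CtxC.numTm G

/-- Number of type variables that a context declares. -/
def CtxC.numTy : CtxC → ℕ
  | [] => 0
  | .tm _ :: G => CtxC.numTy G
  | .ty _ :: G => CtxC.numTy G + 1

theorem CtxC.hasTm (Δ : Ctx) : ∀ {G : CtxC} {n : ℕ} {T : TyC}, CtxC.lookupTm G n = some T →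
    HasTm (CtxC.den Δ G) n T.den
  | .tm T :: G, 0, _, h => by
    cases h
    exact (T.den_rename _ _).symm ▸ .here _ _
  | .tm S :: G, n + 1, T, h => by
    obtain ⟨U, hU, rfl⟩ := Option.map_eq_some_iff.mp h
    exact (U.den_rename _ _).symm ▸ .thereTm _ (hasTm Δ hU)
  | .ty k :: G, n, T, h => by
    obtain ⟨U, hU, rfl⟩ := Option.map_eq_some_iff.mp (by simpa [CtxC.lookupTm] using h)
    exact (U.den_rename _ _).symm ▸ .thereTy _ (hasTm Δ hU)

theorem CtxC.hasTy (Δ : Ctx) : ∀ {G : CtxC} {n : ℕ} {κ : KdC}, CtxC.lookupTy G n = some κ →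
    HasTy (CtxC.den Δ G) n κ.den
  | .ty k :: G, 0, _, h => by
    cases h
    exact (k.den_rename _ _).symm ▸ .here _ _
  | .ty S :: G, n + 1, T, h => by
    obtain ⟨U, hU, rfl⟩ := Option.map_eq_some_iff.mp h
    exact (U.den_rename _ _).symm ▸ .thereTy _ (hasTy Δ hU)
  | .tm k :: G, n, T, h => by
    obtain ⟨U, hU, rfl⟩ := Option.map_eq_some_iff.mp (by simpa [CtxC.lookupTy] using h)
    exact (U.den_rename _ _).symm ▸ .thereTm _ (hasTy Δ hU)

theorem CtxC.numTm_le (Δ : Ctx) : ∀ G : CtxC, CtxC.numTm G ≤ CDLE.numTm (CtxC.den Δ G)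
  | [] => Nat.zero_le _
  | .tm _ :: G => Nat.succ_le_succ (numTm_le Δ G)
  | .ty _ :: G => numTm_le Δ G

theorem CtxC.numTy_le (Δ : Ctx) : ∀ G : CtxC, CtxC.numTy G ≤ CDLE.numTy (CtxC.den Δ G)
  | [] => Nat.zero_le _
  | .tm _ :: G => numTy_le Δ G
  | .ty _ :: G => Nat.succ_le_succ (numTy_le Δ G)

/-- The term is well scoped and refers to the first `n` constants only. -/
def TmC.inScope (n : ℕ) (G : CtxC) (t : TmC) : Bool := t.scoped n (CtxC.numTm G) (CtxC.numTy G)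

theorem TmC.den_inScope (Δ : Ctx) {n : ℕ} {G : CtxC} {t : TmC} (h : t.inScope n G = true) :
    t.den.InScope (CtxC.den Δ G) :=
  t.den.scoped_mono (t.den_scoped (fun c _ => c.scoped) h) (CtxC.numTm_le Δ G)
    (CtxC.numTy_le Δ G)

/-! ### A type checker for codes -/

/-- The kind of a type constructor whose body is a type. -/
def TyC.lamKind : TyC → KdC
  | .lamTm T U => .piTm T U.lamKind
  | .lamTy k T => .piTy k T.lamKind
  | _ => .star

/-- `some x` if `b` holds. -/
def guardSome {α : Type} (b : Bool) (x : α) : Option α := bif b then some x else none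

theorem guardSome_eq_some {α : Type} {b : Bool} {x y : α} :
    guardSome b x = some y ↔ b = true ∧ x = y := by
  cases b <;> simp [guardSome]

/-- The inferred kind is `★`. -/
def isStar : Option KdC → Bool
  | some .star => true
  | _ => false

theorem eq_of_isStar {o : Option KdC} (h : isStar o = true) : o = some .star := by
  unfold isStar at h
  split at h
  · rfl
  · cases h

mutual

/-- Check that a kind is well formed; only the first `n` constants may occur. -/
def KdC.ok (n : ℕ) : ℕ → CtxC → KdC → Bool
  | 0, _, _ => false
  | _ + 1, _, .star => true
  | k + 1, G, .piTm T κ => isStar (T.kind n k G) && κ.ok n k (.tm T :: G)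
  | k + 1, G, .piTy κ κ' => κ.ok n k G && κ'.ok n k (.ty κ :: G)

/-- Infer the kind of a type constructor. -/
def TyC.kind (n : ℕ) : ℕ → CtxC → TyC → Option KdC
  | 0, _, _ => none
  | _ + 1, G, .var i => CtxC.lookupTy G i
  | _ + 1, _, .cst c =>
    match c.decl with
    | .ty _ A => guardSome (Nat.blt c.idx n) A.lamKind
    | .tm .. => none
  | k + 1, G, .allTy κ T => guardSome (κ.ok n k G && isStar (T.kind n k (.ty κ :: G))) .star
  | k + 1, G, .allTm S T | k + 1, G, .pi S T | k + 1, G, .iota S T =>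
    guardSome (isStar (S.kind n k G) && isStar (T.kind n k (.tm S :: G))) .star
  | k + 1, G, .lamTm S T =>
    match T.kind n k (.tm S :: G) with
    | some κ => guardSome (isStar (S.kind n k G)) (.piTm S κ)
    | none => none
  | k + 1, G, .lamTy κ T =>
    match T.kind n k (.ty κ :: G) with
    | some κ' => guardSome (κ.ok n k G) (.piTy κ κ')
    | none => none
  | k + 1, G, .appTm T t =>
    match T.kind n k G with
    | some (.piTm S κ) => guardSome (t.check n k G S) (κ.instTm t)
    | _ => none
  | k + 1, G, .appTy T A =>
    match T.kind n k G, A.kind n k G with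
    | some (.piTy κ₂ κ₁), some κ => guardSome (κ₂.conv 200 κ) (κ₁.instTy A)
    | _, _ => none
  | _ + 1, G, .eq t u => guardSome (t.inScope n G && u.inScope n G) .star

/-- Synthesize the type of a term. -/
def TmC.synth (n : ℕ) : ℕ → CtxC → TmC → Option TyC
  | 0, _, _ => none
  | _ + 1, G, .var i => CtxC.lookupTm G i
  | _ + 1, _, .cst c =>
    match c.decl with
    | .ty .. => none
    | .tm _ A _ _ => guardSome (Nat.blt c.idx n) A
  | k + 1, G, .app t u =>
    match (t.synth n k G).map (TyC.whnf 50) with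
    | some (.pi S T) => guardSome (u.check n k G S) (T.instTm u)
    | _ => none
  | k + 1, G, .appTy t A =>
    match (t.synth n k G).map (TyC.whnf 50), A.kind n k G with
    | some (.allTy κ T), some κ' => guardSome (κ'.conv 200 κ) (T.instTy A)
    | _, _ => none
  | k + 1, G, .appE t u =>
    match (t.synth n k G).map (TyC.whnf 50) with
    | some (.allTm S T) => guardSome (u.check n k G S) (T.instTm u)
    | _ => none
  | k + 1, G, .chi T t => guardSome (isStar (T.kind n k G) && t.check n k G T) T
  | k + 1, G, .fst t =>
    match (t.synth n k G).map (TyC.whnf 50) with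
    | some (.iota S _) => some S
    | _ => none
  | k + 1, G, .snd t =>
    match (t.synth n k G).map (TyC.whnf 50) with
    | some (.iota _ T) => some (T.instTm (.fst t))
    | _ => none
  | k + 1, G, .sym t =>
    match (t.synth n k G).map (TyC.whnf 50) with
    | some (.eq t₁ t₂) => some (.eq t₂ t₁)
    | _ => none
  | _, _, _ => none

/-- Check a term against a type. -/
def TmC.check (n : ℕ) : ℕ → CtxC → TmC → TyC → Bool
  | 0, _, _, _ => false
  | k + 1, G, .lam t, A =>
    match A.whnf 50 with
    | .pi S T => t.check n k (.tm S :: G) T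
    | _ => false
  | k + 1, G, .lamTy t, A =>
    match A.whnf 50 with
    | .allTy κ T => t.check n k (.ty κ :: G) T
    | _ => false
  | k + 1, G, .lamE t, A =>
    match A.whnf 50 with
    | .allTm S T => t.check n k (.tm S :: G) T && !t.free 0
    | _ => false
  | k + 1, G, .letIn S t u, A =>
    isStar (S.kind n k G) && (t.check n k G S && u.check n k (.tm S :: G) A.wkTm)
  | k + 1, G, .pair t u, A =>
    match A.whnf 50 with
    | .iota S T => t.check n k G S && (u.check n k G (T.instTm t) && t.eqv u)
    | _ => false
  | _ + 1, G, .beta t, A =>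
    match A.whnf 50 with
    | .eq t₁ t₂ => t.inScope n G && t₁.eqv t₂
    | _ => false
  | k + 1, G, .rho t T u, A =>
    match (t.synth n k G).map (TyC.whnf 50) with
    | some (.eq t₁ t₂) =>
      isStar ((T.instTm t₂).kind n k G) &&
        (u.check n k G (T.instTm t₂) && (T.instTm t₁).conv 200 A)
    | _ => false
  | k + 1, G, .phi t u w, A => t.check n k G (.eq u w) && (u.check n k G A && w.inScope n G)
  | k + 1, G, t, A =>
    match t.synth n k G with
    | some B => B.conv 200 A
    | none => false

end

/-! ### Soundness of the type checker -/

/-- The constant has the kind or type that the signature lists. -/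
def Const.Accepted (c : Const) : Prop :=
  match c.decl with
  | .ty T A => ∀ Γ, TyKind Γ T A.lamKind.den
  | .tm t A _ _ => ∀ Γ, Synth Γ t A.den

theorem TyC.reds_of_map_whnf {o : Option TyC} {B : TyC} (h : o.map (TyC.whnf 50) = some B) :
    ∃ A, o = some A ∧ Reds A.den B.den := by
  obtain ⟨A, rfl, rfl⟩ := Option.map_eq_some_iff.mp h
  exact ⟨A, rfl, A.reds_whnf 50⟩

theorem TyC.reds_of_whnf {A B : TyC} (h : A.whnf 50 = B) : Reds A.den B.den :=
  h ▸ A.reds_whnf 50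

/-- What the checker establishes in contexts over `Δ` at recursion depth `k`. -/
structure Sound (n k : ℕ) (Δ : Ctx) : Prop where
  ok : ∀ {G : CtxC} {κ : KdC}, κ.ok n k G = true → KdOk (CtxC.den Δ G) κ.den
  kind : ∀ {G : CtxC} {T : TyC} {κ : KdC}, T.kind n k G = some κ →
    TyKind (CtxC.den Δ G) T.den κ.den
  synth : ∀ {G : CtxC} {t : TmC} {A : TyC}, t.synth n k G = some A →
    Synth (CtxC.den Δ G) t.den A.den
  check : ∀ {G : CtxC} {t : TmC} {A : TyC}, t.check n k G A = true →
    Check (CtxC.den Δ G) t.den A.den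

theorem Sound.isStar {n k : ℕ} {Δ : Ctx} (ih : Sound n k Δ) {G : CtxC} {T : TyC}
    (h : CDLE.isStar (T.kind n k G) = true) : TyKind (CtxC.den Δ G) T.den .star :=
  ih.kind (eq_of_isStar h)

theorem Sound.ok_succ {n k : ℕ} {Δ : Ctx} (ih : Sound n k Δ) {G : CtxC} {κ : KdC}
    (h : κ.ok n (k + 1) G = true) : KdOk (CtxC.den Δ G) κ.den := by
  cases κ <;> simp only [KdC.ok, Bool.and_eq_true] at h
  · exact .star
  · exact .piTm (ih.isStar h.1) (ih.ok h.2)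
  · exact .piTy (ih.ok h.1) (ih.ok h.2)

theorem Sound.kind_succ {n k : ℕ} {Δ : Ctx} (H : ∀ c : Const, c.idx < n → c.Accepted)
    (ih : Sound n k Δ) {G : CtxC} {T : TyC} {κ : KdC} (h : T.kind n (k + 1) G = some κ) :
    TyKind (CtxC.den Δ G) T.den κ.den := by
  cases T with
  | var i => exact .var (CtxC.hasTy Δ h)
  | cst c =>
    simp only [TyC.kind] at h
    split at h
    · next T A hd =>
      obtain ⟨hc, rfl⟩ := guardSome_eq_some.mp h
      have := H c (Nat.blt_eq.mp hc)
      simp only [Const.Accepted, hd] at this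
      simpa [TyC.den, Const.tyVal, hd] using this _
    · cases h
  | allTy κ T =>
    obtain ⟨hg, rfl⟩ := guardSome_eq_some.mp h
    have hg := (Bool.and_eq_true _ _).mp hg
    exact .allTy (ih.ok hg.1) (ih.isStar hg.2)
  | allTm S T =>
    obtain ⟨hg, rfl⟩ := guardSome_eq_some.mp h
    have hg := (Bool.and_eq_true _ _).mp hg
    exact .allTm (ih.isStar hg.1) (ih.isStar hg.2)
  | pi S T =>
    obtain ⟨hg, rfl⟩ := guardSome_eq_some.mp h
    have hg := (Bool.and_eq_true _ _).mp hg
    exact .pi (ih.isStar hg.1) (ih.isStar hg.2)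
  | iota S T =>
    obtain ⟨hg, rfl⟩ := guardSome_eq_some.mp h
    have hg := (Bool.and_eq_true _ _).mp hg
    exact .iota (ih.isStar hg.1) (ih.isStar hg.2)
  | lamTm S T =>
    simp only [TyC.kind] at h
    split at h
    · next hT =>
      obtain ⟨hg, rfl⟩ := guardSome_eq_some.mp h
      exact .lamTm (ih.isStar hg) (ih.kind hT)
    · cases h
  | lamTy κ T =>
    simp only [TyC.kind] at h
    split at h
    · next hT =>
      obtain ⟨hg, rfl⟩ := guardSome_eq_some.mp h
      exact .lamTy (ih.ok hg) (ih.kind hT)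
    · cases h
  | appTm T t =>
    simp only [TyC.kind] at h
    split at h
    · next hT =>
      obtain ⟨hg, rfl⟩ := guardSome_eq_some.mp h
      rw [KdC.den_instTm]
      exact .appTm (ih.kind hT) (ih.check hg)
    · cases h
  | appTy T A =>
    simp only [TyC.kind] at h
    split at h
    · next hT hA =>
      obtain ⟨hg, rfl⟩ := guardSome_eq_some.mp h
      rw [KdC.den_instTy]
      exact .appTy (ih.kind hT) (ih.kind hA) (KdC.den_conv hg)
    · cases h
  | eq t u =>
    obtain ⟨hg, rfl⟩ := guardSome_eq_some.mp h
    have hg := (Bool.and_eq_true _ _).mp hg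
    exact .eq (TmC.den_inScope Δ hg.1) (TmC.den_inScope Δ hg.2)

theorem Sound.synth_succ {n k : ℕ} {Δ : Ctx} (H : ∀ c : Const, c.idx < n → c.Accepted)
    (ih : Sound n k Δ) {G : CtxC} {t : TmC} {A : TyC} (h : t.synth n (k + 1) G = some A) :
    Synth (CtxC.den Δ G) t.den A.den := by
  cases t with
  | var i => exact .var (CtxC.hasTm Δ h)
  | cst c =>
    simp only [TmC.synth] at h
    split at h
    · cases h
    · next t A u e hd =>
      obtain ⟨hc, rfl⟩ := guardSome_eq_some.mp h
      have := H c (Nat.blt_eq.mp hc)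
      simp only [Const.Accepted, hd] at this
      simpa [TmC.den, Const.tmVal, hd] using this _
  | app t u =>
    simp only [TmC.synth] at h
    split at h
    · next ht =>
      obtain ⟨hg, rfl⟩ := guardSome_eq_some.mp h
      obtain ⟨B, hB, r⟩ := TyC.reds_of_map_whnf ht
      rw [TyC.den_instTm]
      exact .app (ih.synth hB) r (ih.check hg)
    · cases h
  | appE t u =>
    simp only [TmC.synth] at h
    split at h
    · next ht =>
      obtain ⟨hg, rfl⟩ := guardSome_eq_some.mp h
      obtain ⟨B, hB, r⟩ := TyC.reds_of_map_whnf ht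
      rw [TyC.den_instTm]
      exact .appE (ih.synth hB) r (ih.check hg)
    · cases h
  | appTy t T =>
    simp only [TmC.synth] at h
    split at h
    · next ht hT =>
      obtain ⟨hg, rfl⟩ := guardSome_eq_some.mp h
      obtain ⟨B, hB, r⟩ := TyC.reds_of_map_whnf ht
      rw [TyC.den_instTy]
      exact .appTy (ih.synth hB) r (ih.kind hT) (KdC.den_conv hg)
    · cases h
  | chi T t =>
    obtain ⟨hg, rfl⟩ := guardSome_eq_some.mp h
    have hg := (Bool.and_eq_true _ _).mp hg
    exact .chi (ih.isStar hg.1) (ih.check hg.2)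
  | fst t =>
    simp only [TmC.synth] at h
    split at h
    · next ht =>
      cases h
      obtain ⟨B, hB, r⟩ := TyC.reds_of_map_whnf ht
      exact .fst (ih.synth hB) r
    · cases h
  | snd t =>
    simp only [TmC.synth] at h
    split at h
    · next ht =>
      cases h
      obtain ⟨B, hB, r⟩ := TyC.reds_of_map_whnf ht
      rw [TyC.den_instTm]
      exact .snd (ih.synth hB) r
    · cases h
  | sym t =>
    simp only [TmC.synth] at h
    split at h
    · next ht =>
      cases h
      obtain ⟨B, hB, r⟩ := TyC.reds_of_map_whnf ht
      exact .sym (ih.synth hB) r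
    · cases h
  | _ => cases h

theorem Sound.check_succ {n k : ℕ} {Δ : Ctx} (ih : Sound n k Δ) {G : CtxC} {t : TmC} {A : TyC}
    (h : t.check n (k + 1) G A = true) : Check (CtxC.den Δ G) t.den A.den := by
  cases t with
  | lam t =>
    simp only [TmC.check] at h
    split at h
    · next hA => exact .lam (TyC.reds_of_whnf hA) (ih.check h)
    · cases h
  | lamTy t =>
    simp only [TmC.check] at h
    split at h
    · next hA => exact .lamTy (TyC.reds_of_whnf hA) (ih.check h)
    · cases h
  | lamE t =>
    simp only [TmC.check] at h
    split at h
    · next hA =>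
      simp only [Bool.and_eq_true, Bool.not_eq_true'] at h
      refine .lamE (TyC.reds_of_whnf hA) (ih.check h.1) fun hf => ?_
      rw [t.free_of_free_erase hf] at h
      exact absurd h.2 (by simp)
    · cases h
  | letIn S t u =>
    simp only [TmC.check, Bool.and_eq_true] at h
    refine .letIn (ih.isStar h.1) (ih.check h.2.1) ?_
    have := ih.check h.2.2
    rwa [TyC.wkTm, TyC.den_rename] at this
  | pair t u =>
    simp only [TmC.check] at h
    split at h
    · next hA =>
      simp only [Bool.and_eq_true] at h
      have hu := ih.check h.2.1
      rw [TyC.den_instTm] at hu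
      exact .pair (TyC.reds_of_whnf hA) (ih.check h.1) hu (TmC.den_eqv h.2.2)
    · cases h
  | beta t =>
    simp only [TmC.check] at h
    split at h
    · next hA =>
      simp only [Bool.and_eq_true] at h
      exact .beta (TyC.reds_of_whnf hA) (TmC.den_inScope Δ h.1) (TmC.den_eqv h.2)
    · cases h
  | rho t T u =>
    simp only [TmC.check] at h
    split at h
    · next ht =>
      simp only [Bool.and_eq_true] at h
      obtain ⟨B, hB, r⟩ := TyC.reds_of_map_whnf ht
      have h₁ := ih.isStar h.1
      have h₂ := ih.check h.2.1
      have h₃ := TyC.den_conv h.2.2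
      rw [TyC.den_instTm] at h₁ h₂ h₃
      exact .rho (ih.synth hB) r h₁ h₂ h₃
    · cases h
  | phi t u w =>
    simp only [TmC.check, Bool.and_eq_true] at h
    exact .phi (ih.check h.1) (ih.check h.2.1) (TmC.den_inScope Δ h.2.2)
  | _ =>
    simp only [TmC.check] at h
    split at h
    · next hB => exact .conv (ih.synth hB) (TyC.den_conv h)
    · cases h

theorem sound {n : ℕ} (H : ∀ c : Const, c.idx < n → c.Accepted) (k : ℕ) (Δ : Ctx) :
    Sound n k Δ := by
  induction k with
  | zero =>
    refine ⟨fun h => ?_, fun h => ?_, fun h => ?_, fun h => ?_⟩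
    · simp [KdC.ok] at h
    · simp [TyC.kind] at h
    · simp [TmC.synth] at h
    · simp [TmC.check] at h
  | succ k ih => exact ⟨ih.ok_succ, ih.kind_succ H, ih.synth_succ H, ih.check_succ⟩

/-- Check a type constructor against the kind `T.lamKind`. -/
def TyC.checkLam (n k : ℕ) : CtxC → TyC → Bool
  | G, .lamTm T U => isStar (T.kind n k G) && U.checkLam n k (.tm T :: G)
  | G, .lamTy κ T => κ.ok n k G && T.checkLam n k (.ty κ :: G)
  | G, T => isStar (T.kind n k G)

theorem TyC.tyKind_lamKind {n k : ℕ} (H : ∀ c : Const, c.idx < n → c.Accepted) (Δ : Ctx) :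
    ∀ {G : CtxC} {T : TyC}, T.checkLam n k G = true →
      TyKind (CtxC.den Δ G) T.den T.lamKind.den
  | _, .lamTm T U, h => by
    have h := (Bool.and_eq_true _ _).mp h
    exact .lamTm ((sound H k Δ).isStar h.1) (tyKind_lamKind H Δ h.2)
  | _, .lamTy κ T, h => by
    have h := (Bool.and_eq_true _ _).mp h
    exact .lamTy ((sound H k Δ).ok h.1) (tyKind_lamKind H Δ h.2)
  | _, .var _, h | _, .cst _, h | _, .allTy _ _, h | _, .allTm _ _, h | _, .pi _ _, h
  | _, .appTm _ _, h | _, .appTy _ _, h | _, .iota _ _, h | _, .eq _ _, h =>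
    (sound H k Δ).isStar h

/-- Check the entry of a constant in the signature. -/
def Const.check (c : Const) : Bool :=
  match c.decl with
  | .ty _ A => A.checkLam c.idx 100 []
  | .tm _ A u _ => isStar (A.kind c.idx 100 []) && u.check c.idx 100 [] A

set_option maxHeartbeats 4000000 in
theorem Const.check_eq_true (c : Const) : c.check = true := by
  cases c <;> decide +kernel

theorem Const.accepted (c : Const) : c.Accepted := by
  induction hc : c.idx using Nat.strong_induction_on generalizing c with
  | _ n ih =>
    subst hc
    have H : ∀ d : Const, d.idx < c.idx → d.Accepted := fun d hd => ih d.idx hd d rfl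
    have h₁ := c.check_eq_true
    have h₂ := decl_den c
    unfold Const.check at h₁
    unfold Const.Accepted
    cases hd : c.decl with
    | ty T A =>
      rw [hd] at h₁ h₂
      obtain rfl : T = A.den := h₂
      exact fun Γ => TyC.tyKind_lamKind H Γ h₁
    | tm t A u e =>
      rw [hd] at h₁ h₂
      obtain rfl : t = .chi A.den u.den := h₂
      have h₁ := (Bool.and_eq_true _ _).mp h₁
      exact fun Γ => .chi ((sound H 100 Γ).isStar h₁.1) ((sound H 100 Γ).check h₁.2)

/-- A definition in the signature is accepted. -/
theorem Const.defn {c : Const} {t : Tm} {A : TyC} {u : TmC} {e : Pure}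
    (hd : c.decl = .tm t A u e) : Defn u.den A.den := by
  have h := c.check_eq_true
  simp only [Const.check, hd, Bool.and_eq_true] at h
  have S := sound (n := c.idx) (fun d _ => d.accepted) 100 []
  exact ⟨S.isStar h.1, S.check h.2⟩

/-! ### Scott-encoded values have the type of the Lepigre-Raffalli encoding -/

theorem ConvKd.scheme : ConvKd CDLE.scheme CDLE.scheme := .piTy .star .star

theorem View_reds (T : Ty) (t : Tm) :
    Reds (View ⬝ₜ T ⬝ t) (.iota T (.eq (v 0) t.wkTm)) := by
  have h : (Ty.lamTm Top (.iota T.wkTm (.eq (v 0) (v 1)))).appTm t =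
      (Ty.lamTm Top (.iota (V 0) (.eq (v 0) (v 1)))).instTy T ⬝ t := rfl
  have h' : (Ty.iota T.wkTm (.eq (v 0) (v 1))).instTm t = .iota T (.eq (v 0) t.wkTm) :=
    congrArg (Ty.iota · _) (T.wkTm_instTm t)
  refine .trans (.single (.appTm t (.betaTy _ _ _))) ?_
  rw [← h, ← h']
  exact .single (.betaTm _ _ _)

theorem Cast_reds (S T : Ty) :
    Reds (Cast ⬝ₜ S ⬝ₜ T) (.iota (S ⟶ₜ T) (.eq (v 0) (.beta idTm))) := by
  have h : (Ty.lamTy .star (View ⬝ₜ (S.wkTy ⟶ₜ V 0) ⬝ .beta idTm)) ⬝ₜ T =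
      (Ty.lamTy .star (View ⬝ₜ (V 1 ⟶ₜ V 0) ⬝ .beta idTm)).instTy S ⬝ₜ T := rfl
  have h' : (View ⬝ₜ (S.wkTy ⟶ₜ V 0) ⬝ .beta idTm).instTy T = View ⬝ₜ (S ⟶ₜ T) ⬝ .beta idTm :=
    congrArg (fun S' => View ⬝ₜ (S' ⟶ₜ T) ⬝ .beta idTm) (S.wkTy_instTy T)
  refine .trans (.single (.appTy T (.betaTy _ _ _))) ?_
  rw [← h]
  refine .trans (.single (.betaTy _ _ _)) ?_
  rw [h']
  exact View_reds _ _

theorem Const.subst_tyVal (c : Const) (s : Sub) : c.tyVal.subst s = c.tyVal :=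
  c.tyVal.subst_of_scoped s.fixes_zero c.scoped.1

theorem toD_synth {Γ : Ctx} {F : Ty} {m : Tm} (hF : TyKind Γ F scheme)
    (hm : Check Γ m (Mono ⬝ₜ F)) :
    Synth Γ (toD ⋆ₜ F ⋆ₑ m) (Cast ⬝ₜ (ScottD ⬝ₜ F) ⬝ₜ (LRD ⬝ₜ F ⬝ m)) := by
  have hMono (s : Sub) : Mono.subst s = Mono := Const.subst_tyVal .Mono s
  have hCast (s : Sub) : Cast.subst s = Cast := Const.subst_tyVal .Cast s
  have hScottD (s : Sub) : ScottD.subst s = ScottD := Const.subst_tyVal .ScottD s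
  have hLRD (s : Sub) : LRD.subst s = LRD := Const.subst_tyVal .LRD s
  have e : (Ty.allTm (Mono ⬝ₜ V 0) (Cast ⬝ₜ (ScottD ⬝ₜ V 0) ⬝ₜ (LRD ⬝ₜ V 0 ⬝ v 0))).instTy F =
      .allTm (Mono ⬝ₜ F) (Cast ⬝ₜ (ScottD ⬝ₜ F.wkTm) ⬝ₜ (LRD ⬝ₜ F.wkTm ⬝ v 0)) := by
    simp only [Ty.instTy, Ty.subst, Tm.subst, hMono, hCast, hScottD, hLRD]
    rfl
  have e' : (Cast ⬝ₜ (ScottD ⬝ₜ F.wkTm) ⬝ₜ (LRD ⬝ₜ F.wkTm ⬝ v 0)).instTm m =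
      Cast ⬝ₜ (ScottD ⬝ₜ F) ⬝ₜ (LRD ⬝ₜ F ⬝ m) := by
    have hF := F.wkTm_instTm m
    simp only [Ty.instTm] at hF
    simp only [Ty.instTm, Ty.subst, Tm.subst, hCast, hScottD, hLRD, hF]
    rfl
  have h := Synth.appTy (Const.accepted .toD Γ) .refl hF .scheme
  rw [e] at h
  exact e' ▸ h.appE .refl hm

theorem scottD_inclusion {Γ : Ctx} {F : Ty} {m s : Tm} (hF : TyKind Γ F scheme)
    (hm : Check Γ m (Mono ⬝ₜ F)) (hs : Check Γ s (ScottD ⬝ₜ F)) :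
    ∃ s' : Tm, Synth Γ s' (LRD ⬝ₜ F ⬝ m) ∧ s'.Eqv s := by
  refine ⟨.fst (toD ⋆ₜ F ⋆ₑ m) ⋆ s, ?_, ?_⟩
  · have h := Synth.app (.fst (toD_synth hF hm) (Cast_reds _ _)) .refl hs
    rwa [Ty.wkTm_instTm] at h
  · exact .trans (.app (decl_erase .toD) (.refl _)) (.beta _ _)

end CDLE

theorem mainTheorem8 :
    (∃ toD : CDLE.Tm, CDLE.Defn toD CDLE.ToDType) ∧
    (∀ (Γ : CDLE.Ctx) (F : CDLE.Ty) (m s : CDLE.Tm),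
      CDLE.TyKind Γ F CDLE.scheme →
      CDLE.Check Γ m (CDLE.Mono ⬝ₜ F) →
      CDLE.Check Γ s (CDLE.ScottD ⬝ₜ F) →
      ∃ s' : CDLE.Tm, CDLE.Synth Γ s' (CDLE.LRD ⬝ₜ F ⬝ m) ∧ s'.Eqv s) ∧
    (∃ indLRD : CDLE.Tm, CDLE.Defn indLRD CDLE.IndLRDType) ∧
    (∃ indD : CDLE.Tm, CDLE.Defn indD CDLE.IndDType) :=
  ⟨⟨_, CDLE.Const.defn (c := .toD) rfl⟩,
    fun _ _ _ _ hF hm hs => CDLE.scottD_inclusion hF hm hs,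
    ⟨_, CDLE.Const.defn (c := .indLRD) rfl⟩, ⟨_, CDLE.Const.defn (c := .indD) rfl⟩⟩
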